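/- Multigraphs here are loopless, have a non-empty countable vertex set and finite edge multiplicities, and are considered up to (root-preserving) isomorphism; no local finiteness is assumed. Fix $\lambda>0$. Given a rooted connected multigraph $(G,o)$, the \emph{full process} with parameter $\lambda$ is the following continuous-time evolution: it starts from $(G,o)$; each vertex lives for an independent $\mathrm{Exp}(1)$ time and is then replaced by two new vertices $v_1,v_2$; at that moment $\mathrm{Poisson}(\lambda/2)$ edges are added between $v_1$ and $v_2$, each edge $uv$ at the split vertex $v$ is replaced by $uv_1$ or $uv_2$ with probability $1/2$ each, and if $v$ was the root, the new root is $v_1$ or $v_2$ with probability $1/2$ each; all these choices are independent. The \emph{cluster process} $(G_t,o_t)_{t\ge 0}$ is the component of the root in the full process at time $t$. If $(G,o)$ is random, it is taken independent of the evolution. For $t>0$ let $T(t)$ be the random rooted binary tree obtained from a single root vertex by giving each vertex, at its creation, an independent $\mathrm{Exp}(1)$ clock, adding two children to a vertex when its clock rings, and stopping at time $t$. Let $T$ be the random infinite tree consisting of a path $v_0v_1v_2\cdots$ whose edges $v_{i-1}v_i$ carry i.i.d. $\mathrm{Exp}(1)$ labels $s_i$, $i\ge1$, together with, for each $i\ge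 1$, a copy of $T(s_1+\dots+s_i)$ (conditionally independent given the labels) whose root is joined to $v_i$ by an edge. Conditionally on $T$, place $\mathrm{Poisson}(2^{1-d_T(x,y)}\lambda)$ edges between each pair of distinct leaves $x,y$ of $T$, independently, where $d_T$ is the graph distance in $T$; let $(M(\lambda),o)$ be the component of $v_0$ in this random multigraph, rooted at $o=v_0$. \textbf{Theorem.} Let $\lambda>0$. (i) There is exactly one distribution of a random rooted connected multigraph $(M,o)$ with finite expected root degree which is invariant under the cluster process, that is, such that $(M_t,o_t)$ has the same distribution as $(M,o)$ for every $t\ge 0$. It is the distribution of $(M(\lambda),o)$. (ii) $M(\lambda)$ is almost surely finite. (iii) Let $(G^\circ_t,o_t)$ be the cluster process started from a single vertex. As $t\to\infty$, $(G^\circ_t,o_t)$ converges in distribution to $(M(\lambda),o)$; more precisely, $\mathbb P\big((G^\circ_t,o_t)\in\mathcal S\big)\to\mathbb P\big((M(\lambda),o)\in\mathcal S\big)$ for every set $\mathcal S$ of isomorphism classes of rooted connected multigraphs. -/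

import Mathlib

open MeasureTheory ProbabilityTheory Filter Topology
open scoped NNReal ENNReal

/-! ### Rooted multigraphs -/

/-- A rooted loopless multigraph whose vertices are elements of the label type `V`; `mult x y` is
the (finite) number of parallel edges between `x` and `y`. Degrees are allowed to be infinite. -/
structure RootedMultigraph (V : Type) where
  verts : Set V
  mult : V → V → ℕ
  root : V
  root_mem : root ∈ verts
  mult_comm : ∀ x y, mult x y = mult y x
  mult_self : ∀ x, mult x x = 0
  mem_of_mult : ∀ x y, mult x y ≠ 0 → x ∈ verts

namespace RootedMultigraph

variable {V W : Type}

/-- `x` is joined to the root by a path. -/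
def Reachable (G : RootedMultigraph V) (x : V) : Prop :=
  Relation.ReflTransGen (fun a b => G.mult a b ≠ 0) G.root x

def Connected (G : RootedMultigraph V) : Prop :=
  ∀ x ∈ G.verts, G.Reachable x

open scoped Classical in
/-- The component of the root. -/
noncomputable def component (G : RootedMultigraph V) : RootedMultigraph V where
  verts := {x | G.Reachable x}
  mult x y := if G.Reachable x ∧ G.Reachable y then G.mult x y else 0
  root := G.root
  root_mem := Relation.ReflTransGen.refl
  mult_comm x y := by simp only [and_comm, G.mult_comm x y]
  mult_self x := by simp [G.mult_self x]
  mem_of_mult x y h := by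
    by_contra hx
    exact h (if_neg fun h' => hx h'.1)

/-- The degree of the root, counted with multiplicity. -/
noncomputable def rootDegree (G : RootedMultigraph V) : ℝ≥0∞ :=
  ∑' x, (G.mult G.root x : ℝ≥0∞)

/-- Root-preserving isomorphism. -/
def Iso (G : RootedMultigraph V) (H : RootedMultigraph W) : Prop :=
  ∃ f : G.verts ≃ H.verts,
    (f ⟨G.root, G.root_mem⟩ : W) = H.root ∧
      ∀ x y : G.verts, H.mult (f x) (f y) = G.mult x y

/-- Renaming of the labels. -/
def relabel (e : V ≃ W) (G : RootedMultigraph V) : RootedMultigraph W where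
  verts := {x | e.symm x ∈ G.verts}
  mult x y := G.mult (e.symm x) (e.symm y)
  root := e G.root
  root_mem := by simpa using G.root_mem
  mult_comm _ _ := G.mult_comm _ _
  mult_self _ := G.mult_self _
  mem_of_mult _ _ h := G.mem_of_mult _ _ h

/-- The graph with a single vertex. -/
def single (o : V) : RootedMultigraph V where
  verts := {o}
  mult _ _ := 0
  root := o
  root_mem := rfl
  mult_comm _ _ := rfl
  mult_self _ := rfl
  mem_of_mult _ _ h := absurd rfl h

/-- The σ-algebra generated by the root, the vertex set and the edge multiplicities. -/
instance : MeasurableSpace (RootedMultigraph ℕ) :=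
  MeasurableSpace.comap
    (fun G => ((G.root, G.verts, G.mult) : ℕ × Set ℕ × (ℕ → ℕ → ℕ))) inferInstance

instance isoSetoid : Setoid (RootedMultigraph ℕ) where
  r G H := G.Iso H
  iseqv :=
    { refl := fun _ => ⟨Equiv.refl _, rfl, fun _ _ => rfl⟩
      symm := by
        rintro G H ⟨f, hr, hm⟩
        refine ⟨f.symm, ?_, fun x y => ?_⟩
        · have h : f ⟨G.root, G.root_mem⟩ = ⟨H.root, H.root_mem⟩ := Subtype.ext hr
          rw [← h, Equiv.symm_apply_apply]
        · rw [← hm, Equiv.apply_symm_apply, Equiv.apply_symm_apply]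
      trans := by
        rintro G H K ⟨f, hr, hm⟩ ⟨g, hr', hm'⟩
        refine ⟨f.trans g, ?_, fun x y => ?_⟩
        · have h : f ⟨G.root, G.root_mem⟩ = ⟨H.root, H.root_mem⟩ := Subtype.ext hr
          rw [Equiv.trans_apply, h, hr']
        · rw [Equiv.trans_apply, Equiv.trans_apply, hm', hm] }

end RootedMultigraph

/-- Isomorphism classes of countable rooted multigraphs. It carries the quotient σ-algebra: its
measurable sets are the isomorphism-invariant measurable sets of graphs labelled by `ℕ`. -/
abbrev MultigraphClass : Type := Quotient RootedMultigraph.isoSetoid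

/-- The isomorphism class of a rooted multigraph on a countable label type. -/
noncomputable def RootedMultigraph.isoClass {V : Type} [Countable V] [Infinite V]
    (G : RootedMultigraph V) : MultigraphClass :=
  ⟦G.relabel (Classical.choice (inferInstance : Nonempty (V ≃ ℕ)))⟧

def MultigraphClass.IsFinite (c : MultigraphClass) : Prop :=
  ∃ G : RootedMultigraph ℕ, G.verts.Finite ∧ ⟦G⟧ = c

/-! ### Genealogy

The vertices descending from an initial vertex `a` are the pairs `(a, w)` with `w` a binary word:
`(a, [])` is `a` itself, and `(a, w)` splits into `(a, w ++ [false])` and `(a, w ++ [true])`. -/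

abbrev Word : Type := List Bool

/-- The time at which `(a, w)` is created, when `clock (a, w)` is the lifetime of `(a, w)`. -/
def birthTime (clock : ℕ × Word → ℝ) (a : ℕ) (w : Word) : ℝ :=
  ∑ k ∈ Finset.range w.length, clock (a, w.take k)

def splitTime (clock : ℕ × Word → ℝ) (a : ℕ) (w : Word) : ℝ :=
  birthTime clock a w + clock (a, w)

def Alive (clock : ℕ × Word → ℝ) (t : ℝ) (x : ℕ × Word) : Prop :=
  birthTime clock x.1 x.2 ≤ t ∧ t < splitTime clock x.1 x.2

/-- The first `n` letters of an infinite binary sequence. -/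
def initialWord (c : ℕ → Bool) (n : ℕ) : Word := (List.range n).map c

/-- Going from `p` towards its descendants, and choosing the successive children according to `c`,
one passes through `w`. -/
def Follows (p : Word) (c : ℕ → Bool) (w : Word) : Prop :=
  ∃ n : ℕ, w = p ++ initialWord c n

/-! ### The full process and the cluster process -/

/-- The objects that choose one of the two children at each split: the root; for `old a b k`,
the end at a descendant of `a` of the `k`-th initial edge between `a` and `b`; for
`new a p i d`, that end of the `i`-th edge created by the split of `(a, p)` which lies at a
descendant of the child `(a, p ++ [d])`. -/
inductive Walker : Type
  | root : Walker
  | old (a b k : ℕ) : Walker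
  | new (a : ℕ) (p : Word) (i : ℕ) (d : Bool) : Walker

/-- All the randomness of the evolution: the lifetimes of the vertices, the numbers of edges
created at the splits, and the successive choices of the root and of the ends of the edges. -/
abbrev Noise : Type :=
  (ℕ × Word → ℝ) × (ℕ × Word → ℕ) × (Walker → ℕ → Bool)

/-- All these choices are independent; lifetimes are exponential of rate `1`, the numbers of new
edges are Poisson of mean `lam / 2`, and the choices between two children are fair. -/
noncomputable def noiseMeasure (lam : ℝ≥0) : Measure Noise :=
  (Measure.infinitePi fun _ : ℕ × Word => expMeasure 1).prod
    ((Measure.infinitePi fun _ : ℕ × Word => poissonMeasure (lam / 2)).prod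
      (Measure.infinitePi fun _ : Walker =>
        Measure.infinitePi fun _ : ℕ => (PMF.uniformOfFintype Bool).toMeasure))

namespace RootedMultigraph

/-- The labels of the initial edges that join `x` and `y` at time `t`. -/
def oldEdges (G : RootedMultigraph ℕ) (ω : Noise) (x y : ℕ × Word) : Set ℕ :=
  {k | k < G.mult x.1 y.1 ∧ Follows [] (ω.2.2 (.old x.1 y.1 k)) x.2 ∧
    Follows [] (ω.2.2 (.old y.1 x.1 k)) y.2}

/-- The labels of the edges created by splits of descendants of an initial vertex that join `x`
and `y` at a time when both are alive: `(p, i)` stands for the `i`-th edge created by the split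
of `p`. -/
def newEdges (G : RootedMultigraph ℕ) (ω : Noise) (x y : ℕ × Word) : Set (Word × ℕ) :=
  {e | x.1 ∈ G.verts ∧ x.1 = y.1 ∧ e.2 < ω.2.1 (x.1, e.1) ∧
    ∃ d : Bool, Follows (e.1 ++ [d]) (ω.2.2 (.new x.1 e.1 e.2 d)) x.2 ∧
      Follows (e.1 ++ [!d]) (ω.2.2 (.new x.1 e.1 e.2 (!d))) y.2}

/-- The position of the root at time `t`: it has split `n` times by time `t`. -/
noncomputable def rootAt (G : RootedMultigraph ℕ) (ω : Noise) (t : ℝ) : ℕ × Word :=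
  (G.root, initialWord (ω.2.2 .root)
    (sInf {n : ℕ | t < splitTime ω.1 G.root (initialWord (ω.2.2 .root) n)}))

open scoped Classical in
/-- The full process at time `t`, started from `G`. The vertices are the living descendants of the
vertices of `G`. (The root is almost surely one of them; it is inserted so that the definition
makes sense on the null event that the root splits infinitely often before time `t`.) -/
noncomputable def full (G : RootedMultigraph ℕ) (ω : Noise) (t : ℝ) :
    RootedMultigraph (ℕ × Word) where
  verts := insert (G.rootAt ω t) {x | x.1 ∈ G.verts ∧ Alive ω.1 t x}
  mult x y :=
    if Alive ω.1 t x ∧ Alive ω.1 t y then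
      (G.oldEdges ω x y).ncard + (G.newEdges ω x y).ncard
    else 0
  root := G.rootAt ω t
  root_mem := Set.mem_insert _ _
  mult_comm x y := by
    have h1 : G.oldEdges ω x y = G.oldEdges ω y x := by
      ext k
      simp only [oldEdges, Set.mem_ofPred_eq, G.mult_comm x.1 y.1]
      tauto
    have h2 : ∀ x y, G.newEdges ω x y ⊆ G.newEdges ω y x := by
      rintro ⟨a, u⟩ ⟨b, v⟩ e ⟨ha, hab, hi, d, hu, hv⟩
      dsimp only at ha hab hi hu hv
      subst hab
      exact ⟨ha, rfl, hi, !d, hv, by simpa using hu⟩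
    rw [h1, Set.Subset.antisymm (h2 x y) (h2 y x)]
    simp only [and_comm]
  mult_self x := by
    have h1 : G.oldEdges ω x x = ∅ := by
      ext k
      simp [oldEdges, G.mult_self]
    have h2 : G.newEdges ω x x = ∅ := by
      ext ⟨p, i⟩
      simp only [newEdges, Follows, Set.mem_ofPred_eq, Set.mem_empty_iff_false, iff_false]
      rintro ⟨-, -, -, d, ⟨n, hn⟩, ⟨m, hm⟩⟩
      rw [hn, List.append_assoc, List.append_assoc] at hm
      simpa using List.append_cancel_left hm
    simp [h1, h2]
  mem_of_mult x y h := by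
    have hA : Alive ω.1 t x ∧ Alive ω.1 t y := by
      by_contra hA
      exact h (if_neg hA)
    refine Set.mem_insert_of_mem _ ⟨?_, hA.1⟩
    by_contra hx
    have h1 : G.oldEdges ω x y = ∅ := by
      have h0 : G.mult x.1 y.1 = 0 := by
        by_contra h0
        exact hx (G.mem_of_mult _ _ h0)
      ext k
      simp [oldEdges, h0]
    have h2 : G.newEdges ω x y = ∅ := by
      ext e
      simp [newEdges, hx]
    exact h (by simp [h1, h2])

/-- The cluster process at time `t`, started from `G`. -/
noncomputable def cluster (G : RootedMultigraph ℕ) (ω : Noise) (t : ℝ) :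
    RootedMultigraph (ℕ × Word) :=
  (G.full ω t).component

end RootedMultigraph

/-- `ν` is the distribution (up to isomorphism) of a random rooted connected multigraph with finite
expected root degree which is invariant under the cluster process with parameter `lam`; the initial
graph, with distribution `μ`, is independent of the randomness of the evolution. -/
def IsInvariantLaw (lam : ℝ≥0) (ν : Measure MultigraphClass) : Prop :=
  ∃ μ : Measure (RootedMultigraph ℕ),
    IsProbabilityMeasure μ ∧
    (∀ᵐ G ∂μ, G.Connected) ∧
    ∫⁻ G, G.rootDegree ∂μ < ∞ ∧
    (∀ t : ℝ, 0 ≤ t →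
      IdentDistrib
        (fun p : RootedMultigraph ℕ × Noise => (p.1.cluster p.2 t).isoClass)
        (fun G : RootedMultigraph ℕ => G.isoClass)
        (μ.prod (noiseMeasure lam)) μ) ∧
    μ.map RootedMultigraph.isoClass = ν

/-! ### The Poisson edge model on the random tree -/

/-- `x` has exactly one neighbour. -/
def IsLeaf {X : Type} (T : SimpleGraph X) (x : X) : Prop := ∃! y, T.Adj x y

/-- The mean number of edges of the Poisson edge model between the two elements of a pair of leaves
of `T`, namely `2 ^ (1 - d) * lam` where `d` is their distance in `T`. -/
noncomputable def pairRate {X : Type} (lam : ℝ≥0) (T : SimpleGraph X) : Sym2 X → ℝ≥0 :=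
  Sym2.lift ⟨fun x y => 2 * lam / 2 ^ T.dist x y, fun x y => by
    simp only [T.dist_comm]⟩

open scoped Classical in
/-- The multigraph on the leaves of `T` with `N s(x, y)` edges between distinct leaves `x`, `y`. -/
noncomputable def leafGraph {X : Type} (T : SimpleGraph X) (o : X) (ho : IsLeaf T o)
    (N : Sym2 X → ℕ) : RootedMultigraph X where
  verts := {x | IsLeaf T x}
  mult x y := if x ≠ y ∧ IsLeaf T x ∧ IsLeaf T y then N s(x, y) else 0
  root := o
  root_mem := ho
  mult_comm x y := by
    rw [Sym2.eq_swap]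
    congr 1
    simp only [eq_iff_iff]
    tauto
  mult_self x := by simp
  mem_of_mult x y h := by
    by_contra hx
    exact h (if_neg fun h' => hx h'.2.1)

/-- The law of the component of the leaf `o` in the `T`-Poisson edge model with parameter `lam`. -/
noncomputable def poissonClusterLaw {X : Type} [Countable X] [Infinite X] (lam : ℝ≥0)
    (T : SimpleGraph X) (o : X) (ho : IsLeaf T o) : Measure MultigraphClass :=
  (Measure.infinitePi fun e : Sym2 X => poissonMeasure (pairRate lam T e)).map
    fun N => (leafGraph T o ho N).component.isoClass

/-- Possible vertices of the random tree: the vertices `v n` of an infinite path, and the vertices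
`h i w` of a tree whose root `h i []` is attached to `v (i + 1)`. -/
inductive TreeVertex : Type
  | v (n : ℕ) : TreeVertex
  | h (i : ℕ) (w : Word) : TreeVertex

namespace TreeVertex

/-- Parent-child pairs. The label of the edge from `v j` to `v (j + 1)` is `s j`. The tree attached
to `v (i + 1)` is grown until time `s 0 + ⋯ + s i`: a vertex has children precisely if its
clock, started at its creation, rings by that time. -/
inductive Link (s : ℕ → ℝ) (clock : ℕ × Word → ℝ) : TreeVertex → TreeVertex → Prop
  | path (n : ℕ) : Link s clock (v (n + 1)) (v n)
  | attach (i : ℕ) : Link s clock (v (i + 1)) (h i [])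
  | child (i : ℕ) (w : Word) (d : Bool)
      (hw : splitTime clock i w ≤ ∑ j ∈ Finset.range (i + 1), s j) :
      Link s clock (h i w) (h i (w ++ [d]))

/-- The tree with given path labels and given clocks. (Potential vertices that do not belong to the
tree are isolated in this graph, hence not leaves.) -/
def tree (s : ℕ → ℝ) (clock : ℕ × Word → ℝ) : SimpleGraph TreeVertex :=
  SimpleGraph.fromRel (Link s clock)

lemma isLeaf_v_zero (s : ℕ → ℝ) (clock : ℕ × Word → ℝ) : IsLeaf (tree s clock) (v 0) := by
  refine ⟨v 1, ⟨by simp, Or.inr (Link.path 0)⟩, ?_⟩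
  rintro y ⟨-, hy | hy⟩
  · cases hy
  · cases hy
    rfl

/-- `TreeVertex` is a copy of `ℕ ⊕ ℕ × Word`. -/
def equivSum : TreeVertex ≃ ℕ ⊕ ℕ × Word where
  toFun x := match x with
    | v n => Sum.inl n
    | h i w => Sum.inr (i, w)
  invFun x := match x with
    | Sum.inl n => v n
    | Sum.inr (i, w) => h i w
  left_inv x := by cases x <;> rfl
  right_inv x := by rcases x with n | ⟨i, w⟩ <;> rfl

instance : Countable TreeVertex := equivSum.injective.countable

instance : Infinite TreeVertex := Infinite.of_injective v fun _ _ h => by cases h; rfl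

end TreeVertex

/-- The law of the path labels and of the clocks: all are independent and exponential of
rate `1`. -/
noncomputable def treeMeasure : Measure ((ℕ → ℝ) × (ℕ × Word → ℝ)) :=
  (Measure.infinitePi fun _ : ℕ => expMeasure 1).prod
    (Measure.infinitePi fun _ : ℕ × Word => expMeasure 1)

/-- The law of `M(lam)`: the component of `v 0` in the Poisson edge model on the random tree. -/
noncomputable def limitLaw (lam : ℝ≥0) : Measure MultigraphClass :=
  treeMeasure.bind fun θ =>
    poissonClusterLaw lam (TreeVertex.tree θ.1 θ.2) (TreeVertex.v 0)
      (TreeVertex.isLeaf_v_zero θ.1 θ.2)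

/-! The mechanism is Poisson thinning on a branching tree. Start from one vertex. If two living
descendants separated at some split and have since undergone r and s further splits, each of the
Poisson edges of mean lam / 2 born at that split joins them with probability 2^-(r+s), independently
of the tree. The edge numbers at time t are therefore independent Poisson variables of mean lam *
2^-(r+s+1) = 2^(1-d) * lam, where d = r + s + 2 is the distance of the two leaves. The same holds
when the initial graph is already such a model: a split of an end of an initial edge halves the rate
and lengthens the distance by one. So Poisson edge models on trees stay of this type, given the tree
(`map_markCount_eq_infinitePi`, `spineDist_descend`, `Descends.exists_field`,
`measure_cluster_spineGraph`).

It remains to follow the tree as seen from the root. Its shape is encoded by the list of finite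
trees hanging off the path to the root, the oldest first. Reading the split times of the root
backwards from time t gives independent exponential labels, so this list has the law of the trees of
age at most t along the infinite path (`measure_trimmedSpine`). Hence the process started from one
vertex has at time t exactly the law of M(lam) with its tree trimmed at age t
(`measure_cluster_single`). The shapes satisfy the Chapman-Kolmogorov identity
`SpineList.tsum_prob_mul_growProb`.

Trimming is harmless in the limit. By the Kraft inequality, the mean number of edges between the
levels up to i and those above i is at most 2 * lam, whatever the trees, and edges crossing two cuts
i < j simultaneously have mean at most 2 * lam * 2^(i-j). The events that cuts are empty thus have
probabilities bounded below and geometrically decaying covariances, and Chebyshev's inequality shows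
that one of the first n cuts is empty with probability tending to one, uniformly in the trees
(`exists_tendsto_measure_not_emptyCut`). The component of the root stays below an empty cut. This
gives finiteness and convergence (`tendsto_trimmedLaw`). For invariance, trim at age s, run for time
t, obtain the model trimmed at age s + t, and let s tend to infinity
(`measure_cluster_hangingLeaves`).

For uniqueness, run the process from an invariant graph and from its root alone with the same
randomness. The two clusters agree unless an initial edge at the root copies the first n choices of
the root, which has probability at most 2^-n times the degree, or the cluster from the single vertex
contains a vertex outside the descent of the n-th ancestor of the root, which becomes unlikely as t
grows, again by empty cuts (`cluster_eq_single`, `tendsto_measure_strays`). Let t and then n tend to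
infinity. -/

/-! ### Splitting a Poisson number of marked items -/

section PoissonSplitting

open scoped Classical in
/-- The number of the first `z.1` items whose mark lies in `m`. -/
noncomputable def markCount {X : Type*} (m : Set X) (z : ℕ × (ℕ → X)) : ℕ :=
  ((Finset.range z.1).filter fun i => z.2 i ∈ m).card

lemma markCount_eq_sum {X : Type*} (m : Set X) (z : ℕ × (ℕ → X)) :
    markCount m z = ∑ i ∈ Finset.range z.1, m.indicator (fun _ => 1) (z.2 i) := by
  classical
  simp [markCount, Set.indicator_apply]

/-- A Poisson number of items with independent marks. -/
noncomputable def markedPoisson {X : Type*} [MeasurableSpace X] (ρ : ℝ≥0) (β : Measure X) :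
    Measure (ℕ × (ℕ → X)) :=
  (poissonMeasure ρ).prod (Measure.infinitePi fun _ : ℕ => β)

variable {X : Type*} [MeasurableSpace X]

instance (ρ : ℝ≥0) (β : Measure X) [IsProbabilityMeasure β] :
    IsProbabilityMeasure (markedPoisson ρ β) := by
  unfold markedPoisson; infer_instance

lemma measurable_markCount {m : Set X} (hm : MeasurableSet m) :
    Measurable (markCount m) := by
  refine measurable_from_prod_countable_right fun K => ?_
  simp only [markCount_eq_sum]
  exact Finset.measurable_sum _ fun i _ =>
    (measurable_const.indicator hm).comp (measurable_pi_apply i)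

lemma integral_prod_infinitePi (β : Measure X) [IsProbabilityMeasure β] (g : X → ℂ)
    (hg : Measurable g) (K : ℕ) :
    ∫ x : ℕ → X, ∏ i ∈ Finset.range K, g (x i) ∂(Measure.infinitePi fun _ : ℕ => β) =
      (∫ x, g x ∂β) ^ K := by
  have h := integral_restrict_infinitePi (μ := fun _ : ℕ => β) (s := Finset.range K)
    (f := fun y => ∏ i, g (y i)) (by
      refine Measurable.aestronglyMeasurable ?_
      fun_prop)
  rw [integral_fintype_prod_eq_prod (f := fun _ => g)] at h
  simp only [Finset.prod_const, Finset.card_univ, Fintype.card_coe, Finset.card_range] at h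
  rw [← h]
  congr 1 with x
  exact (Finset.prod_coe_sort (Finset.range K) fun i => g (x i)).symm

lemma integral_poisson_pow (ρ : ℝ≥0) (w : ℂ) :
    ∫ K : ℕ, w ^ K ∂(poissonMeasure ρ) = Complex.exp (ρ * (w - 1)) := by
  rw [integral_poissonMeasure]
  calc ∑' n : ℕ, (Real.exp (-ρ) * ρ ^ n / n.factorial) • w ^ n
      = ∑' n : ℕ, (Real.exp (-ρ) : ℂ) * ((ρ * w) ^ n / n.factorial) := by
        congr with n
        rw [Complex.real_smul]
        push_cast
        ring
    _ = (Real.exp (-ρ) : ℂ) * Complex.exp (ρ * w) := by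
        rw [tsum_mul_left, (NormedSpace.expSeries_div_hasSum_exp ((ρ : ℂ) * w)).tsum_eq,
          Complex.exp_eq_exp_ℂ]
    _ = _ := by
        rw [Complex.ofReal_exp, ← Complex.exp_add]
        push_cast
        ring_nf

/-- Since an item lies in at most one of the sets, the exponential of the weighted count is a
product over the items of g = 1 + ∑ 1_{m e} (exp (i t e) - 1). Given K items the expectation is (∫
g)^K, and the Poisson generating function exp (ρ (w - 1)) turns the sum ∫ g - 1 into a product over
e. -/
lemma integral_exp_markCount {ι : Type*} [Fintype ι] (ρ : ℝ≥0) (β : Measure X)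
    [IsProbabilityMeasure β] (m : ι → Set X) (hm : ∀ e, MeasurableSet (m e))
    (hd : Pairwise (Function.onFun Disjoint m)) (t : ι → ℝ) :
    ∫ z, Complex.exp (((∑ e, (markCount (m e) z : ℝ) * t e : ℝ) : ℂ) * Complex.I)
        ∂(markedPoisson ρ β) =
      ∏ e, Complex.exp ((ρ * (β (m e)).toNNReal : ℝ≥0) * (Complex.exp (t e * Complex.I) - 1)) := by
  classical
  set g : X → ℂ := fun x => 1 + ∑ e, (m e).indicator
    (fun _ => Complex.exp (t e * Complex.I) - 1) x with hg
  have hgm : Measurable g := by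
    refine measurable_const.add (Finset.measurable_sum _ fun e _ => ?_)
    exact measurable_const.indicator (hm e)
  have hgx (x : X) : Complex.exp (((∑ e, ((m e).indicator (fun _ => (1 : ℝ)) x) * t e : ℝ) : ℂ)
      * Complex.I) = g x := by
    by_cases hx : ∃ e, x ∈ m e
    · obtain ⟨e, he⟩ := hx
      have hne (e' : ι) (h : e' ≠ e) : x ∉ m e' := fun h' =>
        Set.disjoint_left.1 (hd h) h' he
      rw [hg]
      dsimp only
      rw [Finset.sum_eq_single e, Finset.sum_eq_single e]
      · simp [he]
      · intro e' _ h; simp [hne e' h]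
      · simp
      · intro e' _ h; simp [hne e' h]
      · simp
    · push Not at hx
      simp [hg, hx]
  have hcount (z : ℕ × (ℕ → X)) :
      Complex.exp (((∑ e, (markCount (m e) z : ℝ) * t e : ℝ) : ℂ) * Complex.I) =
        ∏ i ∈ Finset.range z.1, g (z.2 i) := by
    simp_rw [← hgx]
    rw [← Complex.exp_sum, ← Finset.sum_mul, ← Complex.ofReal_sum]
    congr 3
    rw [Finset.sum_comm]
    refine Finset.sum_congr rfl fun e _ => ?_
    rw [← Finset.sum_mul, markCount_eq_sum]
    push_cast
    congr 1
    refine Finset.sum_congr rfl fun i _ => ?_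
    by_cases h : z.2 i ∈ m e <;> simp [h]
  have hbound (z : ℕ × (ℕ → X)) :
      ‖Complex.exp (((∑ e, (markCount (m e) z : ℝ) * t e : ℝ) : ℂ) * Complex.I)‖ = 1 :=
    Complex.norm_exp_ofReal_mul_I _
  have hint : Integrable (fun z : ℕ × (ℕ → X) =>
      Complex.exp (((∑ e, (markCount (m e) z : ℝ) * t e : ℝ) : ℂ) * Complex.I))
      (markedPoisson ρ β) := by
    refine Integrable.of_bound (C := 1) ?_ (ae_of_all _ fun z => (hbound z).le)
    refine Measurable.aestronglyMeasurable ?_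
    have h (e : ι) : Measurable fun z : ℕ × (ℕ → X) => (markCount (m e) z : ℝ) :=
      measurable_from_top.comp (measurable_markCount (hm e))
    fun_prop
  rw [markedPoisson] at hint ⊢
  rw [integral_prod _ hint]
  simp_rw [hcount, integral_prod_infinitePi β g hgm]
  rw [integral_poisson_pow, ← Complex.exp_sum]
  congr 1
  have hI : ∫ x, g x ∂β =
      1 + ∑ e, ((β (m e)).toNNReal : ℂ) * (Complex.exp (t e * Complex.I) - 1) := by
    have hi (e : ι) : Integrable ((m e).indicator
        (fun _ => Complex.exp (t e * Complex.I) - 1)) β :=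
      (integrable_const _).indicator (hm e)
    rw [hg, integral_add (integrable_const _) (integrable_finsetSum _ fun e _ => hi e),
      integral_finsetSum _ fun e _ => hi e]
    congr 1
    · simp
    refine Finset.sum_congr rfl fun e _ => ?_
    rw [integral_indicator (hm e)]
    simp [Measure.real, ENNReal.toReal]
  rw [hI, add_sub_cancel_left, Finset.mul_sum]
  refine Finset.sum_congr rfl fun e _ => ?_
  push_cast
  ring

/-- The factorised characteristic function is that of independent Poisson variables. The counts are
cast to the reals so that characteristic functions apply. -/
lemma map_markCount_eq_pi {ι : Type*} [Fintype ι] (ρ : ℝ≥0) (β : Measure X)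
    [IsProbabilityMeasure β] (m : ι → Set X) (hm : ∀ e, MeasurableSet (m e))
    (hd : Pairwise (Function.onFun Disjoint m)) :
    (markedPoisson ρ β).map (fun z e => (markCount (m e) z : ℝ)) =
      Measure.pi fun e => (poissonMeasure (ρ * (β (m e)).toNNReal)).map Nat.cast := by
  have hV : Measurable fun (z : ℕ × (ℕ → X)) (e : ι) => (markCount (m e) z : ℝ) :=
    measurable_pi_lambda _ fun e => measurable_from_top.comp (measurable_markCount (hm e))
  have : IsProbabilityMeasure ((markedPoisson ρ β).map
      (fun z e => (markCount (m e) z : ℝ))) := Measure.isProbabilityMeasure_map hV.aemeasurable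
  rw [← charFun_eq_pi_iff]
  intro t
  simp_rw [charFun_map_cast_poissonMeasure]
  rw [← integral_exp_markCount ρ β m hm hd, charFun_apply,
    Measure.map_map (by fun_prop) hV,
    integral_map ((WithLp.measurable_toLp 2 _).comp hV).aemeasurable]
  · congr 1 with z
    simp [PiLp.inner_apply, mul_comm]
  · exact Measurable.aestronglyMeasurable (by fun_prop)

lemma markedPoisson_counts (ρ : ℝ≥0) (β : Measure X) [IsProbabilityMeasure β] {ι : Type*}
    (s : Finset ι) (m : ι → Set X) (hm : ∀ e ∈ s, MeasurableSet (m e))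
    (hd : (s : Set ι).Pairwise (Function.onFun Disjoint m)) (B : ι → Set ℕ) :
    markedPoisson ρ β {z | ∀ e ∈ s, markCount (m e) z ∈ B e} =
      ∏ e ∈ s, poissonMeasure (ρ * (β (m e)).toNNReal) (B e) := by
  have hemb : MeasurableEmbedding (Nat.cast : ℕ → ℝ) := MeasurableEmbedding.natCast
  have hB (e : ι) : MeasurableSet ((Nat.cast : ℕ → ℝ) '' B e) :=
    hemb.measurableSet_image.2 (MeasurableSet.of_discrete)
  have h := congrArg (fun μ => μ (Set.pi Set.univ fun e : s => (Nat.cast : ℕ → ℝ) '' B e))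
    (map_markCount_eq_pi ρ β (fun e : s => m e) (fun e => hm e e.2)
      (fun e e' h => hd e.2 e'.2 (fun h' => h (Subtype.ext h'))))
  have hV : Measurable fun (z : ℕ × (ℕ → X)) (e : s) => (markCount (m e) z : ℝ) :=
    measurable_pi_lambda _ fun e => measurable_from_top.comp (measurable_markCount (hm e e.2))
  rw [Measure.map_apply hV (MeasurableSet.univ_pi fun e => hB e), Measure.pi_pi] at h
  have hset : {z : ℕ × (ℕ → X) | ∀ e ∈ s, markCount (m e) z ∈ B e} =
      (fun z (e : s) => (markCount (m e) z : ℝ)) ⁻¹'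
        (Set.pi Set.univ fun e : s => (Nat.cast : ℕ → ℝ) '' B e) := by
    ext z
    simp
  rw [hset, h, ← Finset.prod_coe_sort s
    fun e => poissonMeasure (ρ * (β (m e)).toNNReal) (B e)]
  refine Finset.prod_congr rfl fun e _ => ?_
  rw [hemb.map_apply, Set.preimage_image_eq _ Nat.cast_injective]

/-- Independent sources of marked items: the numbers of items with marks in sets that are disjoint
within each source are independent Poisson variables. -/
theorem map_markCount_eq_infinitePi {σ P : Type*} (ρ : σ → ℝ≥0) (β : Measure X)
    [IsProbabilityMeasure β] (src : P → σ) (m : P → Set X) (hm : ∀ e, MeasurableSet (m e))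
    (hd : ∀ e e', e ≠ e' → src e = src e' → Disjoint (m e) (m e')) :
    (Measure.infinitePi fun a => markedPoisson (ρ a) β).map
        (fun ξ e => markCount (m e) (ξ (src e))) =
      Measure.infinitePi fun e => poissonMeasure (ρ (src e) * (β (m e)).toNNReal) := by
  classical
  refine Measure.eq_infinitePi _ fun s B hB => ?_
  have hmeas : Measurable fun (ξ : σ → ℕ × (ℕ → X)) (e : P) => markCount (m e) (ξ (src e)) :=
    measurable_pi_lambda _ fun e => (measurable_markCount (hm e)).comp (measurable_pi_apply _)
  rw [Measure.map_apply hmeas (.pi s.countable_toSet fun _ _ => hB _)]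
  -- Constraints are grouped by source: sources are independent of each other, and within one source
  -- the disjointness hypothesis applies.
  have hset : (fun (ξ : σ → ℕ × (ℕ → X)) (e : P) => markCount (m e) (ξ (src e))) ⁻¹'
      (Set.pi s B) = Set.pi (s.image src : Finset σ)
        (fun a => {z | ∀ e ∈ s.filter (src · = a), markCount (m e) z ∈ B e}) := by
    ext ξ
    simp only [Set.mem_preimage, Set.mem_pi, Finset.mem_coe, Finset.mem_image,
      Finset.mem_filter, Set.mem_ofPred_eq]
    constructor
    · rintro h a - e ⟨he, rfl⟩
      exact h e he
    · intro h e he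
      exact h (src e) ⟨e, he, rfl⟩ e ⟨he, rfl⟩
  rw [hset, Measure.infinitePi_pi]
  · rw [← Finset.prod_fiberwise_of_maps_to (s := s) (t := s.image src) (g := src)
      (fun e he => Finset.mem_image_of_mem _ he)]
    refine Finset.prod_congr rfl fun a _ => ?_
    rw [markedPoisson_counts (ρ a) β _ m (fun e _ => hm e)]
    · refine Finset.prod_congr rfl fun e he => ?_
      rw [(Finset.mem_filter.1 he).2]
    · intro e he e' he' hne
      simp only [Finset.coe_filter, Set.mem_ofPred_eq] at he he'
      exact hd e e' hne (he.2.trans he'.2.symm)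
  · intro a _
    have : {z : ℕ × (ℕ → X) | ∀ e ∈ s.filter (src · = a), markCount (m e) z ∈ B e} =
        ⋂ e ∈ s.filter (src · = a), markCount (m e) ⁻¹' (B e) := by
      ext z; simp
    rw [this]
    exact Finset.measurableSet_biInter _ fun e _ => measurable_markCount (hm e) (hB e)

end PoissonSplitting

/-! ### Exponential lifetimes -/

section Exponential

instance : IsProbabilityMeasure (expMeasure 1) := isProbabilityMeasure_expMeasure one_pos

lemma lintegral_expMeasure {f : ℝ → ℝ≥0∞} (hf : Measurable f) :
    ∫⁻ u, f u ∂(expMeasure 1) = ∫⁻ u in Set.Ioi 0, ENNReal.ofReal (Real.exp (-u)) * f u := by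
  have h : expMeasure 1 = volume.withDensity (exponentialPDF 1) := rfl
  have hm : Measurable (exponentialPDF 1) := (measurable_exponentialPDFReal 1).ennreal_ofReal
  rw [h, lintegral_withDensity_eq_lintegral_mul _ hm hf,
    setLIntegral_congr (Ioi_ae_eq_Ici (μ := volume) (a := (0 : ℝ))),
    ← lintegral_indicator measurableSet_Ici]
  congr 1 with u
  rw [Pi.mul_apply, exponentialPDF_eq]
  by_cases hu : 0 ≤ u
  · rw [Set.indicator_of_mem (Set.mem_Ici.2 hu)]
    simp [hu]
  · rw [Set.indicator_of_notMem (by simpa using hu)]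
    simp [hu]

lemma ae_pos_expMeasure : ∀ᵐ u ∂(expMeasure 1), 0 < u := by
  have h := lintegral_expMeasure (f := (Set.Iic 0).indicator 1)
    (measurable_one.indicator measurableSet_Iic)
  rw [lintegral_indicator_one measurableSet_Iic] at h
  have h0 : expMeasure 1 (Set.Iic 0) = 0 := by
    rw [h, setLIntegral_congr_fun (g := 0) measurableSet_Ioi]
    · simp
    · intro u hu
      have : u ∉ Set.Iic (0 : ℝ) := by simpa using hu
      simp [this]
  rw [ae_iff]
  convert h0 using 2
  ext u; simp

lemma expMeasure_Ioi {t : ℝ} (ht : 0 ≤ t) :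
    expMeasure 1 (Set.Ioi t) = ENNReal.ofReal (Real.exp (-t)) := by
  rw [← lintegral_indicator_one measurableSet_Ioi,
    lintegral_expMeasure (measurable_one.indicator measurableSet_Ioi)]
  have h : ∀ u ∈ Set.Ioi (0 : ℝ), ENNReal.ofReal (Real.exp (-u)) * (Set.Ioi t).indicator 1 u =
      (Set.Ioi t).indicator (fun u => ENNReal.ofReal (Real.exp (-u))) u := by
    intro u _
    by_cases hu : t < u <;> simp [hu]
  rw [setLIntegral_congr_fun measurableSet_Ioi h, lintegral_indicator measurableSet_Ioi,
    Measure.restrict_restrict measurableSet_Ioi, Set.inter_eq_left.2 (Set.Ioi_subset_Ioi ht),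
    ← ofReal_integral_eq_lintegral_ofReal]
  · rw [integral_exp_neg_Ioi]
  · have h := exp_neg_integrableOn_Ioi t one_pos
    simp only [neg_mul, one_mul] at h
    exact h
  · exact ae_of_all _ fun u => (Real.exp_pos _).le

lemma measurable_expMeasure_Ioi : Measurable fun t => expMeasure 1 (Set.Ioi t) :=
  Antitone.measurable fun _ _ h => measure_mono (Set.Ioi_subset_Ioi h)

/-- The exponential distribution has no memory. -/
lemma setLIntegral_Ioi_expMeasure {s : ℝ} (hs : 0 ≤ s) {g : ℝ → ℝ≥0∞} (hg : Measurable g) :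
    ∫⁻ u in Set.Ioi s, g u ∂(expMeasure 1) =
      expMeasure 1 (Set.Ioi s) * ∫⁻ v, g (v + s) ∂(expMeasure 1) := by
  have hgs : Measurable fun v => g (v + s) := by fun_prop
  rw [← lintegral_indicator measurableSet_Ioi, lintegral_expMeasure
    (hg.indicator measurableSet_Ioi), lintegral_expMeasure hgs, expMeasure_Ioi hs,
    ← lintegral_const_mul _ (by fun_prop), ← lintegral_indicator measurableSet_Ioi,
    ← lintegral_indicator measurableSet_Ioi, ← lintegral_add_right_eq_self _ s]
  congr 1 with v
  by_cases hv : 0 < v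
  · have h1 : 0 < v + s := by linarith
    have h2 : s < v + s := by linarith
    rw [Set.indicator_of_mem (Set.mem_Ioi.2 h1), Set.indicator_of_mem (Set.mem_Ioi.2 h2),
      Set.indicator_of_mem (Set.mem_Ioi.2 hv), ← mul_assoc,
      ← ENNReal.ofReal_mul (Real.exp_pos _).le,
      ← Real.exp_add]
    congr 3
    ring
  · have h2 : ¬ s < v + s := by linarith
    rw [Set.indicator_of_notMem (s := Set.Ioi 0) (a := v) hv]
    by_cases h1 : 0 < v + s
    · rw [Set.indicator_of_mem (Set.mem_Ioi.2 h1), Set.indicator_of_notMem (by simpa using h2),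
        mul_zero]
    · rw [Set.indicator_of_notMem (by simpa using h1)]

/-- The value at time `t` of a process that restarts at an exponential time. -/
noncomputable def renew (F : ℝ → ℝ≥0∞) (t : ℝ) : ℝ≥0∞ :=
  ∫⁻ u in Set.Iic t, F (t - u) ∂(expMeasure 1)

lemma measurable_renew {F : ℝ → ℝ≥0∞} (hF : Measurable F) : Measurable (renew F) := by
  have h : renew F = fun t => ∫⁻ u, {p : ℝ × ℝ | p.2 ≤ p.1}.indicator
      (fun p => F (p.1 - p.2)) (t, u) ∂(expMeasure 1) := by
    ext t
    rw [renew, ← lintegral_indicator measurableSet_Iic]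
    rfl
  rw [h]
  refine Measurable.lintegral_prod_right' (f := {p : ℝ × ℝ | p.2 ≤ p.1}.indicator
      (fun p => F (p.1 - p.2))) ?_
  exact Measurable.indicator (by fun_prop) (measurableSet_le measurable_snd measurable_fst)

/-- Either the clock rings before `s`, or it survives `s` and, having no memory, starts afresh
there. -/
lemma renew_add {F : ℝ → ℝ≥0∞} (hF : Measurable F) {s t : ℝ} (hs : 0 ≤ s) (ht : 0 ≤ t) :
    renew F (s + t) = (∫⁻ u in Set.Iic s, F (s - u + t) ∂(expMeasure 1)) +
      expMeasure 1 (Set.Ioi s) * renew F t := by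
  have hsplit : Set.Iic (s + t) = Set.Iic s ∪ Set.Ioc s (s + t) := by
    rw [Set.Iic_union_Ioc_eq_Iic]; linarith
  rw [renew, hsplit, lintegral_union measurableSet_Ioc]
  · congr 1
    · congr 1 with u
      congr 1; ring
    · have hg : Measurable ((Set.Iic (s + t)).indicator fun u => F (s + t - u)) :=
        Measurable.indicator (by fun_prop) measurableSet_Iic
      have h := setLIntegral_Ioi_expMeasure hs hg
      rw [lintegral_indicator measurableSet_Iic, Measure.restrict_restrict measurableSet_Iic,
        Set.inter_comm, Set.Ioi_inter_Iic] at h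
      rw [h, renew, ← lintegral_indicator measurableSet_Iic]
      congr 2 with v
      by_cases hv : v ≤ t
      · rw [Set.indicator_of_mem (by simp only [Set.mem_Iic]; linarith),
          Set.indicator_of_mem (Set.mem_Iic.2 hv)]
        congr 1; ring
      · rw [Set.indicator_of_notMem (by simp only [Set.mem_Iic]; linarith),
          Set.indicator_of_notMem (by simpa using hv)]
  · rw [Set.disjoint_left]
    intro u hu hu'
    exact absurd hu'.1 (not_lt.2 hu)

lemma expMeasure_Ioi_add {s t : ℝ} (hs : 0 ≤ s) (ht : 0 ≤ t) :
    expMeasure 1 (Set.Ioi (s + t)) = expMeasure 1 (Set.Ioi s) * expMeasure 1 (Set.Ioi t) := by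
  rw [expMeasure_Ioi hs, expMeasure_Ioi ht, expMeasure_Ioi (add_nonneg hs ht),
    ← ENNReal.ofReal_mul (Real.exp_pos _).le, ← Real.exp_add, neg_add]

end Exponential

lemma ENNReal.tsum_sum {α β : Type*} (f : α ⊕ β → ℝ≥0∞) :
    ∑' x, f x = ∑' a, f (Sum.inl a) + ∑' b, f (Sum.inr b) :=
  (HasSum.sum (f := f) ENNReal.summable.hasSum ENNReal.summable.hasSum).tsum_eq

/-! ### Shapes of splitting trees -/

/-- Finite binary trees. -/
inductive BinTree : Type
  | leaf : BinTree
  | node (l r : BinTree) : BinTree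

namespace BinTree

/-- A numbering of the finite binary trees. -/
def code : BinTree → ℕ
  | leaf => 0
  | node l r => Nat.pair l.code r.code + 1

lemma code_injective : Function.Injective code := by
  intro x
  induction x with
  | leaf => intro y h; cases y <;> simp_all [code]
  | node l r hl hr =>
    intro y h
    cases y with
    | leaf => simp [code] at h
    | node l' r' =>
      simp only [code, Nat.add_right_cancel_iff, Nat.pair_eq_pair] at h
      rw [hl h.1, hr h.2]

instance : Countable BinTree := code_injective.countable

lemma tsum_eq (f : BinTree → ℝ≥0∞) :
    ∑' x, f x = f leaf + ∑' l, ∑' r, f (node l r) := by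
  let e : Unit ⊕ (BinTree × BinTree) ≃ BinTree :=
    { toFun := fun o => o.elim (fun _ => leaf) fun p => node p.1 p.2
      invFun := fun x => match x with
        | leaf => Sum.inl ()
        | node l r => Sum.inr (l, r)
      left_inv := by rintro (_ | ⟨l, r⟩) <;> rfl
      right_inv := by rintro (_ | ⟨l, r⟩) <;> rfl }
  rw [← e.tsum_eq f, ENNReal.tsum_sum, ENNReal.tsum_prod']
  simp [e]

/-- The probability that the descendants of a vertex form the tree `x` after time `t`. -/
noncomputable def prob : BinTree → ℝ → ℝ≥0∞
  | leaf => fun t => expMeasure 1 (Set.Ioi t)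
  | node l r => renew fun t => l.prob t * r.prob t

lemma measurable_prob (x : BinTree) : Measurable x.prob := by
  induction x with
  | leaf => exact measurable_expMeasure_Ioi
  | node l r hl hr => exact measurable_renew (hl.mul hr)

/-- The probability that `x` becomes `y` when a tree grows from each leaf for a time `t`. -/
noncomputable def growProb (t : ℝ) : BinTree → BinTree → ℝ≥0∞
  | leaf, y => y.prob t
  | node _ _, leaf => 0
  | node l r, node l' r' => growProb t l l' * growProb t r r'

/-- Chapman-Kolmogorov identity of the branching process. In the inductive step the shape at time
`s` is a single leaf if the first split comes after `s`, the second term of `renew_add`; otherwise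
both subtrees satisfy the identity from the first split on. -/
lemma tsum_prob_mul_growProb {t : ℝ} (ht : 0 ≤ t) (y : BinTree) {s : ℝ} (hs : 0 ≤ s) :
    ∑' x : BinTree, x.prob s * growProb t x y = y.prob (s + t) := by
  induction y generalizing s with
  | leaf => simp [tsum_eq, growProb, prob, expMeasure_Ioi_add hs ht]
  | node l' r' hl hr =>
    rw [tsum_eq]
    simp only [growProb, prob]
    rw [renew_add (F := fun t => l'.prob t * r'.prob t)
      ((measurable_prob l').mul (measurable_prob r')) hs ht, add_comm]
    congr 1
    have h (l r : BinTree) : renew (fun t => l.prob t * r.prob t) s *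
        (growProb t l l' * growProb t r r') = ∫⁻ u in Set.Iic s,
          (l.prob (s - u) * growProb t l l') * (r.prob (s - u) * growProb t r r')
            ∂(expMeasure 1) := by
      have := measurable_prob l
      have := measurable_prob r
      rw [renew, ← lintegral_mul_const _ (by fun_prop)]
      congr 1 with u
      ring
    simp_rw [h]
    have hm (l r : BinTree) : AEMeasurable (fun u => (l.prob (s - u) * growProb t l l') *
        (r.prob (s - u) * growProb t r r')) ((expMeasure 1).restrict (Set.Iic s)) := by
      have := measurable_prob l
      have := measurable_prob r
      fun_prop
    have h2 (l : BinTree) : ∑' r : BinTree, ∫⁻ u in Set.Iic s,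
          (l.prob (s - u) * growProb t l l') * (r.prob (s - u) * growProb t r r')
            ∂(expMeasure 1) = ∫⁻ u in Set.Iic s, ∑' r : BinTree,
          (l.prob (s - u) * growProb t l l') * (r.prob (s - u) * growProb t r r')
            ∂(expMeasure 1) := (lintegral_tsum fun r => hm l r).symm
    simp_rw [h2]
    rw [← lintegral_tsum fun l => AEMeasurable.tsum fun r => hm l r]
    refine setLIntegral_congr_fun measurableSet_Iic fun u hu => ?_
    have hu' : 0 ≤ s - u := sub_nonneg.2 hu
    simp_rw [ENNReal.tsum_mul_left, ENNReal.tsum_mul_right]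
    rw [hl hu', hr hu']

end BinTree

/-! ### Shapes of the trees along the path to the root -/

namespace SpineList

open BinTree

lemma tsum_list_eq {α : Type*} (f : List α → ℝ≥0∞) :
    ∑' x, f x = f [] + ∑' a, ∑' l, f (a :: l) := by
  let e : Unit ⊕ (α × List α) ≃ List α :=
    { toFun := fun o => o.elim (fun _ => []) fun p => p.1 :: p.2
      invFun := fun x => match x with
        | [] => Sum.inl ()
        | a :: l => Sum.inr (a, l)
      left_inv := by rintro (_ | ⟨l, r⟩) <;> rfl
      right_inv := by rintro (_ | ⟨l, r⟩) <;> rfl }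
  rw [← e.tsum_eq f, ENNReal.tsum_sum, ENNReal.tsum_prod']
  simp [e]

/-- The probability that, after time `t`, the shapes of the trees that hang off the path to the
root vertex are `l`, the largest tree coming first. -/
noncomputable def prob : List BinTree → ℝ → ℝ≥0∞
  | [] => fun t => expMeasure 1 (Set.Ioi t)
  | x :: l => renew fun t => x.prob t * prob l t

lemma measurable_prob (l : List BinTree) : Measurable (prob l) := by
  induction l with
  | nil => exact measurable_expMeasure_Ioi
  | cons x l ih => exact measurable_renew (x.measurable_prob.mul ih)

/-- The probability that `l` becomes `m` when a tree grows from each leaf for a time `t`. -/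
noncomputable def growProb (t : ℝ) : List BinTree → List BinTree → ℝ≥0∞
  | [], m => prob m t
  | _ :: _, [] => 0
  | x :: l, y :: m => x.growProb t y * growProb t l m

/-- The same first-split decomposition, with the subtree containing the root treated by induction
and the other one by the identity for binary trees. This is the Markov property behind invariance.
-/
lemma tsum_prob_mul_growProb {t : ℝ} (ht : 0 ≤ t) (m : List BinTree) {s : ℝ} (hs : 0 ≤ s) :
    ∑' l : List BinTree, prob l s * growProb t l m = prob m (s + t) := by
  induction m generalizing s with
  | nil => simp [tsum_list_eq, growProb, prob, expMeasure_Ioi_add hs ht]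
  | cons y m ih =>
    rw [tsum_list_eq]
    simp only [growProb, prob]
    rw [renew_add (F := fun t => y.prob t * prob m t)
      ((BinTree.measurable_prob y).mul (measurable_prob m)) hs ht, add_comm]
    congr 1
    have h (x : BinTree) (l : List BinTree) : renew (fun t => x.prob t * prob l t) s *
        (x.growProb t y * growProb t l m) = ∫⁻ u in Set.Iic s,
          (x.prob (s - u) * x.growProb t y) * (prob l (s - u) * growProb t l m)
            ∂(expMeasure 1) := by
      have := x.measurable_prob
      have := measurable_prob l
      rw [renew, ← lintegral_mul_const _ (by fun_prop)]
      congr 1 with u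
      ring
    simp_rw [h]
    have hm (x : BinTree) (l : List BinTree) : AEMeasurable (fun u =>
        (x.prob (s - u) * x.growProb t y) * (prob l (s - u) * growProb t l m))
        ((expMeasure 1).restrict (Set.Iic s)) := by
      have := x.measurable_prob
      have := measurable_prob l
      fun_prop
    have h2 (x : BinTree) : ∑' l : List BinTree, ∫⁻ u in Set.Iic s,
          (x.prob (s - u) * x.growProb t y) * (prob l (s - u) * growProb t l m)
            ∂(expMeasure 1) = ∫⁻ u in Set.Iic s, ∑' l : List BinTree,
          (x.prob (s - u) * x.growProb t y) * (prob l (s - u) * growProb t l m)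
            ∂(expMeasure 1) := (lintegral_tsum fun r => hm x r).symm
    simp_rw [h2]
    rw [← lintegral_tsum fun x => AEMeasurable.tsum fun l => hm x l]
    refine setLIntegral_congr_fun measurableSet_Iic fun u hu => ?_
    have hu' : 0 ≤ s - u := sub_nonneg.2 hu
    simp_rw [ENNReal.tsum_mul_left, ENNReal.tsum_mul_right]
    rw [BinTree.tsum_prob_mul_growProb ht y hu', ih hu']

end SpineList

/-! ### Decompositions of product measures -/

section ProductDecomposition

variable {X : Type*} [MeasurableSpace X]

lemma map_sumElim_infinitePi {α β : Type*} (μ : α → Measure X) (ν : β → Measure X)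
    [∀ a, IsProbabilityMeasure (μ a)] [∀ b, IsProbabilityMeasure (ν b)] :
    ((Measure.infinitePi μ).prod (Measure.infinitePi ν)).map
        (fun p => (Sum.elim p.1 p.2 : α ⊕ β → X)) = Measure.infinitePi (Sum.elim μ ν) := by
  have : ∀ x, IsProbabilityMeasure (Sum.elim μ ν x) := by rintro (a | b) <;> simp <;> infer_instance
  refine Measure.eq_infinitePi _ fun s t ht => ?_
  have hm : Measurable fun p : (α → X) × (β → X) => (Sum.elim p.1 p.2 : α ⊕ β → X) := by
    refine measurable_pi_lambda _ ?_
    rintro (a | b)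
    · exact (measurable_pi_apply a).comp measurable_fst
    · exact (measurable_pi_apply b).comp measurable_snd
  rw [Measure.map_apply hm (.pi s.countable_toSet fun _ _ => ht _)]
  have hset : (fun p : (α → X) × (β → X) => (Sum.elim p.1 p.2 : α ⊕ β → X)) ⁻¹' (Set.pi s t) =
      (Set.pi s.toLeft fun a => t (Sum.inl a)) ×ˢ (Set.pi s.toRight fun b => t (Sum.inr b)) := by
    ext ⟨f, g⟩
    simp only [Set.mem_preimage, Set.mem_pi, Set.mem_prod, Finset.mem_coe, Finset.mem_toLeft,
      Finset.mem_toRight]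
    constructor
    · intro h
      exact ⟨fun a ha => h _ ha, fun b hb => h _ hb⟩
    · rintro ⟨h, h'⟩ (a | b) hx
      · exact h a hx
      · exact h' b hx
  rw [hset, Measure.prod_prod, Measure.infinitePi_pi _ fun _ _ => ht _,
    Measure.infinitePi_pi _ fun _ _ => ht _, Finset.prod_sum_eq_prod_toLeft_mul_prod_toRight]
  simp

lemma map_optionElim_infinitePi {α : Type*} (μ₀ : Measure X) (μ : α → Measure X)
    [IsProbabilityMeasure μ₀] [∀ a, IsProbabilityMeasure (μ a)] :
    (μ₀.prod (Measure.infinitePi μ)).map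
        (fun p => ((fun o => o.elim p.1 p.2) : Option α → X)) =
      Measure.infinitePi (fun o : Option α => o.elim μ₀ μ) := by
  classical
  have : ∀ o : Option α, IsProbabilityMeasure (o.elim μ₀ μ) := by
    rintro (_ | a) <;> simp <;> infer_instance
  refine Measure.eq_infinitePi _ fun s t ht => ?_
  have hm : Measurable fun p : X × (α → X) => ((fun o => o.elim p.1 p.2) : Option α → X) := by
    refine measurable_pi_lambda _ ?_
    rintro (_ | a)
    · exact measurable_fst
    · exact (measurable_pi_apply a).comp measurable_snd
  rw [Measure.map_apply hm (.pi s.countable_toSet fun _ _ => ht _)]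
  have hset : (fun p : X × (α → X) => ((fun o => o.elim p.1 p.2) : Option α → X)) ⁻¹'
      (Set.pi s t) = (if none ∈ s then t none else Set.univ) ×ˢ
        (Set.pi s.eraseNone fun a => t (some a)) := by
    ext ⟨x, f⟩
    simp only [Set.mem_preimage, Set.mem_pi, Set.mem_prod, Finset.mem_coe,
      Finset.mem_eraseNone]
    constructor
    · intro h
      refine ⟨?_, fun a ha => h _ ha⟩
      split_ifs with hs
      · exact h _ hs
      · trivial
    · rintro ⟨h, h'⟩ (_ | a) hx
      · rw [if_pos hx] at h
        exact h
      · exact h' a hx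
  rw [hset, Measure.prod_prod, Measure.infinitePi_pi _ fun _ _ => ht _]
  by_cases hs : none ∈ s
  · rw [if_pos hs, ← Finset.mul_prod_erase s _ hs]
    congr 1
    rw [← Finset.map_some_eraseNone, Finset.prod_map]
    rfl
  · rw [if_neg hs, measure_univ, one_mul]
    conv_rhs => rw [← Finset.erase_eq_of_notMem hs, ← Finset.map_some_eraseNone, Finset.prod_map]
    rfl

/-- The family on words with given values at the empty word and after each first letter. -/
def wordJoin {X : Type*} (p : X × (Word → X) × (Word → X)) : Word → X
  | [] => p.1
  | false :: w => p.2.1 w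
  | true :: w => p.2.2 w

lemma measurable_wordJoin : Measurable (wordJoin (X := X)) := by
  refine measurable_pi_lambda _ ?_
  rintro (_ | ⟨_ | _, w⟩)
  · exact measurable_fst
  · exact (measurable_pi_apply w).comp (measurable_fst.comp measurable_snd)
  · exact (measurable_pi_apply w).comp (measurable_snd.comp measurable_snd)

lemma map_wordJoin (ν : Measure X) [IsProbabilityMeasure ν] :
    (ν.prod ((Measure.infinitePi fun _ : Word => ν).prod
      (Measure.infinitePi fun _ : Word => ν))).map wordJoin =
      Measure.infinitePi fun _ : Word => ν := by
  let f : Word → Option (Word ⊕ Word)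
    | [] => none
    | false :: w => some (Sum.inl w)
    | true :: w => some (Sum.inr w)
  have hf : Function.Injective f := by
    rintro (_ | ⟨_ | _, w⟩) (_ | ⟨_ | _, w'⟩) h <;> simp_all [f]
  have h1 := map_sumElim_infinitePi (fun _ : Word => ν) (fun _ : Word => ν)
  have h2 := map_optionElim_infinitePi ν (fun _ : Word ⊕ Word => ν)
  have hc : (fun o : Option (Word ⊕ Word) => o.elim ν fun _ => ν) = fun _ => ν := by
    ext1 o; cases o <;> rfl
  have hc' : (Sum.elim (fun _ => ν) (fun _ => ν) : Word ⊕ Word → Measure X) = fun _ => ν := by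
    ext1 o; cases o <;> rfl
  rw [hc] at h2
  rw [hc'] at h1
  have h3 := Measure.map_infinitePi_infinitePi_of_inj (P := fun _ : Option (Word ⊕ Word) => ν) hf
  have hm1 : Measurable fun p : (Word → X) × (Word → X) =>
      (Sum.elim p.1 p.2 : Word ⊕ Word → X) := by
    refine measurable_pi_lambda _ ?_
    rintro (a | b)
    · exact (measurable_pi_apply a).comp measurable_fst
    · exact (measurable_pi_apply b).comp measurable_snd
  have hm2 : Measurable fun p : X × (Word ⊕ Word → X) =>
      ((fun o => o.elim p.1 p.2) : Option (Word ⊕ Word) → X) := by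
    refine measurable_pi_lambda _ ?_
    rintro (_ | a)
    · exact measurable_fst
    · exact (measurable_pi_apply a).comp measurable_snd
  have h4 := Measure.map_prod_map ν ((Measure.infinitePi fun _ : Word => ν).prod
    (Measure.infinitePi fun _ : Word => ν)) measurable_id hm1
  rw [Measure.map_id, h1] at h4
  refine Eq.trans ?_ h3
  rw [← h2, h4, Measure.map_map hm2 (by fun_prop),
    Measure.map_map (by fun_prop) (hm2.comp (by fun_prop))]
  congr 1
  ext p w
  rcases w with _ | ⟨_ | _, w⟩ <;> rfl

/-- Branching property: given the value at the empty word, the values after the two first letters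
are independent copies of the whole family. The recursions for laws of shapes all come from here. -/
lemma infinitePi_word_apply (ν : Measure X) [IsProbabilityMeasure ν] {A : Set (Word → X)}
    (hA : MeasurableSet A) :
    (Measure.infinitePi fun _ : Word => ν) A =
      ∫⁻ x, ((Measure.infinitePi fun _ : Word => ν).prod (Measure.infinitePi fun _ : Word => ν))
        {p | wordJoin (x, p) ∈ A} ∂ν := by
  conv_lhs => rw [← map_wordJoin ν]
  rw [Measure.map_apply measurable_wordJoin hA, Measure.prod_apply (measurable_wordJoin hA)]
  rfl

end ProductDecomposition

/-- Fair coin tosses. -/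
noncomputable abbrev coinMeasure : Measure (ℕ → Bool) :=
  Measure.infinitePi fun _ : ℕ => (PMF.uniformOfFintype Bool).toMeasure

/-- Independent lifetimes of the descendants of one vertex. -/
noncomputable abbrev clockMeasure : Measure (Word → ℝ) :=
  Measure.infinitePi fun _ : Word => expMeasure 1

/-! ### The tree of descendants of a vertex -/

/-- The word `w` is alive at time `t` among the descendants of a vertex. -/
def WordAlive (c : Word → ℝ) (t : ℝ) (w : Word) : Prop :=
  ∑ k ∈ Finset.range w.length, c (w.take k) ≤ t ∧
    t < (∑ k ∈ Finset.range w.length, c (w.take k)) + c w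

lemma wordAlive_nil (c : Word → ℝ) (t : ℝ) : WordAlive c t [] ↔ 0 ≤ t ∧ t < c [] := by
  simp [WordAlive]

lemma wordAlive_cons (c : Word → ℝ) (t : ℝ) (b : Bool) (w : Word) :
    WordAlive c t (b :: w) ↔ WordAlive (fun v => c (b :: v)) (t - c []) w := by
  simp only [WordAlive, List.length_cons, Finset.sum_range_succ', List.take_succ_cons,
    List.take_zero]
  constructor <;> rintro ⟨h1, h2⟩ <;> constructor <;> linarith

/-! ### Finite binary trees as shapes of the set of living descendants -/

namespace BinTree

/-- The leaves of a binary tree, as words. -/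
def leaves : BinTree → Set Word
  | leaf => {[]}
  | node l r => (false :: ·) '' l.leaves ∪ (true :: ·) '' r.leaves

@[simp] lemma nil_mem_leaves_node (l r : BinTree) : [] ∉ (node l r).leaves := by
  simp [leaves]

@[simp] lemma cons_mem_leaves_leaf (b : Bool) (w : Word) : b :: w ∉ leaf.leaves := by
  simp [leaves]

@[simp] lemma cons_mem_leaves_node (l r : BinTree) (b : Bool) (w : Word) :
    b :: w ∈ (node l r).leaves ↔ w ∈ (if b then r else l).leaves := by
  cases b <;> simp [leaves]

lemma leaves_finite (x : BinTree) : x.leaves.Finite := by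
  induction x with
  | leaf => exact Set.finite_singleton _
  | node l r hl hr => exact (hl.image _).union (hr.image _)

/-- The weights `2 ^ (-|w|)` of the leaves add up to at most one. -/
lemma kraft (x : BinTree) :
    ∑' w : Word, x.leaves.indicator (fun w => (2⁻¹ : ℝ≥0∞) ^ w.length) w ≤ 1 := by
  induction x with
  | leaf =>
    rw [tsum_eq_single []]
    · simp [leaves]
    · intro w hw
      simp [leaves, hw]
  | node l r hl hr =>
    rw [SpineList.tsum_list_eq]
    simp only [nil_mem_leaves_node, not_false_eq_true, Set.indicator_of_notMem, zero_add]
    rw [tsum_bool]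
    have h (b : Bool) : ∑' w : Word, (node l r).leaves.indicator
        (fun w => (2⁻¹ : ℝ≥0∞) ^ w.length) (b :: w) = 2⁻¹ * ∑' w : Word,
          (if b then r else l).leaves.indicator (fun w => (2⁻¹ : ℝ≥0∞) ^ w.length) w := by
      rw [← ENNReal.tsum_mul_left]
      congr 1 with w
      by_cases hw : w ∈ (if b then r else l).leaves
      · rw [Set.indicator_of_mem hw, Set.indicator_of_mem (by simpa using hw)]
        simp [pow_succ']
      · rw [Set.indicator_of_notMem hw, Set.indicator_of_notMem (by simpa using hw), mul_zero]
    rw [h, h, ← mul_add]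
    calc (2⁻¹ : ℝ≥0∞) * _ ≤ 2⁻¹ * (1 + 1) := by
          gcongr
          · simpa using hl
          · simpa using hr
      _ = 1 := by rw [one_add_one_eq_two, ENNReal.inv_mul_cancel] <;> simp

/-- The descendants of a vertex with lifetimes `c` form the tree `x` at time `t`. -/
def Grows : BinTree → (Word → ℝ) → ℝ → Prop
  | leaf, c, t => t < c []
  | node l r, c, t => c [] ≤ t ∧ l.Grows (fun w => c (false :: w)) (t - c []) ∧
      r.Grows (fun w => c (true :: w)) (t - c [])

lemma Grows.unique {x y : BinTree} {c : Word → ℝ} {t : ℝ} (hx : x.Grows c t) (hy : y.Grows c t) :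
    x = y := by
  induction x generalizing y c t with
  | leaf =>
    cases y with
    | leaf => rfl
    | node l r => exact absurd hy.1 (not_le.2 hx)
  | node l r hl hr =>
    cases y with
    | leaf => exact absurd hx.1 (not_le.2 hy)
    | node l' r' => rw [hl hx.2.1 hy.2.1, hr hx.2.2 hy.2.2]

/-- Induction along the first split. Positivity of the lifetimes keeps the descendants of a vertex
that has not yet split from counting as alive. -/
lemma Grows.wordAlive_iff {x : BinTree} {c : Word → ℝ} {t : ℝ} (hx : x.Grows c t)
    (hc : ∀ w, 0 < c w) (ht : 0 ≤ t) (w : Word) : WordAlive c t w ↔ w ∈ x.leaves := by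
  induction x generalizing c t w with
  | leaf =>
    have hx' : t < c [] := hx
    cases w with
    | nil => simp [wordAlive_nil, hx', ht, leaves]
    | cons b w =>
      simp only [cons_mem_leaves_leaf, iff_false, wordAlive_cons]
      rintro ⟨h, -⟩
      have := Finset.sum_nonneg (s := Finset.range w.length)
        (f := fun k => c (b :: w.take k)) fun k _ => (hc _).le
      linarith
  | node l r hl hr =>
    cases w with
    | nil => simpa [wordAlive_nil] using fun _ => hx.1
    | cons b w =>
      rw [wordAlive_cons, cons_mem_leaves_node]
      have ht' : 0 ≤ t - c [] := sub_nonneg.2 hx.1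
      cases b
      · exact hl hx.2.1 (fun _ => hc _) ht' w
      · exact hr hx.2.2 (fun _ => hc _) ht' w

lemma measurableSet_grows (x : BinTree) :
    MeasurableSet {p : ℝ × (Word → ℝ) | x.Grows p.2 p.1} := by
  induction x with
  | leaf =>
    exact measurableSet_lt measurable_fst ((measurable_pi_apply []).comp measurable_snd)
  | node l r hl hr =>
    have h (b : Bool) : Measurable fun p : ℝ × (Word → ℝ) =>
        (p.1 - p.2 [], fun w => p.2 (b :: w)) := by fun_prop
    have h0 : MeasurableSet {p : ℝ × (Word → ℝ) | p.2 [] ≤ p.1} :=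
      measurableSet_le ((measurable_pi_apply []).comp measurable_snd) measurable_fst
    exact h0.inter ((h false hl).inter (h true hr))

lemma measurableSet_grows_right (x : BinTree) (t : ℝ) :
    MeasurableSet {c : Word → ℝ | x.Grows c t} :=
  x.measurableSet_grows.preimage (f := fun c : Word → ℝ => (t, c)) (by fun_prop)

lemma measure_grows (x : BinTree) (t : ℝ) : clockMeasure {c | x.Grows c t} = x.prob t := by
  induction x generalizing t with
  | leaf =>
    have h := (measurePreserving_eval_infinitePi (fun _ : Word => expMeasure 1) []).measure_preimage
      (measurableSet_Ioi (a := t)).nullMeasurableSet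
    exact h
  | node l r hl hr =>
    rw [clockMeasure, infinitePi_word_apply _ (measurableSet_grows_right _ t), prob, renew,
      ← lintegral_indicator measurableSet_Iic]
    congr 1 with u
    by_cases hu : u ≤ t
    · rw [Set.indicator_of_mem (Set.mem_Iic.2 hu), ← hl, ← hr, ← Measure.prod_prod]
      congr 1 with p
      simp [Grows, wordJoin, hu]
    · rw [Set.indicator_of_notMem (by simpa using hu)]
      simp [Grows, wordJoin, hu]

end BinTree

/-- The tree of descendants reaches beyond depth `k` by time `t`. -/
def Deep : ℕ → (Word → ℝ) → ℝ → Prop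
  | 0, c, t => c [] ≤ t
  | k + 1, c, t => c [] ≤ t ∧ (Deep k (fun w => c (false :: w)) (t - c []) ∨
      Deep k (fun w => c (true :: w)) (t - c []))

lemma exists_grows_of_not_deep {k : ℕ} {c : Word → ℝ} {t : ℝ} (h : ¬ Deep k c t) :
    ∃ x : BinTree, x.Grows c t := by
  induction k generalizing c t with
  | zero => exact ⟨.leaf, not_le.1 h⟩
  | succ k ih =>
    by_cases hc : c [] ≤ t
    · have h' : ¬ (Deep k (fun w => c (false :: w)) (t - c []) ∨
        Deep k (fun w => c (true :: w)) (t - c [])) := fun h' => h ⟨hc, h'⟩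
      push Not at h'
      obtain ⟨l, hl⟩ := ih h'.1
      obtain ⟨r, hr⟩ := ih h'.2
      exact ⟨.node l r, hc, hl, hr⟩
    · exact ⟨.leaf, not_le.1 hc⟩

lemma measurableSet_deep (k : ℕ) : MeasurableSet {p : ℝ × (Word → ℝ) | Deep k p.2 p.1} := by
  induction k with
  | zero =>
    exact measurableSet_le ((measurable_pi_apply []).comp measurable_snd) measurable_fst
  | succ k ih =>
    have h (b : Bool) : Measurable fun p : ℝ × (Word → ℝ) =>
        (p.1 - p.2 [], fun w => p.2 (b :: w)) := by fun_prop
    have h0 : MeasurableSet {p : ℝ × (Word → ℝ) | p.2 [] ≤ p.1} :=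
      measurableSet_le ((measurable_pi_apply []).comp measurable_snd) measurable_fst
    exact h0.inter ((h false ih).union (h true ih))

lemma lintegral_exp_neg_two : ∫⁻ u, ENNReal.ofReal (Real.exp (-(2 * u))) ∂(expMeasure 1) =
    ENNReal.ofReal (1 / 3) := by
  rw [lintegral_expMeasure (by fun_prop)]
  have h : ∀ u : ℝ, ENNReal.ofReal (Real.exp (-u)) * ENNReal.ofReal (Real.exp (-(2 * u))) =
      ENNReal.ofReal (Real.exp (-3 * u)) := by
    intro u
    rw [← ENNReal.ofReal_mul (Real.exp_pos _).le, ← Real.exp_add]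
    ring_nf
  simp_rw [h]
  have h3 := exp_neg_integrableOn_Ioi 0 (b := 3) (by norm_num)
  rw [← ofReal_integral_eq_lintegral_ofReal h3 (ae_of_all _ fun u => (Real.exp_pos _).le),
    integral_exp_mul_Ioi (by norm_num)]
  norm_num

/-- A Chernoff bound over generations: two children, each contributing the factor E exp (-2 u) =
1/3, give 2/3 per generation. The exponent 2 is one for which this product is below one. -/
lemma measure_deep_le (k : ℕ) (t : ℝ) : clockMeasure {c | Deep k c t} ≤
    ENNReal.ofReal (Real.exp (2 * t)) * ENNReal.ofReal (2 / 3) ^ k := by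
  induction k generalizing t with
  | zero =>
    have h := (measurePreserving_eval_infinitePi (fun _ : Word => expMeasure 1) []).measure_preimage
      (measurableSet_Iic (a := t)).nullMeasurableSet
    have h' : clockMeasure {c | Deep 0 c t} = expMeasure 1 (Set.Iic t) := h
    rw [h', pow_zero, mul_one]
    -- Negative times occur in the recursion through `t - u`; there the event is null because
    -- lifetimes are positive.
    rcases le_or_gt 0 t with ht | ht
    · refine prob_le_one.trans ?_
      rw [ENNReal.one_le_ofReal]
      exact Real.one_le_exp (by linarith)
    · have : expMeasure 1 (Set.Iic t) = 0 := by
        refine measure_mono_null ?_ (ae_iff.1 ae_pos_expMeasure)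
        intro u hu
        simp only [Set.mem_Iic, Set.mem_ofPred_eq, not_lt] at hu ⊢
        linarith
      rw [this]
      exact zero_le
  | succ k ih =>
    have hm : MeasurableSet {c | Deep (k + 1) c t} :=
      (measurableSet_deep (k + 1)).preimage (f := fun c : Word → ℝ => (t, c)) (by fun_prop)
    rw [clockMeasure, infinitePi_word_apply _ hm]
    calc _ ≤ ∫⁻ u, 2 * (ENNReal.ofReal (Real.exp (2 * (t - u))) * ENNReal.ofReal (2 / 3) ^ k)
          ∂(expMeasure 1) := by
          refine lintegral_mono fun u => ?_
          calc _ ≤ (clockMeasure.prod clockMeasure)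
                ({c | Deep k c (t - u)} ×ˢ Set.univ ∪ Set.univ ×ˢ {c | Deep k c (t - u)}) := by
                refine measure_mono ?_
                rintro ⟨c, c'⟩ ⟨-, h⟩
                rcases h with h | h
                · exact Or.inl ⟨h, trivial⟩
                · exact Or.inr ⟨trivial, h⟩
            _ ≤ _ := by
                refine (measure_union_le _ _).trans ?_
                rw [Measure.prod_prod, Measure.prod_prod, measure_univ, mul_one,
                  one_mul, two_mul]
                exact add_le_add (ih _) (ih _)
      _ = ∫⁻ u, (2 * (ENNReal.ofReal (Real.exp (2 * t)) * ENNReal.ofReal (2 / 3) ^ k)) *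
            ENNReal.ofReal (Real.exp (-(2 * u))) ∂(expMeasure 1) := by
          congr 1 with u
          rw [mul_sub, sub_eq_add_neg, Real.exp_add, ENNReal.ofReal_mul (Real.exp_pos _).le]
          ring
      _ = _ := by
          rw [lintegral_const_mul _ (by fun_prop), lintegral_exp_neg_two, pow_succ]
          have : (2 : ℝ≥0∞) * ENNReal.ofReal (1 / 3) = ENNReal.ofReal (2 / 3) := by
            rw [← ENNReal.ofReal_ofNat, ← ENNReal.ofReal_mul (by norm_num)]
            norm_num
          rw [← this]
          ring

/-- A vertex has finitely many descendants at time `t`. -/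
lemma ae_exists_grows (t : ℝ) : ∀ᵐ c ∂clockMeasure, ∃ x : BinTree, x.Grows c t := by
  have h : clockMeasure {c | ∀ k, Deep k c t} = 0 := by
    have hlim : Tendsto (fun k => ENNReal.ofReal (Real.exp (2 * t)) * ENNReal.ofReal (2 / 3) ^ k)
        atTop (𝓝 (ENNReal.ofReal (Real.exp (2 * t)) * 0)) := by
      refine ENNReal.Tendsto.const_mul ?_ (Or.inr ENNReal.ofReal_ne_top)
      refine ENNReal.tendsto_pow_atTop_nhds_zero_of_lt_one ?_
      rw [ENNReal.ofReal_lt_one]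
      norm_num
    rw [mul_zero] at hlim
    refine le_antisymm (ge_of_tendsto' hlim fun k => ?_) zero_le
    have hsub : {c | ∀ k, Deep k c t} ⊆ {c | Deep k c t} :=
      Set.ofPred_subset_ofPred.2 fun c hc => hc k
    exact (measure_mono hsub).trans (measure_deep_le k t)
  rw [ae_iff]
  refine measure_mono_null ?_ h
  intro c hc k
  by_contra hk
  exact hc (exists_grows_of_not_deep hk)

lemma ae_clock_pos : ∀ᵐ c ∂clockMeasure, ∀ w, 0 < c w := by
  rw [ae_all_iff]
  intro w
  exact (measurePreserving_eval_infinitePi (fun _ : Word => expMeasure 1)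
    w).quasiMeasurePreserving.ae
    ae_pos_expMeasure

/-- The descendants of a vertex with lifetimes `c` at time `t`, seen from the vertex reached by
the choices `d`: the trees hanging off the path to it are those in the list, the largest first. -/
def Marks : List BinTree → (Word → ℝ) → (ℕ → Bool) → ℝ → Prop
  | [], c, _, t => t < c []
  | x :: l, c, d, t => c [] ≤ t ∧ x.Grows (fun w => c ((!d 0) :: w)) (t - c []) ∧
      Marks l (fun w => c (d 0 :: w)) (fun n => d (n + 1)) (t - c [])

lemma Marks.unique {l m : List BinTree} {c : Word → ℝ} {d : ℕ → Bool} {t : ℝ}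
    (hl : Marks l c d t) (hm : Marks m c d t) : l = m := by
  induction l generalizing m c d t with
  | nil =>
    cases m with
    | nil => rfl
    | cons y m => exact absurd hm.1 (not_le.2 hl)
  | cons x l ih =>
    cases m with
    | nil => exact absurd hl.1 (not_le.2 hm)
    | cons y m => rw [hl.2.1.unique hm.2.1, ih hl.2.2 hm.2.2]

lemma BinTree.Grows.exists_marks {x : BinTree} {c : Word → ℝ} {t : ℝ} (hx : x.Grows c t)
    (d : ℕ → Bool) : ∃ l, Marks l c d t := by
  induction x generalizing c d t with
  | leaf => exact ⟨[], hx⟩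
  | node l r hl hr =>
    cases hd : d 0
    · obtain ⟨m, hm⟩ := hl hx.2.1 (fun n => d (n + 1))
      exact ⟨r :: m, hx.1, by simpa [hd] using hx.2.2, by simpa [hd] using hm⟩
    · obtain ⟨m, hm⟩ := hr hx.2.2 (fun n => d (n + 1))
      exact ⟨l :: m, hx.1, by simpa [hd] using hx.2.1, by simpa [hd] using hm⟩

lemma measurableSet_marks (l : List BinTree) :
    MeasurableSet {p : ℝ × (Word → ℝ) × (ℕ → Bool) | Marks l p.2.1 p.2.2 p.1} := by
  induction l with
  | nil =>
    exact measurableSet_lt measurable_fst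
      ((measurable_pi_apply []).comp (measurable_fst.comp measurable_snd))
  | cons x l ih =>
    have h0 : MeasurableSet {p : ℝ × (Word → ℝ) × (ℕ → Bool) | p.2.1 [] ≤ p.1} :=
      measurableSet_le ((measurable_pi_apply []).comp (measurable_fst.comp measurable_snd))
        measurable_fst
    have hd (b : Bool) : MeasurableSet {p : ℝ × (Word → ℝ) × (ℕ → Bool) | p.2.2 0 = b} := by
      have hm : Measurable fun p : ℝ × (Word → ℝ) × (ℕ → Bool) => p.2.2 0 := by fun_prop
      exact hm (measurableSet_singleton b)
    have h1 (b : Bool) : Measurable fun p : ℝ × (Word → ℝ) × (ℕ → Bool) =>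
        (p.1 - p.2.1 [], fun w => p.2.1 ((!b) :: w)) := by fun_prop
    have h2 (b : Bool) : Measurable fun p : ℝ × (Word → ℝ) × (ℕ → Bool) =>
        (p.1 - p.2.1 [], (fun w => p.2.1 (b :: w), fun n => p.2.2 (n + 1))) := by fun_prop
    have h (b : Bool) := (hd b).inter (h0.inter ((h1 b x.measurableSet_grows).inter (h2 b ih)))
    convert (h false).union (h true) using 1
    ext ⟨s, c, d⟩
    cases hd : d 0 <;> simp [Marks, hd]

/-- The two subtrees after a split have the same law, so every fixed sequence of choices gives the
same distribution of shapes. Hence the shapes are independent of the choices of the root. -/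
lemma measure_marks (l : List BinTree) (d : ℕ → Bool) (t : ℝ) :
    clockMeasure {c | Marks l c d t} = SpineList.prob l t := by
  induction l generalizing d t with
  | nil =>
    have h := (measurePreserving_eval_infinitePi (fun _ : Word => expMeasure 1) []).measure_preimage
      (measurableSet_Ioi (a := t)).nullMeasurableSet
    exact h
  | cons x l ih =>
    have hm : MeasurableSet {c | Marks (x :: l) c d t} :=
      (measurableSet_marks (x :: l)).preimage (f := fun c : Word → ℝ => (t, c, d)) (by fun_prop)
    rw [clockMeasure, infinitePi_word_apply _ hm, SpineList.prob, renew,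
      ← lintegral_indicator measurableSet_Iic]
    congr 1 with u
    by_cases hu : u ≤ t
    · rw [Set.indicator_of_mem (Set.mem_Iic.2 hu), ← x.measure_grows, ← ih (fun n => d (n + 1))]
      cases hd : d 0
      · rw [mul_comm, ← Measure.prod_prod]
        congr 1 with p
        simp [Marks, wordJoin, hu, hd, and_comm]
      · rw [← Measure.prod_prod]
        congr 1 with p
        simp [Marks, wordJoin, hu, hd]
    · rw [Set.indicator_of_notMem (by simpa using hu)]
      simp [Marks, wordJoin, hu]

/-! ### Growth of a new tree out of every leaf of a given tree -/

namespace BinTree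

/-- When the leaf `w` of `x` has descendants with lifetimes `C w`, the tree `x` becomes `y` after
time `t`. -/
def GrowsFrom : BinTree → BinTree → (Word → Word → ℝ) → ℝ → Prop
  | leaf, y, C, t => y.Grows (C []) t
  | node _ _, leaf, _, _ => False
  | node l r, node l' r', C, t => l.GrowsFrom l' (fun w => C (false :: w)) t ∧
      r.GrowsFrom r' (fun w => C (true :: w)) t

lemma GrowsFrom.unique {x y z : BinTree} {C : Word → Word → ℝ} {t : ℝ}
    (hy : x.GrowsFrom y C t) (hz : x.GrowsFrom z C t) : y = z := by
  induction x generalizing y z C with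
  | leaf => exact Grows.unique hy hz
  | node l r hl hr =>
    cases y with
    | leaf => exact hy.elim
    | node l' r' =>
      cases z with
      | leaf => exact hz.elim
      | node l'' r'' => rw [hl hy.1 hz.1, hr hy.2 hz.2]

lemma exists_growsFrom (x : BinTree) {C : Word → Word → ℝ} {t : ℝ}
    (h : ∀ w, ∃ y : BinTree, y.Grows (C w) t) : ∃ y, x.GrowsFrom y C t := by
  induction x generalizing C with
  | leaf => exact h []
  | node l r hl hr =>
    obtain ⟨l', hl'⟩ := hl fun w => h (false :: w)
    obtain ⟨r', hr'⟩ := hr fun w => h (true :: w)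
    exact ⟨node l' r', hl', hr'⟩

lemma measurableSet_growsFrom (x y : BinTree) (t : ℝ) :
    MeasurableSet {C | x.GrowsFrom y C t} := by
  induction x generalizing y with
  | leaf => exact (y.measurableSet_grows_right t).preimage (measurable_pi_apply [])
  | node l r hl hr =>
    cases y with
    | leaf => exact MeasurableSet.empty
    | node l' r' =>
      have h (b : Bool) : Measurable fun (C : Word → Word → ℝ) (w : Word) => C (b :: w) := by
        fun_prop
      exact ((hl l').preimage (h false)).inter ((hr r').preimage (h true))

/-- The left and right leaves read separate blocks of lifetimes, hence the product in `growProb`. -/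
lemma measure_growsFrom (x y : BinTree) (t : ℝ) :
    (Measure.infinitePi fun _ : Word => clockMeasure) {C | x.GrowsFrom y C t} =
      growProb t x y := by
  induction x generalizing y with
  | leaf =>
    rw [growProb, ← y.measure_grows]
    exact (measurePreserving_eval_infinitePi (fun _ : Word => clockMeasure) []).measure_preimage
      (y.measurableSet_grows_right t).nullMeasurableSet
  | node l r hl hr =>
    cases y with
    | leaf => simp [GrowsFrom, growProb]
    | node l' r' =>
      rw [infinitePi_word_apply _ (measurableSet_growsFrom _ _ t), growProb, ← hl, ← hr,
        ← Measure.prod_prod]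
      have h (u : Word → ℝ) : {p | wordJoin (u, p) ∈ {C | (node l r).GrowsFrom (node l' r') C t}} =
          {C | l.GrowsFrom l' C t} ×ˢ {C | r.GrowsFrom r' C t} := by
        ext p
        simp [GrowsFrom, wordJoin]
      simp_rw [h]
      rw [lintegral_const, measure_univ, mul_one]

lemma GrowsFrom.mem_leaves_iff {x y : BinTree} {C : Word → Word → ℝ} {t : ℝ}
    (h : x.GrowsFrom y C t) (hC : ∀ w u, 0 < C w u) (ht : 0 ≤ t) (v : Word) :
    v ∈ y.leaves ↔ ∃ w ∈ x.leaves, ∃ u, WordAlive (C w) t u ∧ v = w ++ u := by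
  induction x generalizing y C v with
  | leaf =>
    have hg : y.Grows (C []) t := h
    simp only [← hg.wordAlive_iff (hC []) ht, leaves, Set.mem_singleton_iff, exists_eq_left,
      List.nil_append, exists_eq_right']
  | node l r hl hr =>
    cases y with
    | leaf => exact h.elim
    | node l' r' =>
      cases v with
      | nil =>
        simp only [nil_mem_leaves_node, false_iff]
        rintro ⟨w, hw, u, -, huv⟩
        cases w with
        | nil => simp at hw
        | cons b w => simp at huv
      | cons b v =>
        rw [cons_mem_leaves_node]
        have key : v ∈ (if b then r' else l').leaves ↔ ∃ w ∈ (if b then r else l).leaves,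
            ∃ u, WordAlive (C (b :: w)) t u ∧ v = w ++ u := by
          cases b
          · exact hl h.1 (fun _ _ => hC _ _) v
          · exact hr h.2 (fun _ _ => hC _ _) v
        rw [key]
        constructor
        · rintro ⟨w, hw, u, hu, rfl⟩
          exact ⟨b :: w, by simpa using hw, u, hu, rfl⟩
        · rintro ⟨w, hw, u, hu, huv⟩
          cases w with
          | nil => simp at hw
          | cons b' w =>
            simp only [List.cons_append, List.cons.injEq] at huv
            obtain ⟨rfl, rfl⟩ := huv
            exact ⟨w, by simpa using hw, u, hu, rfl⟩

end BinTree

/-! ### Independent levels -/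

section Levels

variable {α X : Type*}

/-- The elements of a list are numbered from the end: the head of `x :: l` has level `l.length`.
The entry of `K` at the level of each element `x` belongs to `Q x`. -/
def AllLevels (Q : α → ℕ → Set X) : List α → (ℕ → X) → Prop
  | [], _ => True
  | x :: l, K => K l.length ∈ Q x l.length ∧ AllLevels Q l K

/-- The product of the probabilities of the events `Q x`. -/
noncomputable def levelProd [MeasurableSpace X] (μ : Measure X) (Q : α → ℕ → Set X) :
    List α → ℝ≥0∞
  | [] => 1
  | x :: l => μ (Q x l.length) * levelProd μ Q l

variable [MeasurableSpace X]

lemma measurableSet_allLevels {Q : α → ℕ → Set X} (hQ : ∀ x i, MeasurableSet (Q x i))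
    (l : List α) : MeasurableSet {K | AllLevels Q l K} := by
  induction l with
  | nil => exact MeasurableSet.univ
  | cons x l ih => exact ((hQ x _).preimage (measurable_pi_apply _)).inter ih

/-- Numbering from the end gives distinct levels to distinct positions, and these levels do not move
when trees are put at the head. The event is thus a box in the first `l.length` coordinates. -/
lemma measure_allLevels (μ : Measure X) [IsProbabilityMeasure μ] {Q : α → ℕ → Set X}
    (hQ : ∀ x i, MeasurableSet (Q x i)) (l : List α) :
    (Measure.infinitePi fun _ : ℕ => μ) {K | AllLevels Q l K} = levelProd μ Q l := by
  have key : ∃ B : ℕ → Set X, (∀ i, MeasurableSet (B i)) ∧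
      {K | AllLevels Q l K} = Set.pi (Finset.range l.length) B ∧
      levelProd μ Q l = ∏ i ∈ Finset.range l.length, μ (B i) := by
    induction l with
    | nil => exact ⟨fun _ => Set.univ, fun _ => .univ, by simp [AllLevels], by simp [levelProd]⟩
    | cons x l ih =>
      obtain ⟨B, hB, hset, hprod⟩ := ih
      refine ⟨fun i => if i = l.length then Q x i else B i, fun i => ?_, ?_, ?_⟩
      · dsimp only
        split_ifs
        · exact hQ _ _
        · exact hB i
      · ext K
        have hK : AllLevels Q l K ↔ ∀ i < l.length, K i ∈ B i := by
          have := Set.ext_iff.1 hset K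
          simpa using this
        simp only [Set.mem_ofPred_eq, AllLevels, hK, List.length_cons, Set.mem_pi, Finset.mem_coe,
          Finset.mem_range, Nat.lt_succ_iff_lt_or_eq]
        constructor
        · rintro ⟨h1, h2⟩ i (hi | rfl)
          · rw [if_neg hi.ne]
            exact h2 i hi
          · simpa using h1
        · intro h
          refine ⟨by simpa using h l.length (Or.inr rfl), fun i hi => ?_⟩
          have := h i (Or.inl hi)
          rwa [if_neg hi.ne] at this
      · rw [levelProd, hprod, List.length_cons, Finset.prod_range_succ, mul_comm]
        simp only [if_true]
        congr 1
        refine Finset.prod_congr rfl fun i hi => ?_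
        rw [if_neg (Finset.mem_range.1 hi).ne]
  obtain ⟨B, hB, hset, hprod⟩ := key
  rw [hset, hprod, Measure.infinitePi_pi _ fun i _ => hB i]

end Levels

/-- The leaves of the trees in a list, together with the levels of the trees. -/
def levelLeaves : List BinTree → Set (ℕ × Word)
  | [] => ∅
  | x :: l => {p | p.1 = l.length ∧ p.2 ∈ x.leaves} ∪ levelLeaves l

lemma lt_length_of_mem_levelLeaves {l : List BinTree} {i : ℕ} {w : Word}
    (h : (i, w) ∈ levelLeaves l) : i < l.length := by
  induction l with
  | nil => exact h.elim
  | cons x l ih =>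
    rcases h with h | h
    · have : i = l.length := h.1
      simp [this]
    · exact (ih h).trans (by simp)

lemma mem_levelLeaves_cons {x : BinTree} {l : List BinTree} {i : ℕ} {w : Word} :
    (i, w) ∈ levelLeaves (x :: l) ↔ i = l.length ∧ w ∈ x.leaves ∨ (i, w) ∈ levelLeaves l := Iff.rfl

lemma levelLeaves_finite (l : List BinTree) : (levelLeaves l).Finite := by
  induction l with
  | nil => exact Set.finite_empty
  | cons x l ih =>
    refine Set.Finite.union ?_ ih
    refine (x.leaves_finite.image fun w => (l.length, w)).subset ?_
    rintro ⟨i, w⟩ ⟨rfl, hw⟩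
    exact ⟨w, hw, rfl⟩

/-- On each level, the leaves are those of a finite binary tree, if there are any. -/
lemma levelLeaves_level (l : List BinTree) (i : ℕ) :
    (∃ x : BinTree, ∀ w, (i, w) ∈ levelLeaves l ↔ w ∈ x.leaves) ∨ ∀ w, (i, w) ∉ levelLeaves l := by
  induction l with
  | nil => exact Or.inr fun w h => h
  | cons x l ih =>
    by_cases hi : i = l.length
    · refine Or.inl ⟨x, fun w => ?_⟩
      rw [mem_levelLeaves_cons]
      constructor
      · rintro (h | h)
        · exact h.2
        · exact absurd (lt_length_of_mem_levelLeaves h) (by omega)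
      · exact fun h => Or.inl ⟨hi, h⟩
    · simpa [mem_levelLeaves_cons, hi] using ih

open TreeVertex in
/-- When the vertex `h i w` has descendants with lifetimes `C (h i w)`, and the root vertex `v 0`
moves according to `d`, the trees in the first list become those in the second after time `t`. -/
def SpineGrows : List BinTree → List BinTree → (TreeVertex → Word → ℝ) → (ℕ → Bool) → ℝ → Prop
  | [], m, C, d, t => Marks m (C (v 0)) d t
  | _ :: _, [], _, _, _ => False
  | x :: l, y :: m, C, d, t => x.GrowsFrom y (fun w => C (h l.length w)) t ∧ SpineGrows l m C d t

lemma SpineGrows.unique {l m m' : List BinTree} {C : TreeVertex → Word → ℝ} {d : ℕ → Bool} {t : ℝ}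
    (h : SpineGrows l m C d t) (h' : SpineGrows l m' C d t) : m = m' := by
  induction l generalizing m m' with
  | nil => exact Marks.unique h h'
  | cons x l ih =>
    cases m with
    | nil => exact h.elim
    | cons y m =>
      cases m' with
      | nil => exact h'.elim
      | cons y' m' => rw [h.1.unique h'.1, ih h.2 h'.2]

lemma exists_spineGrows (l : List BinTree) {C : TreeVertex → Word → ℝ} {t : ℝ}
    (hC : ∀ X, ∃ x : BinTree, x.Grows (C X) t) (d : ℕ → Bool) : ∃ m, SpineGrows l m C d t := by
  induction l with
  | nil => exact (hC _).choose_spec.exists_marks d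
  | cons x l ih =>
    obtain ⟨m, hm⟩ := ih
    obtain ⟨y, hy⟩ := x.exists_growsFrom fun w => hC (.h l.length w)
    exact ⟨y :: m, hy, hm⟩

lemma measurableSet_spineGrows (l m : List BinTree) (t : ℝ) :
    MeasurableSet {p : (TreeVertex → Word → ℝ) × (ℕ → Bool) | SpineGrows l m p.1 p.2 t} := by
  induction l generalizing m with
  | nil =>
    exact (measurableSet_marks m).preimage
      (f := fun p : (TreeVertex → Word → ℝ) × (ℕ → Bool) => (t, p.1 (.v 0), p.2)) (by fun_prop)
  | cons x l ih =>
    cases m with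
    | nil => exact MeasurableSet.empty
    | cons y m =>
      have h : Measurable fun (p : (TreeVertex → Word → ℝ) × (ℕ → Bool)) (w : Word) =>
        p.1 (.h l.length w) := by fun_prop
      exact ((x.measurableSet_growsFrom y t).preimage h).inter (ih m)

/-- The trees already present remain the oldest, so they become the beginning of `m`, while `m.drop
l.length` comes from the splits of `v 0`. Each level and `v 0` read their own lifetimes, so the
probability factorises. -/
lemma measure_spineGrows (l m : List BinTree) (d : ℕ → Bool) (t : ℝ) :
    (Measure.infinitePi fun _ : TreeVertex => clockMeasure) {C | SpineGrows l m C d t} =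
      SpineList.growProb t l m := by
  let f : Option (ℕ × Word) → TreeVertex := fun o => o.elim (.v 0) fun p => .h p.1 p.2
  have hf : Function.Injective f := by
    rintro (_ | p) (_ | p') h
    · rfl
    · cases h
    · cases h
    · simp only [f, Option.elim_some, TreeVertex.h.injEq] at h
      rw [Prod.ext h.1 h.2]
  have h1 := Measure.map_infinitePi_infinitePi_of_inj (P := fun _ : TreeVertex => clockMeasure) hf
  have h2 := map_optionElim_infinitePi clockMeasure (fun _ : ℕ × Word => clockMeasure)
  have h3 := Measure.infinitePi_map_curry_symm fun (_ : ℕ) (_ : Word) => clockMeasure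
  have hc : (fun o : Option (ℕ × Word) => o.elim clockMeasure fun _ => clockMeasure) =
      fun _ => clockMeasure := by
    ext1 o; cases o <;> rfl
  rw [hc] at h2
  have hm : Measurable fun p : (Word → ℝ) × (ℕ × Word → Word → ℝ) =>
      ((fun o => o.elim p.1 p.2) : Option (ℕ × Word) → Word → ℝ) := by
    refine measurable_pi_lambda _ ?_
    rintro (_ | a)
    · exact measurable_fst
    · exact (measurable_pi_apply a).comp measurable_snd
  have h4 := Measure.map_prod_map (clockMeasure)
    (Measure.infinitePi fun _ : ℕ => Measure.infinitePi fun _ : Word => clockMeasure)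
    measurable_id (MeasurableEquiv.curry ℕ Word (Word → ℝ)).symm.measurable
  rw [Measure.map_id, h3] at h4
  let Q : BinTree × BinTree → ℕ → Set (Word → Word → ℝ) := fun p _ => {C | p.1.GrowsFrom p.2 C t}
  have hQ (p : BinTree × BinTree) (i : ℕ) : MeasurableSet (Q p i) := p.1.measurableSet_growsFrom _ _
  have hval : SpineList.growProb t l m = if l.length ≤ m.length then
      SpineList.prob (m.drop l.length) t *
        levelProd (Measure.infinitePi fun _ : Word => clockMeasure)
        Q (l.zip m) else 0 := by
    induction l generalizing m with
    | nil => simp [SpineList.growProb, levelProd]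
    | cons x l ih =>
      cases m with
      | nil => simp [SpineList.growProb]
      | cons y m =>
        rw [SpineList.growProb, ih]
        by_cases hlm : l.length ≤ m.length
        · simp only [hlm, if_true, List.length_cons, add_le_add_iff_right, List.drop_succ_cons,
            List.zip_cons_cons, levelProd]
          rw [← BinTree.measure_growsFrom]
          ring
        · simp [hlm]
  have hset : ∀ C, SpineGrows l m C d t ↔ l.length ≤ m.length ∧
      Marks (m.drop l.length) (C (.v 0)) d t ∧
      AllLevels Q (l.zip m) (fun i w => C (.h i w)) := by
    intro C
    clear hval
    induction l generalizing m with
    | nil => simp [SpineGrows, AllLevels]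
    | cons x l ih =>
      cases m with
      | nil => simp [SpineGrows]
      | cons y m =>
        simp only [SpineGrows, ih, List.length_cons, add_le_add_iff_right, List.drop_succ_cons,
          List.zip_cons_cons, AllLevels, List.length_zip]
        constructor
        · rintro ⟨h1, h2, h3, h4⟩
          exact ⟨h2, h3, by rwa [min_eq_left h2], h4⟩
        · rintro ⟨h2, h3, h1, h4⟩
          rw [min_eq_left h2] at h1
          exact ⟨h1, h2, h3, h4⟩
  rw [hval]
  split_ifs with hlm
  · have hm1 : MeasurableSet {c | Marks (m.drop l.length) c d t} :=
      (measurableSet_marks _).preimage (f := fun c : Word → ℝ => (t, c, d)) (by fun_prop)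
    have hm2 := measurableSet_allLevels hQ (l.zip m)
    rw [← measure_allLevels _ hQ, ← measure_marks _ d, ← Measure.prod_prod]
    -- Only `v 0` and the vertices `h i w` are read; the lifetimes at the other `v n` are projected
    -- away.
    have hprod : (clockMeasure.prod (Measure.infinitePi fun _ : ℕ =>
        Measure.infinitePi fun _ : Word => clockMeasure)) =
          (Measure.infinitePi fun _ : TreeVertex =>
          clockMeasure).map (fun C => (C (.v 0), fun i w => C (.h i w))) := by
      have : MeasurePreserving (fun p : (Word → ℝ) × (ℕ → Word → Word → ℝ) =>
          ((fun o => o.elim p.1 fun q => p.2 q.1 q.2) : Option (ℕ × Word) → Word → ℝ))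
          (clockMeasure.prod (Measure.infinitePi fun _ : ℕ =>
            Measure.infinitePi fun _ : Word => clockMeasure))
          (Measure.infinitePi fun _ : Option (ℕ × Word) => clockMeasure) := by
        refine ⟨hm.comp (measurable_id.prodMap
          (MeasurableEquiv.curry ℕ Word (Word → ℝ)).symm.measurable), ?_⟩
        rw [← h2, h4, Measure.map_map hm (measurable_id.prodMap
          (MeasurableEquiv.curry ℕ Word (Word → ℝ)).symm.measurable)]
        rfl
      have hg : Measurable fun C : Option (ℕ × Word) → Word → ℝ =>
          (C none, fun (i : ℕ) (w : Word) => C (some (i, w))) := by fun_prop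
      have hg' : Measurable fun (C : TreeVertex → Word → ℝ) (o : Option (ℕ × Word)) => C (f o) := by
        fun_prop
      calc _ = (Measure.infinitePi fun _ : Option (ℕ × Word) => clockMeasure).map
            (fun C => (C none, fun i w => C (some (i, w)))) := by
            rw [← this.map_eq, Measure.map_map hg this.measurable]
            exact (Measure.map_id).symm
        _ = _ := by
            rw [← h1, Measure.map_map hg hg']
            rfl
    have hF : Measurable fun C : TreeVertex → Word → ℝ =>
      (C (.v 0), fun (i : ℕ) (w : Word) => C (.h i w)) := by fun_prop
    rw [hprod, Measure.map_apply hF (hm1.prod hm2)]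
    congr 1 with C
    simp [hset, hlm]
  · have : {C | SpineGrows l m C d t} = ∅ := by
      ext C
      simp [hset, hlm]
    rw [this, measure_empty]

/-! ### The trees along the infinite path, up to a given age -/

lemma map_update_infinitePi {ι X : Type*} [DecidableEq ι] [MeasurableSpace X] (μ : ι → Measure X)
    [∀ i, IsProbabilityMeasure (μ i)] (k : ι) :
    ((Measure.infinitePi μ).prod (μ k)).map (fun p => Function.update p.1 k p.2) =
      Measure.infinitePi μ := by
  refine Measure.eq_infinitePi _ fun s t ht => ?_
  have hm : Measurable fun p : (ι → X) × X => Function.update p.1 k p.2 := by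
    refine measurable_pi_lambda _ fun i => ?_
    by_cases hi : i = k
    · subst hi
      simpa using measurable_snd
    · simp only [Function.update_of_ne hi]
      fun_prop
  rw [Measure.map_apply hm (.pi s.countable_toSet fun _ _ => ht _)]
  have hset : (fun p : (ι → X) × X => Function.update p.1 k p.2) ⁻¹' (Set.pi s t) =
      (Set.pi (s.erase k : Finset ι) t) ×ˢ (if k ∈ s then t k else Set.univ) := by
    ext ⟨f, x⟩
    simp only [Set.mem_preimage, Set.mem_pi, Finset.mem_coe, Set.mem_prod, Finset.mem_erase]
    constructor
    · intro h
      refine ⟨fun i hi => ?_, ?_⟩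
      · simpa [hi.1] using h i hi.2
      · split_ifs with hk
        · simpa using h k hk
        · trivial
    · rintro ⟨h1, h2⟩ i hi
      by_cases hik : i = k
      · subst hik
        simpa [hi] using h2
      · simpa [hik] using h1 i ⟨hik, hi⟩
  rw [hset, Measure.prod_prod, Measure.infinitePi_pi _ fun _ _ => ht _]
  by_cases hk : k ∈ s
  · rw [if_pos hk, Finset.prod_erase_mul _ _ hk]
  · rw [if_neg hk, measure_univ, mul_one, Finset.erase_eq_of_notMem hk]

/-- Resampling one label does not change the law; this isolates a single label for integration while
the others stay in place. -/
lemma lintegral_infinitePi_update {F : (ℕ → ℝ) → ℝ≥0∞} (hF : Measurable F) (k : ℕ) :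
    ∫⁻ s, F s ∂(Measure.infinitePi fun _ : ℕ => expMeasure 1) =
      ∫⁻ s, ∫⁻ u, F (Function.update s k u) ∂(expMeasure 1)
        ∂(Measure.infinitePi fun _ : ℕ => expMeasure 1) := by
  have hm : Measurable fun p : (ℕ → ℝ) × ℝ => Function.update p.1 k p.2 := by
    refine measurable_pi_lambda _ fun i => ?_
    by_cases hi : i = k
    · subst hi
      simpa using measurable_snd
    · simp only [Function.update_of_ne hi]
      fun_prop
  conv_lhs => rw [← map_update_infinitePi (fun _ : ℕ => expMeasure 1) k]
  rw [lintegral_map hF hm]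
  exact lintegral_prod _ (hF.comp hm).aemeasurable

/-- The time by which the tree at level `i` has grown. -/
def age (s : ℕ → ℝ) (i : ℕ) : ℝ := ∑ j ∈ Finset.range (i + 1), s j

lemma measurable_age (i : ℕ) : Measurable fun s => age s i := by
  unfold age; fun_prop

lemma age_succ (s : ℕ → ℝ) (i : ℕ) : age s (i + 1) = age s i + s (i + 1) :=
  Finset.sum_range_succ _ _

lemma age_mono {s : ℕ → ℝ} (hs : ∀ i, 0 < s i) : Monotone (age s) :=
  monotone_nat_of_le_succ fun i => by rw [age_succ]; linarith [hs (i + 1)]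

lemma age_pos {s : ℕ → ℝ} (hs : ∀ i, 0 < s i) (i : ℕ) : 0 < age s i :=
  Finset.sum_pos (fun j _ => hs j) ⟨0, by simp⟩

lemma age_update {s : ℕ → ℝ} {i k : ℕ} (h : i < k) (u : ℝ) :
    age (Function.update s k u) i = age s i := by
  refine Finset.sum_congr rfl fun j hj => ?_
  rw [Function.update_of_ne]
  have := Finset.mem_range.1 hj
  omega

/-- The probability of given shapes of the trees along the path, given the path labels. -/
noncomputable def ageProd (s : ℕ → ℝ) (l : List BinTree) : ℝ≥0∞ :=
  levelProd clockMeasure (fun (x : BinTree) i => {c | x.Grows c (age s i)}) l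

lemma ageProd_nil (s : ℕ → ℝ) : ageProd s [] = 1 := rfl

lemma ageProd_cons (s : ℕ → ℝ) (x : BinTree) (l : List BinTree) :
    ageProd s (x :: l) = x.prob (age s l.length) * ageProd s l := by
  simp only [ageProd, levelProd, BinTree.measure_grows]

lemma measurable_ageProd (l : List BinTree) : Measurable fun s => ageProd s l := by
  induction l with
  | nil => exact measurable_const
  | cons x l ih =>
    simp only [ageProd_cons]
    exact (x.measurable_prob.comp (measurable_age _)).mul ih

lemma ageProd_update {s : ℕ → ℝ} {l : List BinTree} {k : ℕ} (h : l.length ≤ k) (u : ℝ) :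
    ageProd (Function.update s k u) l = ageProd s l := by
  induction l with
  | nil => rfl
  | cons x l ih =>
    have hk : l.length < k := by simpa using h
    rw [ageProd_cons, ageProd_cons, age_update hk, ih hk.le]

lemma lintegral_expMeasure_Ici {f : ℝ → ℝ≥0∞} (hf : Measurable f) :
    ∫⁻ u, f u ∂(expMeasure 1) = ∫⁻ u in Set.Ici 0, ENNReal.ofReal (Real.exp (-u)) * f u := by
  rw [lintegral_expMeasure hf, setLIntegral_congr Ioi_ae_eq_Ici]

/-- The joint law of the shapes of the first trees along the path and of the age at the next
level. -/
lemma lintegral_ageProd_mul (l : List BinTree) {φ : ℝ → ℝ≥0∞} (hφ : Measurable φ) :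
    ∫⁻ s, ageProd s l * φ (age s l.length) ∂(Measure.infinitePi fun _ : ℕ => expMeasure 1) =
      ∫⁻ v in Set.Ici 0, SpineList.prob l v * φ v := by
  induction l generalizing φ with
  | nil =>
    have h := (measurePreserving_eval_infinitePi (fun _ : ℕ => expMeasure 1) 0).lintegral_comp hφ
    simp only [ageProd_nil, one_mul, List.length_nil]
    calc
      _ = ∫⁻ s : ℕ → ℝ, φ (Function.eval 0 s)
          ∂(Measure.infinitePi fun _ : ℕ => expMeasure 1) := by
          simp [age]
      _ = _ := by
        -- At rate one the exponential density exp (-v) equals the tail probability. This is why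
        -- `SpineList.prob` serves here as a density in the age.
        rw [h, lintegral_expMeasure_Ici hφ]
        refine setLIntegral_congr_fun measurableSet_Ici fun v hv => ?_
        simp only [SpineList.prob]
        rw [expMeasure_Ioi hv]
  | cons x l ih =>
    have hx := x.measurable_prob
    have hl := SpineList.measurable_prob l
    have hψ : Measurable fun v => ∫⁻ u, φ (v + u) ∂(expMeasure 1) :=
      Measurable.lintegral_prod_right' (f := fun p : ℝ × ℝ => φ (p.1 + p.2)) (by fun_prop)
    have hm : Measurable fun s => ageProd s (x :: l) * φ (age s (x :: l).length) :=
      (measurable_ageProd _).mul (hφ.comp (measurable_age _))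
    rw [lintegral_infinitePi_update hm (l.length + 1)]
    have h1 (s : ℕ → ℝ) : ∫⁻ u, ageProd (Function.update s (l.length + 1) u) (x :: l) *
        φ (age (Function.update s (l.length + 1) u) (x :: l).length) ∂(expMeasure 1) =
        ageProd s l * (fun v => x.prob v * ∫⁻ u, φ (v + u) ∂(expMeasure 1)) (age s l.length) := by
      have h2 (u : ℝ) : ageProd (Function.update s (l.length + 1) u) (x :: l) *
          φ (age (Function.update s (l.length + 1) u) (x :: l).length) =
          (x.prob (age s l.length) * ageProd s l) * φ (age s l.length + u) := by
        rw [ageProd_update (by simp), ageProd_cons, List.length_cons, age_succ,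
          age_update (by omega), Function.update_self]
      simp_rw [h2]
      rw [lintegral_const_mul _ (by fun_prop)]
      ring
    simp_rw [h1]
    rw [ih (φ := fun v => x.prob v * ∫⁻ u, φ (v + u) ∂(expMeasure 1)) (hx.mul hψ)]
    have hF : Measurable fun v => x.prob v * SpineList.prob l v := hx.mul hl
    -- Both sides become double integrals over a label `u` and an age. They differ by the
    -- translation that adds `u` to the age, applied at the end.
    have e1 : ∫⁻ v in Set.Ici 0, SpineList.prob l v *
        (x.prob v * ∫⁻ u, φ (v + u) ∂(expMeasure 1)) = ∫⁻ u, (∫⁻ v, (Set.Ici (0 : ℝ)).indicator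
          (fun v => (x.prob v * SpineList.prob l v) * φ (v + u)) v) ∂(expMeasure 1) := by
      rw [lintegral_lintegral_swap]
      · rw [← lintegral_indicator measurableSet_Ici]
        congr 1 with v
        by_cases hv : v ∈ Set.Ici (0 : ℝ)
        · simp only [Set.indicator_of_mem hv]
          rw [lintegral_const_mul _ (by fun_prop)]
          ring
        · simp [Set.indicator_of_notMem hv]
      · refine Measurable.aemeasurable ?_
        have : (Function.uncurry fun (u v : ℝ) => (Set.Ici (0 : ℝ)).indicator
          (fun v => (x.prob v * SpineList.prob l v) * φ (v + u)) v) =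
          (Prod.snd ⁻¹' Set.Ici (0 : ℝ)).indicator
            fun p : ℝ × ℝ => (x.prob p.2 * SpineList.prob l p.2) * φ (p.2 + p.1) := by
          ext ⟨u, v⟩
          rfl
        rw [this]
        exact Measurable.indicator (by fun_prop) (measurable_snd measurableSet_Ici)
    have e2 : ∫⁻ v in Set.Ici 0, SpineList.prob (x :: l) v * φ v =
        ∫⁻ u, (∫⁻ w, (Set.Ici (0 : ℝ)).indicator ((Set.Ici u).indicator
          (fun w => (x.prob (w - u) * SpineList.prob l (w - u)) * φ w)) w) ∂(expMeasure 1) := by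
      rw [lintegral_lintegral_swap]
      · rw [← lintegral_indicator measurableSet_Ici]
        congr 1 with w
        by_cases hw : w ∈ Set.Ici (0 : ℝ)
        · simp only [Set.indicator_of_mem hw]
          rw [SpineList.prob, renew, ← lintegral_indicator measurableSet_Iic,
            ← lintegral_mul_const _ (Measurable.indicator (by fun_prop) measurableSet_Iic)]
          congr 1 with u
          by_cases hu : u ≤ w
          · rw [Set.indicator_of_mem (Set.mem_Iic.2 hu), Set.indicator_of_mem (Set.mem_Ici.2 hu)]
          · rw [Set.indicator_of_notMem (by simpa using hu),
              Set.indicator_of_notMem (by simpa using hu), zero_mul]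
        · simp [Set.indicator_of_notMem hw]
      · refine Measurable.aemeasurable ?_
        have : (Function.uncurry fun (u w : ℝ) => (Set.Ici (0 : ℝ)).indicator ((Set.Ici u).indicator
          (fun w => (x.prob (w - u) * SpineList.prob l (w - u)) * φ w)) w) =
          (Prod.snd ⁻¹' Set.Ici (0 : ℝ)).indicator ({p : ℝ × ℝ | p.1 ≤ p.2}.indicator
            fun p : ℝ × ℝ => (x.prob (p.2 - p.1) * SpineList.prob l (p.2 - p.1)) * φ p.2) := by
          ext ⟨u, v⟩
          rfl
        rw [this]
        exact Measurable.indicator (Measurable.indicator (by fun_prop)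
          (measurableSet_le measurable_fst measurable_snd)) (measurable_snd measurableSet_Ici)
    rw [e1, e2]
    refine lintegral_congr_ae ?_
    filter_upwards [ae_pos_expMeasure] with u hu
    symm
    rw [← lintegral_add_right_eq_self _ u]
    congr 1 with v
    by_cases hv : 0 ≤ v
    · rw [Set.indicator_of_mem (Set.mem_Ici.2 hv),
        Set.indicator_of_mem (Set.mem_Ici.2 (by linarith)),
        Set.indicator_of_mem (Set.mem_Ici.2 (by linarith)), add_sub_cancel_right]
    · rw [Set.indicator_of_notMem (a := v) (by simpa using hv)]
      by_cases hvu : 0 ≤ v + u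
      · rw [Set.indicator_of_mem (Set.mem_Ici.2 hvu), Set.indicator_of_notMem (by simpa using hv)]
      · rw [Set.indicator_of_notMem (by simpa using hvu)]

/-- The trees along the path whose ages are at most `t` have the shapes in the list. -/
def TrimmedSpine (l : List BinTree) (s : ℕ → ℝ) (K : ℕ → Word → ℝ) (t : ℝ) : Prop :=
  AllLevels (fun (x : BinTree) i => {c | x.Grows c (age s i)}) l K ∧
    (∀ i < l.length, age s i ≤ t) ∧ t < age s l.length

lemma AllLevels.unique {s : ℕ → ℝ} {K : ℕ → Word → ℝ} {l m : List BinTree}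
    (hl : AllLevels (fun (x : BinTree) i => {c | x.Grows c (age s i)}) l K)
    (hm : AllLevels (fun (x : BinTree) i => {c | x.Grows c (age s i)}) m K)
    (h : l.length = m.length) : l = m := by
  induction l generalizing m with
  | nil => exact (List.length_eq_zero_iff.1 h.symm).symm
  | cons x l ih =>
    cases m with
    | nil => simp at h
    | cons y m =>
      have h' : l.length = m.length := by simpa using h
      have hx : x.Grows (K l.length) (age s l.length) := hl.1
      have hy : y.Grows (K m.length) (age s m.length) := hm.1
      rw [← h'] at hy
      rw [hx.unique hy, ih hl.2 hm.2 h']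

lemma TrimmedSpine.unique {s : ℕ → ℝ} {K : ℕ → Word → ℝ} {t : ℝ} {l m : List BinTree}
    (hl : TrimmedSpine l s K t) (hm : TrimmedSpine m s K t) : l = m := by
  refine hl.1.unique hm.1 (le_antisymm ?_ ?_)
  · by_contra h
    exact absurd (hl.2.1 _ (not_le.1 h)) (not_le.2 hm.2.2)
  · by_contra h
    exact absurd (hm.2.1 _ (not_le.1 h)) (not_le.2 hl.2.2)

lemma measurableSet_trimmedSpine (l : List BinTree) (t : ℝ) :
    MeasurableSet {p : (ℕ → ℝ) × (ℕ → Word → ℝ) | TrimmedSpine l p.1 p.2 t} := by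
  have h1 : MeasurableSet {p : (ℕ → ℝ) × (ℕ → Word → ℝ) |
      AllLevels (fun (x : BinTree) i => {c | x.Grows c (age p.1 i)}) l p.2} := by
    induction l with
    | nil => exact MeasurableSet.univ
    | cons x l ih =>
      have hm : Measurable fun p : (ℕ → ℝ) × (ℕ → Word → ℝ) => (age p.1 l.length, p.2 l.length) :=
        ((measurable_age _).comp measurable_fst).prodMk (by fun_prop)
      exact (x.measurableSet_grows.preimage hm).inter ih
  have h2 (i : ℕ) : MeasurableSet {p : (ℕ → ℝ) × (ℕ → Word → ℝ) | age p.1 i ≤ t} :=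
    measurableSet_le ((measurable_age _).comp measurable_fst) measurable_const
  have h3 : MeasurableSet {p : (ℕ → ℝ) × (ℕ → Word → ℝ) | t < age p.1 l.length} :=
    measurableSet_lt measurable_const ((measurable_age _).comp measurable_fst)
  have h4 : MeasurableSet {p : (ℕ → ℝ) × (ℕ → Word → ℝ) | ∀ i < l.length, age p.1 i ≤ t} := by
    have : {p : (ℕ → ℝ) × (ℕ → Word → ℝ) | ∀ i < l.length, age p.1 i ≤ t} =
        ⋂ i, ⋂ _ : i < l.length, {p | age p.1 i ≤ t} := by
      ext p; simp
    rw [this]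
    exact MeasurableSet.iInter fun i => MeasurableSet.iInter fun _ => h2 i
  exact h1.inter (h4.inter h3)

lemma ae_label_pos : ∀ᵐ s ∂(Measure.infinitePi fun _ : ℕ => expMeasure 1), ∀ i, 0 < s i := by
  rw [ae_all_iff]
  intro i
  exact (measurePreserving_eval_infinitePi (fun _ : ℕ => expMeasure 1) i).quasiMeasurePreserving.ae
    ae_pos_expMeasure

/-- The trees of age at most `t` along the path have the same law as the trees hanging off the path
to the root in the tree of descendants of a vertex after time `t`. -/
theorem measure_trimmedSpine (l : List BinTree) (t : ℝ) :
    ((Measure.infinitePi fun _ : ℕ => expMeasure 1).prod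
      (Measure.infinitePi fun _ : ℕ => clockMeasure)) {p | TrimmedSpine l p.1 p.2 t} =
      SpineList.prob l t := by
  rw [Measure.prod_apply (measurableSet_trimmedSpine l t)]
  have h1 (s : ℕ → ℝ) : (Measure.infinitePi fun _ : ℕ => clockMeasure)
      (Prod.mk s ⁻¹' {p | TrimmedSpine l p.1 p.2 t}) =
      {s | (∀ i < l.length, age s i ≤ t) ∧ t < age s l.length}.indicator
        (fun s => ageProd s l) s := by
    by_cases h : (∀ i < l.length, age s i ≤ t) ∧ t < age s l.length
    · rw [Set.indicator_of_mem (by simpa only [Set.mem_ofPred_eq] using h), ageProd,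
        ← measure_allLevels]
      · congr 1 with K
        simp only [Set.mem_preimage, Set.mem_ofPred_eq, TrimmedSpine]
        exact ⟨fun h' => h'.1, fun h' => ⟨h', h⟩⟩
      · exact fun x i => x.measurableSet_grows_right _
    · rw [Set.indicator_of_notMem (by simpa only [Set.mem_ofPred_eq] using h)]
      convert measure_empty (μ := Measure.infinitePi fun _ : ℕ => clockMeasure)
      ext K
      simp only [Set.mem_preimage, Set.mem_ofPred_eq, TrimmedSpine, Set.mem_empty_iff_false,
        iff_false]
      exact fun h' => h h'.2
  simp_rw [h1]
  cases l with
  | nil =>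
    have h := (measurePreserving_eval_infinitePi (fun _ : ℕ => expMeasure 1) 0).measure_preimage
      (measurableSet_Ioi (a := t)).nullMeasurableSet
    simp only [SpineList.prob]
    rw [← h, ← lintegral_indicator_one ((measurable_pi_apply 0) measurableSet_Ioi)]
    congr 1 with s
    by_cases hs : t < s 0
    · rw [Set.indicator_of_mem (by simpa [age] using hs),
        Set.indicator_of_mem (s := (fun f : ℕ → ℝ => f 0) ⁻¹' Set.Ioi t) hs]
      rfl
    · rw [Set.indicator_of_notMem (by simpa [age] using hs),
        Set.indicator_of_notMem (s := (fun f : ℕ → ℝ => f 0) ⁻¹' Set.Ioi t) hs]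
  | cons x l =>
    have hx := x.measurable_prob
    have hl := SpineList.measurable_prob l
    -- Ages increase almost surely, so only the last age before `t` and the first one after it need
    -- testing.
    let A : Set (ℕ → ℝ) := {s | age s l.length ≤ t ∧ t < age s (l.length + 1)}
    have hA : MeasurableSet A := (measurableSet_le (measurable_age _) measurable_const).inter
      (measurableSet_lt measurable_const (measurable_age _))
    have e1 : ∫⁻ s, {s | (∀ i < (x :: l).length, age s i ≤ t) ∧ t < age s (x :: l).length}.indicator
        (fun s => ageProd s (x :: l)) s ∂(Measure.infinitePi fun _ : ℕ => expMeasure 1) =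
        ∫⁻ s, A.indicator (fun s => ageProd s (x :: l)) s
          ∂(Measure.infinitePi fun _ : ℕ => expMeasure 1) := by
      refine lintegral_congr_ae ?_
      filter_upwards [ae_label_pos] with s hs
      have : s ∈ {s | (∀ i < (x :: l).length, age s i ≤ t) ∧ t < age s (x :: l).length} ↔
          s ∈ A := by
        constructor
        · rintro ⟨h1, h2⟩
          exact ⟨h1 _ (by simp), h2⟩
        · rintro ⟨h1, h2⟩
          refine ⟨fun i hi => (age_mono hs ?_).trans h1, h2⟩
          simp only [List.length_cons] at hi
          omega
      by_cases h : s ∈ A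
      · rw [Set.indicator_of_mem h, Set.indicator_of_mem (this.2 h)]
      · rw [Set.indicator_of_notMem h, Set.indicator_of_notMem (fun h' => h (this.1 h'))]
    -- Integrating out the label that carries the age beyond `t` leaves its tail probability as a
    -- factor.
    rw [e1, lintegral_infinitePi_update (k := l.length + 1) ((measurable_ageProd _).indicator hA)]
    have h2 (s : ℕ → ℝ) : ∫⁻ u, A.indicator (fun s => ageProd s (x :: l))
        (Function.update s (l.length + 1) u) ∂(expMeasure 1) = ageProd s l *
        (Set.Iic t).indicator (fun v => x.prob v * expMeasure 1 (Set.Ioi (t - v)))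
          (age s l.length) := by
      have h3 (u : ℝ) : A.indicator (fun s => ageProd s (x :: l))
          (Function.update s (l.length + 1) u) = (ageProd s l * (Set.Iic t).indicator
            x.prob (age s l.length)) * (Set.Ioi (t - age s l.length)).indicator 1 u := by
        have hmem : Function.update s (l.length + 1) u ∈ A ↔
            age s l.length ≤ t ∧ t - age s l.length < u := by
          simp only [A, Set.mem_ofPred_eq, age_succ, age_update (Nat.lt_succ_self l.length),
            Function.update_self, sub_lt_iff_lt_add']
        by_cases h : age s l.length ≤ t ∧ t - age s l.length < u
        · rw [Set.indicator_of_mem (hmem.2 h), Set.indicator_of_mem (Set.mem_Iic.2 h.1),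
            Set.indicator_of_mem (Set.mem_Ioi.2 h.2), ageProd_update (by simp), ageProd_cons]
          simp [mul_comm]
        · rw [Set.indicator_of_notMem (fun h' => h (hmem.1 h'))]
          rcases not_and_or.1 h with h | h
          · rw [Set.indicator_of_notMem (by simpa using h)]; simp
          · rw [Set.indicator_of_notMem (s := Set.Ioi _) (by simpa using h)]; simp
      simp_rw [h3]
      rw [lintegral_const_mul _ (measurable_one.indicator measurableSet_Ioi),
        lintegral_indicator_one measurableSet_Ioi, mul_assoc]
      congr 1
      by_cases h : age s l.length ≤ t
      · rw [Set.indicator_of_mem (Set.mem_Iic.2 h), Set.indicator_of_mem (Set.mem_Iic.2 h)]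
      · rw [Set.indicator_of_notMem (by simpa using h), Set.indicator_of_notMem (by simpa using h),
          zero_mul]
    simp_rw [h2]
    have hE := measurable_expMeasure_Ioi
    have hφ : Measurable ((Set.Iic t).indicator
        fun v => x.prob v * expMeasure 1 (Set.Ioi (t - v))) :=
      Measurable.indicator (hx.mul (hE.comp (measurable_const.sub measurable_id)))
        measurableSet_Iic
    -- Time reversal: the age `v` of the oldest tree kept corresponds to a first split at time `u =
    -- t - v`.
    rw [lintegral_ageProd_mul l hφ, SpineList.prob, renew, ← lintegral_indicator measurableSet_Iic,
      lintegral_expMeasure_Ici (Measurable.indicator (by fun_prop) measurableSet_Iic),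
      ← lintegral_indicator measurableSet_Ici, ← lintegral_indicator measurableSet_Ici,
      ← lintegral_sub_left_eq_self _ t]
    congr 1 with u
    by_cases hu : 0 ≤ u
    · by_cases hut : u ≤ t
      · rw [Set.indicator_of_mem (Set.mem_Ici.2 (by linarith)),
          Set.indicator_of_mem (Set.mem_Iic.2 (by linarith)),
          Set.indicator_of_mem (Set.mem_Ici.2 hu), Set.indicator_of_mem (Set.mem_Iic.2 hut),
          sub_sub_cancel, expMeasure_Ioi hu]
        ring
      · rw [Set.indicator_of_notMem (by simpa using hut), Set.indicator_of_mem (Set.mem_Ici.2 hu),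
          Set.indicator_of_notMem (by simpa using hut), mul_zero]
    · rw [Set.indicator_of_notMem (a := u) (by simpa using hu)]
      by_cases hut : 0 ≤ t - u
      · rw [Set.indicator_of_mem (Set.mem_Ici.2 hut), Set.indicator_of_notMem (by simpa using hu),
          mul_zero]
      · rw [Set.indicator_of_notMem (by simpa using hut)]

/-- The shapes along the path to the root have a probability distribution. -/
lemma tsum_spineList_prob (t : ℝ) : ∑' l, SpineList.prob l t = 1 := by
  -- The law of the shapes is the same for every choice sequence; any one will do.
  have d : ℕ → Bool := fun _ => false
  simp_rw [← fun l => measure_marks l d t]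
  have hm (l : List BinTree) : MeasurableSet {c | Marks l c d t} :=
    (measurableSet_marks l).preimage (f := fun c : Word → ℝ => (t, c, d)) (by fun_prop)
  rw [← measure_iUnion _ hm]
  · refine (prob_compl_eq_zero_iff (MeasurableSet.iUnion hm)).1 ?_
    refine measure_mono_null ?_ (ae_iff.1 (ae_exists_grows t))
    intro c hc
    simp only [Set.mem_compl_iff, Set.mem_iUnion, Set.mem_ofPred_eq, not_exists] at hc ⊢
    intro x hx
    obtain ⟨l, hl⟩ := hx.exists_marks d
    exact hc l hl
  · intro l m hlm
    rw [Function.onFun, Set.disjoint_left]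
    intro c hc hc'
    exact hlm (hc.unique hc')

/-! ### Isomorphisms, components and classes of multigraphs -/

namespace RootedMultigraph

variable {U V W : Type}

lemma Iso.symm {G : RootedMultigraph V} {H : RootedMultigraph W} (h : G.Iso H) : H.Iso G := by
  obtain ⟨f, hr, hm⟩ := h
  refine ⟨f.symm, ?_, fun x y => ?_⟩
  · have h : f ⟨G.root, G.root_mem⟩ = ⟨H.root, H.root_mem⟩ := Subtype.ext hr
    rw [← h, Equiv.symm_apply_apply]
  · rw [← hm, Equiv.apply_symm_apply, Equiv.apply_symm_apply]

lemma Iso.trans {G : RootedMultigraph U} {H : RootedMultigraph V} {K : RootedMultigraph W}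
    (h : G.Iso H) (h' : H.Iso K) : G.Iso K := by
  obtain ⟨f, hr, hm⟩ := h
  obtain ⟨g, hr', hm'⟩ := h'
  refine ⟨f.trans g, ?_, fun x y => ?_⟩
  · have h : f ⟨G.root, G.root_mem⟩ = ⟨H.root, H.root_mem⟩ := Subtype.ext hr
    rw [Equiv.trans_apply, h, hr']
  · rw [Equiv.trans_apply, Equiv.trans_apply, hm', hm]

lemma iso_of_injOn {G : RootedMultigraph V} {H : RootedMultigraph W} (f : V → W)
    (hf : Set.InjOn f G.verts) (himg : f '' G.verts = H.verts) (hr : f G.root = H.root)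
    (hm : ∀ x ∈ G.verts, ∀ y ∈ G.verts, H.mult (f x) (f y) = G.mult x y) : G.Iso H := by
  have hb : Set.BijOn f G.verts H.verts := himg ▸ hf.bijOn_image
  exact ⟨Set.BijOn.equiv f hb, hr, fun x y => hm x x.2 y y.2⟩

lemma iso_relabel (e : V ≃ W) (G : RootedMultigraph V) : G.Iso (G.relabel e) := by
  refine iso_of_injOn e e.injective.injOn ?_ rfl fun x _ y _ => by simp [relabel]
  ext y
  simp only [Set.mem_image, relabel, Set.mem_ofPred_eq]
  constructor
  · rintro ⟨x, hx, rfl⟩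
    simpa using hx
  · exact fun h => ⟨_, h, by simp⟩

lemma isoClass_eq_mk {V : Type} [Countable V] [Infinite V] {G : RootedMultigraph V}
    {H : RootedMultigraph ℕ} (h : G.Iso H) : G.isoClass = ⟦H⟧ :=
  Quotient.sound ((iso_relabel _ G).symm.trans h)

lemma isoClass_eq_of_iso [Countable V] [Infinite V] [Countable W] [Infinite W]
    {G : RootedMultigraph V} {H : RootedMultigraph W} (h : G.Iso H) : G.isoClass = H.isoClass :=
  isoClass_eq_mk (h.trans (iso_relabel _ H))

lemma Reachable.mem_verts {G : RootedMultigraph V} {x : V} (h : G.Reachable x) : x ∈ G.verts := by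
  cases h with
  | refl => exact G.root_mem
  | tail _ h => exact G.mem_of_mult _ _ (by rwa [G.mult_comm])

lemma reachable_root (G : RootedMultigraph V) : G.Reachable G.root := Relation.ReflTransGen.refl

lemma Reachable.of_mult {G : RootedMultigraph V} {x y : V} (h : G.Reachable x)
    (hxy : G.mult x y ≠ 0) : G.Reachable y := h.tail hxy

lemma Reachable.map_iso {G : RootedMultigraph V} {H : RootedMultigraph W}
    (f : G.verts ≃ H.verts) (hr : (f ⟨G.root, G.root_mem⟩ : W) = H.root)
    (hm : ∀ x y : G.verts, H.mult (f x) (f y) = G.mult x y) {x : V} (h : G.Reachable x)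
    (hx : x ∈ G.verts) : H.Reachable (f ⟨x, hx⟩) := by
  induction h with
  | refl => rw [hr]; exact H.reachable_root
  | @tail b c hb hbc ih =>
    have hb' : b ∈ G.verts := Reachable.mem_verts hb
    exact (ih hb').of_mult (by rw [hm]; exact hbc)

lemma component_mult_of_reachable {G : RootedMultigraph V} {x y : V} (hx : G.Reachable x) :
    G.component.mult x y = G.mult x y := by
  by_cases hy : G.Reachable y
  · exact if_pos ⟨hx, hy⟩
  · have h0 : G.mult x y = 0 := by
      by_contra h
      exact hy (hx.of_mult h)
    rw [h0]
    exact if_neg fun h => hy h.2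

lemma Iso.component {G : RootedMultigraph V} {H : RootedMultigraph W} (h : G.Iso H) :
    G.component.Iso H.component := by
  obtain ⟨f, hr, hm⟩ := h
  have hr' : (f.symm ⟨H.root, H.root_mem⟩ : V) = G.root := by
    have h : f ⟨G.root, G.root_mem⟩ = ⟨H.root, H.root_mem⟩ := Subtype.ext hr
    rw [← h, Equiv.symm_apply_apply]
  have hm' (x y : H.verts) : G.mult (f.symm x) (f.symm y) = H.mult x y := by
    rw [← hm, Equiv.apply_symm_apply, Equiv.apply_symm_apply]
  let e : G.component.verts ≃ H.component.verts :=
    { toFun := fun x => ⟨f ⟨x, Reachable.mem_verts x.2⟩, Reachable.map_iso f hr hm x.2 _⟩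
      invFun := fun y => ⟨f.symm ⟨y, Reachable.mem_verts y.2⟩,
        Reachable.map_iso f.symm hr' hm' y.2 _⟩
      left_inv := fun x => by simp
      right_inv := fun y => by simp }
  refine ⟨e, hr, fun x y => ?_⟩
  rw [component_mult_of_reachable (e x).2, component_mult_of_reachable x.2]
  exact hm ⟨x, _⟩ ⟨y, _⟩

@[ext] lemma ext' {G H : RootedMultigraph V} (hv : G.verts = H.verts) (hm : G.mult = H.mult)
    (hr : G.root = H.root) : G = H := by
  cases G; cases H
  simp only [mk.injEq]
  exact ⟨hv, hm, hr⟩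

/-- Two graphs that agree on a set containing the root and closed under adjacency have the same
component of the root. -/
lemma component_congr {G H : RootedMultigraph V} (B : Set V) (hr : G.root = H.root)
    (hB : G.root ∈ B) (hm : ∀ x ∈ B, ∀ y, G.mult x y = H.mult x y)
    (hcl : ∀ x ∈ B, ∀ y, G.mult x y ≠ 0 → y ∈ B) : G.component = H.component := by
  have h1 (x : V) (h : G.Reachable x) : H.Reachable x ∧ x ∈ B := by
    induction h with
    | refl => exact ⟨hr ▸ H.reachable_root, hB⟩
    | @tail b c _ hbc ih => exact ⟨ih.1.of_mult (hm b ih.2 c ▸ hbc), hcl b ih.2 c hbc⟩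
  have h2 (x : V) (h : H.Reachable x) : G.Reachable x := by
    induction h with
    | refl => exact hr ▸ G.reachable_root
    | @tail b c _ hbc ih => exact ih.of_mult ((hm b (h1 b ih).2 c).symm ▸ hbc)
  have h3 (x : V) : G.Reachable x ↔ H.Reachable x := ⟨fun h => (h1 x h).1, h2 x⟩
  refine ext' (Set.ext h3) ?_ hr
  funext x y
  by_cases hx : G.Reachable x
  · rw [component_mult_of_reachable hx, component_mult_of_reachable ((h3 x).1 hx),
      hm x (h1 x hx).2]
  · rw [component, component]
    simp only
    rw [if_neg fun h => hx h.1, if_neg fun h => hx ((h3 x).2 h.1)]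

lemma connected_component (G : RootedMultigraph V) : G.component.Connected := by
  intro x hx
  have hx' : G.Reachable x := hx
  clear hx
  induction hx' with
  | refl => exact G.component.reachable_root
  | tail hb hbc ih => exact ih.of_mult (by rwa [component_mult_of_reachable hb])

lemma Connected.of_iso {G : RootedMultigraph V} {H : RootedMultigraph W} (h : G.Iso H)
    (hG : G.Connected) : H.Connected := by
  obtain ⟨f, hr, hm⟩ := h
  intro y hy
  have h := Reachable.map_iso f hr hm (hG _ (f.symm ⟨y, hy⟩).2) (f.symm ⟨y, hy⟩).2
  simpa using h

lemma rootDegree_component (G : RootedMultigraph V) : G.component.rootDegree = G.rootDegree := by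
  unfold rootDegree
  congr 1 with x
  exact congrArg _ (component_mult_of_reachable G.reachable_root)

lemma rootDegree_relabel (e : V ≃ W) (G : RootedMultigraph V) :
    (G.relabel e).rootDegree = G.rootDegree := by
  unfold rootDegree
  rw [← e.tsum_eq]
  simp [relabel]

lemma relabel_component (e : V ≃ W) (G : RootedMultigraph V) :
    (G.relabel e).component = G.component.relabel e := by
  have h1 (x : W) (h : (G.relabel e).Reachable x) : G.Reachable (e.symm x) := by
    induction h with
    | refl => simpa [relabel] using G.reachable_root
    | tail _ hbc ih => exact ih.of_mult hbc
  have h2 (x : V) (h : G.Reachable x) : (G.relabel e).Reachable (e x) := by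
    induction h with
    | refl => exact (G.relabel e).reachable_root
    | tail _ hbc ih => exact ih.of_mult (by simpa [relabel] using hbc)
  have h3 (x : W) : (G.relabel e).Reachable x ↔ G.Reachable (e.symm x) :=
    ⟨h1 x, fun h => by simpa using h2 _ h⟩
  refine ext' (Set.ext h3) ?_ rfl
  funext x y
  by_cases hx : G.Reachable (e.symm x)
  · rw [component_mult_of_reachable ((h3 x).2 hx)]
    exact (component_mult_of_reachable hx).symm
  · exact (if_neg fun h => hx ((h3 x).1 h.1)).trans (if_neg fun h => hx h.1).symm

/-- The cluster process only depends on the component of the root. -/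
lemma cluster_component (G : RootedMultigraph ℕ) (ω : Noise) (t : ℝ) :
    G.component.cluster ω t = G.cluster ω t := by
  refine (component_congr (G := G.full ω t) (H := G.component.full ω t)
    {x : ℕ × Word | G.Reachable x.1}
    rfl G.reachable_root ?_ ?_).symm
  · intro x hx y
    have h1 : G.oldEdges ω x y = G.component.oldEdges ω x y := by
      ext k
      simp only [oldEdges, component_mult_of_reachable hx]
    have h2 : G.newEdges ω x y = G.component.newEdges ω x y := by
      ext k
      have hx1 : x.1 ∈ G.verts := Reachable.mem_verts hx
      have hx2 : x.1 ∈ G.component.verts := hx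
      simp only [newEdges, hx1, hx2]
    simp only [full, h1, h2]
  · intro x hx y hxy
    by_contra hy
    have hne : x.1 ≠ y.1 := fun h => hy (show G.Reachable y.1 from h ▸ hx)
    have h0 : G.mult x.1 y.1 = 0 := by
      by_contra h
      exact hy (Reachable.of_mult hx h)
    apply hxy
    have h1 : G.oldEdges ω x y = ∅ := by
      ext k
      simp [oldEdges, h0]
    have h2 : G.newEdges ω x y = ∅ := by
      ext k
      simp [newEdges, hne]
    simp [full, h1, h2]

/-- A finite graph is determined by its root, its vertex set and the multiplicities on that set.
Countability is what later permits arbitrary, not just measurable, sets of classes in the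
convergence statement. -/
lemma countable_setOf_finite : {G : RootedMultigraph ℕ | G.verts.Finite}.Countable := by
  classical
  let f : {G : RootedMultigraph ℕ | G.verts.Finite} → ℕ × Σ s : Finset ℕ, (s → s → ℕ) :=
    fun G => (G.1.root, ⟨G.2.toFinset, fun x y => G.1.mult x y⟩)
  have hf : Function.Injective f := by
    rintro ⟨G, hG⟩ ⟨H, hH⟩ h
    simp only [f, Prod.mk.injEq, Sigma.mk.injEq] at h
    obtain ⟨hr, hs, hm⟩ := h
    have hv : G.verts = H.verts := by simpa using hs
    refine Subtype.ext (ext' hv ?_ hr)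
    have hm' : ∀ x ∈ G.verts, ∀ y ∈ G.verts, G.mult x y = H.mult x y := by
      obtain ⟨Gv, Gm, Gr, a1, a2, a3, a4⟩ := G
      obtain ⟨Hv, Hm, Hr, b1, b2, b3, b4⟩ := H
      simp only at hv hm ⊢
      subst hv
      intro x hx y hy
      have := congrFun (congrFun (eq_of_heq hm) ⟨x, by simpa using hx⟩) ⟨y, by simpa using hy⟩
      exact this
    funext x y
    by_cases hx : x ∈ G.verts
    · by_cases hy : y ∈ G.verts
      · exact hm' x hx y hy
      · have h1 : G.mult x y = 0 := by
          by_contra h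
          exact hy (G.mem_of_mult y x (by rwa [G.mult_comm]))
        have h2 : H.mult x y = 0 := by
          by_contra h
          exact hy (hv ▸ H.mem_of_mult y x (by rwa [H.mult_comm]))
        rw [h1, h2]
    · have h1 : G.mult x y = 0 := by
        by_contra h
        exact hx (G.mem_of_mult x y h)
      have h2 : H.mult x y = 0 := by
        by_contra h
        exact hx (hv ▸ H.mem_of_mult x y h)
      rw [h1, h2]
  exact Set.countable_coe_iff.1 hf.countable

lemma measurableSet_singleton_graph (G : RootedMultigraph ℕ) : MeasurableSet {G} := by
  let f : RootedMultigraph ℕ → ℕ × (ℕ → Prop) × (ℕ → ℕ → ℕ) := fun G => (G.root, G.verts, G.mult)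
  have hf : Function.Injective f := by
    intro G H h
    have h1 := (Prod.mk.inj h).2
    exact ext' (Prod.mk.inj h1).1 (Prod.mk.inj h1).2 (Prod.mk.inj h).1
  have h : ({G} : Set (RootedMultigraph ℕ)) = f ⁻¹' {f G} := by
    ext H
    simp [hf.eq_iff]
  rw [h]
  exact ⟨{f G}, MeasurableSet.singleton _, rfl⟩

lemma Iso.finite {G : RootedMultigraph V} {H : RootedMultigraph W} (h : G.Iso H)
    (hG : G.verts.Finite) : H.verts.Finite := by
  obtain ⟨f, -⟩ := h
  have := hG.to_subtype
  exact Set.finite_coe_iff.1 (Finite.of_equiv _ f)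

lemma isFinite_isoClass [Countable V] [Infinite V] {G : RootedMultigraph V}
    (hG : G.verts.Finite) : G.isoClass.IsFinite :=
  ⟨_, (iso_relabel _ G).finite hG, rfl⟩

end RootedMultigraph

open RootedMultigraph

lemma MultigraphClass.countable_setOf_isFinite : {c : MultigraphClass | c.IsFinite}.Countable := by
  refine (countable_setOf_finite.image fun G => (⟦G⟧ : MultigraphClass)).mono ?_
  rintro c ⟨G, hG, rfl⟩
  exact ⟨G, hG, rfl⟩

/-- Every set of classes of finite graphs is measurable. -/
lemma MultigraphClass.measurableSet_of_isFinite {S : Set MultigraphClass}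
    (hS : ∀ c ∈ S, c.IsFinite) : MeasurableSet S := by
  have hS' : S.Countable := countable_setOf_isFinite.mono hS
  refine (Set.biUnion_of_singleton S) ▸ MeasurableSet.biUnion hS' fun c hc => ?_
  obtain ⟨G, hG, rfl⟩ := hS c hc
  rw [measurableSet_quotient]
  have : (Quotient.mk'' ⁻¹' ({⟦G⟧} : Set MultigraphClass) : Set (RootedMultigraph ℕ)) =
      ⋃ H ∈ {H : RootedMultigraph ℕ | H.verts.Finite ∧ H.Iso G}, {H} := by
    ext H
    simp only [Set.mem_preimage, Set.mem_singleton_iff, Set.mem_iUnion, Set.mem_ofPred_eq,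
      exists_prop, exists_eq_right']
    constructor
    · intro h
      have h' : H.Iso G := Quotient.exact h
      exact ⟨h'.symm.finite hG, h'⟩
    · exact fun h => Quotient.sound h.2
  rw [this]
  exact MeasurableSet.biUnion (countable_setOf_finite.mono fun H hH => hH.1)
    fun H _ => measurableSet_singleton_graph H

/-! ### Measurability of random multigraphs -/

section RandomSets

variable {Ω α : Type*} [MeasurableSpace Ω]

lemma measurable_ncard_of_mem [Countable α] {A : Ω → Set α}
    (hA : ∀ a, MeasurableSet {ω | a ∈ A ω}) : Measurable fun ω => (A ω).ncard :=
  measurable_ncard.comp (measurable_set_iff.2 fun a => measurableSet_setOfPred.1 (hA a))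

lemma measurable_nat_sInf {A : Ω → Set ℕ} (hA : ∀ n, MeasurableSet {ω | n ∈ A ω}) :
    Measurable fun ω => sInf (A ω) := by
  refine measurable_to_countable' fun k => ?_
  -- The last event accounts for the convention that the infimum of the empty set is `0`.
  have h : (fun ω => sInf (A ω)) ⁻¹' {k} =
      ({ω | k ∈ A ω} ∩ ⋂ j ∈ Set.Iio k, {ω | j ∈ A ω}ᶜ) ∪
        {ω | k = 0 ∧ ∀ n, n ∉ A ω} := by
    ext ω
    simp only [Set.mem_preimage, Set.mem_singleton_iff, Set.mem_union, Set.mem_inter_iff,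
      Set.mem_iInter, Set.mem_ofPred_eq, Set.mem_compl_iff, Set.mem_Iio]
    constructor
    · rintro rfl
      by_cases hne : (A ω).Nonempty
      · exact Or.inl ⟨Nat.sInf_mem hne, fun j hj => Nat.notMem_of_lt_sInf hj⟩
      · rw [Set.not_nonempty_iff_eq_empty] at hne
        exact Or.inr ⟨by simp [hne], by simp [hne]⟩
    · rintro (⟨hk, hj⟩ | ⟨rfl, hn⟩)
      · refine le_antisymm (Nat.sInf_le hk) ?_
        by_contra hlt
        push Not at hlt
        exact hj _ hlt (Nat.sInf_mem ⟨k, hk⟩)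
      · have : A ω = ∅ := Set.eq_empty_of_forall_notMem hn
        simp [this]
  rw [h]
  refine ((hA k).inter (MeasurableSet.biInter (Set.to_countable _) fun j _ =>
    (hA j).compl)).union ?_
  by_cases hk : k = 0
  · simp only [hk, true_and, Set.ofPred_forall]
    exact MeasurableSet.iInter fun n => (hA n).compl
  · simp [hk]

end RandomSets

/-- All the data of the random graph `G` are random variables. -/
structure MeasurableGraph {Ω : Type*} [MeasurableSpace Ω] {V : Type}
    (G : Ω → RootedMultigraph V) : Prop where
  root : ∀ x, MeasurableSet {ω | (G ω).root = x}
  verts : ∀ x, MeasurableSet {ω | x ∈ (G ω).verts}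
  mult : ∀ x y, Measurable fun ω => (G ω).mult x y

namespace MeasurableGraph

variable {Ω Ω' : Type*} [MeasurableSpace Ω] [MeasurableSpace Ω'] {V W : Type}

lemma comp {G : Ω → RootedMultigraph V} (hG : MeasurableGraph G) {f : Ω' → Ω}
    (hf : Measurable f) : MeasurableGraph fun ω => G (f ω) where
  root x := hf (hG.root x)
  verts x := hf (hG.verts x)
  mult x y := (hG.mult x y).comp hf

lemma measurable {G : Ω → RootedMultigraph ℕ} (hG : MeasurableGraph G) : Measurable G := by
  refine measurable_comap_iff.2 ((measurable_to_countable' fun k => hG.root k).prodMk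
    (Measurable.prodMk ?_ ?_))
  · exact measurable_set_iff.2 fun x => measurableSet_setOfPred.1 (hG.verts x)
  · exact measurable_pi_iff.2 fun x => measurable_pi_iff.2 fun y => hG.mult x y

lemma id : MeasurableGraph fun G : RootedMultigraph ℕ => G := by
  have h := comap_measurable (m := inferInstance)
    (fun G : RootedMultigraph ℕ => ((G.root, G.verts, G.mult) : ℕ × Set ℕ × (ℕ → ℕ → ℕ)))
  exact
    { root := fun x => h.fst (MeasurableSet.singleton x)
      verts := fun x => measurableSet_setOfPred.2 (measurable_set_iff.1 h.snd.fst x)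
      mult := fun x y => measurable_pi_iff.1 (measurable_pi_iff.1 h.snd.snd x) y }

lemma of_measurable {G : Ω → RootedMultigraph ℕ} (hG : Measurable G) : MeasurableGraph G :=
  id.comp hG

lemma relabel {G : Ω → RootedMultigraph V} (hG : MeasurableGraph G) (e : V ≃ W) :
    MeasurableGraph fun ω => (G ω).relabel e where
  root x := by
    convert hG.root (e.symm x) using 3
    exact (Equiv.eq_symm_apply e).symm
  verts x := hG.verts (e.symm x)
  mult x y := hG.mult (e.symm x) (e.symm y)

lemma isoClass [Countable V] [Infinite V] {G : Ω → RootedMultigraph V}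
    (hG : MeasurableGraph G) : Measurable fun ω => (G ω).isoClass :=
  measurable_quotient_mk''.comp (hG.relabel _).measurable

lemma reachable [Countable V] {G : Ω → RootedMultigraph V} (hG : MeasurableGraph G) (x : V) :
    MeasurableSet {ω | (G ω).Reachable x} := by
  -- `R n x` is the event that some walk of exactly `n` steps leads from the root to `x`.
  let R : ℕ → V → Set Ω := fun n => Nat.rec (fun x => {ω | (G ω).root = x})
    (fun _ R x => ⋃ y, R y ∩ {ω | (G ω).mult y x ≠ 0}) n
  have hR (n : ℕ) : ∀ x, MeasurableSet (R n x) := by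
    induction n with
    | zero => exact hG.root
    | succ n ih =>
      exact fun x => MeasurableSet.iUnion fun y =>
        (ih y).inter (hG.mult y x (MeasurableSet.singleton 0).compl)
  have h : {ω | (G ω).Reachable x} = ⋃ n, R n x := by
    ext ω
    simp only [Set.mem_ofPred_eq, Set.mem_iUnion]
    constructor
    · intro h
      induction h with
      | refl => exact ⟨0, rfl⟩
      | @tail b c _ hbc ih =>
        obtain ⟨n, hn⟩ := ih
        exact ⟨n + 1, Set.mem_iUnion.2 ⟨b, hn, hbc⟩⟩
    · rintro ⟨n, hn⟩
      induction n generalizing x with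
      | zero =>
        obtain rfl : (G ω).root = x := hn
        exact (G ω).reachable_root
      | succ n ih =>
        obtain ⟨y, hy, hyx⟩ := Set.mem_iUnion.1 hn
        exact (ih y hy).of_mult hyx
  rw [h]
  exact MeasurableSet.iUnion fun n => hR n x

lemma component [Countable V] {G : Ω → RootedMultigraph V} (hG : MeasurableGraph G) :
    MeasurableGraph fun ω => (G ω).component where
  root := hG.root
  verts := hG.reachable
  mult x y := by
    classical
    have : (fun ω => (G ω).component.mult x y) =
        fun ω => if ω ∈ {ω | (G ω).Reachable x} then (G ω).mult x y else 0 := by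
      funext ω
      by_cases hx : (G ω).Reachable x
      · rw [if_pos (by exact hx)]
        exact RootedMultigraph.component_mult_of_reachable hx
      · rw [if_neg (by exact hx)]
        exact if_neg fun h => hx h.1
    rw [this]
    exact Measurable.ite (hG.reachable x) (hG.mult x y) measurable_const

lemma connected [Countable V] {G : Ω → RootedMultigraph V} (hG : MeasurableGraph G) :
    MeasurableSet {ω | (G ω).Connected} := by
  have h : {ω | (G ω).Connected} = ⋂ x, {ω | x ∈ (G ω).verts}ᶜ ∪ {ω | (G ω).Reachable x} := by
    ext ω
    simp [RootedMultigraph.Connected, imp_iff_not_or]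
  rw [h]
  exact MeasurableSet.iInter fun x => (hG.verts x).compl.union (hG.reachable x)

lemma rootDegree [Countable V] {G : Ω → RootedMultigraph V} (hG : MeasurableGraph G) :
    Measurable fun ω => (G ω).rootDegree := by
  classical
  have h : (fun ω => (G ω).rootDegree) = fun ω => ∑' a,
      {ω | (G ω).root = a}.indicator (fun ω => ∑' x, ((G ω).mult a x : ℝ≥0∞)) ω := by
    funext ω
    rw [tsum_eq_single (G ω).root]
    · rw [Set.indicator_of_mem (by exact rfl)]
      rfl
    · intro a ha
      exact Set.indicator_of_notMem (fun h => ha (by exact h.symm)) _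
  rw [h]
  refine Measurable.tsum fun a => Measurable.indicator ?_ (hG.root a)
  exact Measurable.tsum fun x => measurable_from_top.comp (hG.mult a x)

end MeasurableGraph

/-! ### Measurability of the process -/

lemma measurable_birthTime (a : ℕ) (w : Word) :
    Measurable fun clock : ℕ × Word → ℝ => birthTime clock a w := by
  unfold birthTime
  fun_prop

lemma measurable_splitTime (a : ℕ) (w : Word) :
    Measurable fun clock : ℕ × Word → ℝ => splitTime clock a w :=
  (measurable_birthTime a w).add (measurable_pi_apply _)

lemma measurableSet_alive (t : ℝ) (x : ℕ × Word) :
    MeasurableSet {clock : ℕ × Word → ℝ | Alive clock t x} :=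
  (measurableSet_le (measurable_birthTime _ _) measurable_const).inter
    (measurableSet_lt measurable_const (measurable_splitTime _ _))

lemma initialWord_succ (c : ℕ → Bool) (n : ℕ) :
    initialWord c (n + 1) = initialWord c n ++ [c n] := by
  simp [initialWord, List.range_succ]

lemma measurableSet_initialWord (n : ℕ) (u : Word) :
    MeasurableSet {c : ℕ → Bool | initialWord c n = u} := by
  induction n generalizing u with
  | zero => simp [initialWord]
  | succ n ih =>
    have h : {c : ℕ → Bool | initialWord c (n + 1) = u} =
        ⋃ v, ⋃ b, {c | u = v ++ [b]} ∩ ({c | initialWord c n = v} ∩ {c | c n = b}) := by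
      ext c
      simp only [initialWord_succ, Set.mem_ofPred_eq, Set.mem_iUnion, Set.mem_inter_iff]
      constructor
      · exact fun h => ⟨_, _, h.symm, rfl, rfl⟩
      · rintro ⟨v, b, h, rfl, rfl⟩
        exact h.symm
    rw [h]
    exact MeasurableSet.iUnion fun v => MeasurableSet.iUnion fun b =>
      (MeasurableSet.const _).inter
        ((ih v).inter (measurable_pi_apply (X := fun _ : ℕ => Bool) n
          (MeasurableSet.singleton b)))

lemma measurableSet_follows (p w : Word) : MeasurableSet {c : ℕ → Bool | Follows p c w} := by
  have h : {c : ℕ → Bool | Follows p c w} =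
      ⋃ n, ⋃ u, {c | w = p ++ u} ∩ {c | initialWord c n = u} := by
    ext c
    simp [Follows]
  rw [h]
  exact MeasurableSet.iUnion fun n => MeasurableSet.iUnion fun u =>
    (MeasurableSet.const _).inter (measurableSet_initialWord n u)

lemma measurableGraph_full (t : ℝ) :
    MeasurableGraph fun p : RootedMultigraph ℕ × Noise => p.1.full p.2 t := by
  have hG : MeasurableGraph fun p : RootedMultigraph ℕ × Noise => p.1 :=
    .of_measurable measurable_fst
  have hclock : Measurable fun p : RootedMultigraph ℕ × Noise => p.2.1 := measurable_snd.fst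
  have hnum : Measurable fun p : RootedMultigraph ℕ × Noise => p.2.2.1 := measurable_snd.snd.fst
  have hwalk (v : Walker) : Measurable fun p : RootedMultigraph ℕ × Noise => p.2.2.2 v :=
    (measurable_pi_apply v).comp measurable_snd.snd.snd
  have halive (x : ℕ × Word) :
      MeasurableSet {p : RootedMultigraph ℕ × Noise | Alive p.2.1 t x} :=
    hclock (measurableSet_alive t x)
  have hN : Measurable fun p : RootedMultigraph ℕ × Noise => sInf {n : ℕ |
      t < splitTime p.2.1 p.1.root (initialWord (p.2.2.2 .root) n)} := by
    refine measurable_nat_sInf fun n => ?_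
    have h : {p : RootedMultigraph ℕ × Noise | n ∈ {n : ℕ |
          t < splitTime p.2.1 p.1.root (initialWord (p.2.2.2 .root) n)}} =
        ⋃ a, ⋃ u, {p | p.1.root = a} ∩ ({p | initialWord (p.2.2.2 .root) n = u} ∩
          {p | t < splitTime p.2.1 a u}) := by
      ext p
      simp
    rw [h]
    exact MeasurableSet.iUnion fun a => MeasurableSet.iUnion fun u => (hG.root a).inter
      ((hwalk _ (measurableSet_initialWord n u)).inter
        (hclock (measurableSet_lt measurable_const (measurable_splitTime a u))))
  have hroot (x : ℕ × Word) :
      MeasurableSet {p : RootedMultigraph ℕ × Noise | p.1.rootAt p.2 t = x} := by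
    have h : {p : RootedMultigraph ℕ × Noise | p.1.rootAt p.2 t = x} =
        {p | p.1.root = x.1} ∩ ⋃ n, {p | sInf {n : ℕ |
          t < splitTime p.2.1 p.1.root (initialWord (p.2.2.2 .root) n)} = n} ∩
            {p | initialWord (p.2.2.2 .root) n = x.2} := by
      ext p
      simp [RootedMultigraph.rootAt, Prod.ext_iff]
    rw [h]
    exact (hG.root _).inter (MeasurableSet.iUnion fun n =>
      (hN (MeasurableSet.singleton n)).inter (hwalk _ (measurableSet_initialWord n _)))
  refine ⟨hroot, fun x => ?_, fun x y => ?_⟩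
  · have h : {p : RootedMultigraph ℕ × Noise | x ∈ (p.1.full p.2 t).verts} =
        {p | p.1.rootAt p.2 t = x} ∪ ({p | x.1 ∈ p.1.verts} ∩ {p | Alive p.2.1 t x}) := by
      ext p
      simp [RootedMultigraph.full, eq_comm]
    rw [h]
    exact (hroot x).union ((hG.verts _).inter (halive x))
  · classical
    have h : (fun p : RootedMultigraph ℕ × Noise => (p.1.full p.2 t).mult x y) =
        fun p => if p ∈ {p : RootedMultigraph ℕ × Noise | Alive p.2.1 t x} ∩
          {p : RootedMultigraph ℕ × Noise | Alive p.2.1 t y} then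
          (p.1.oldEdges p.2 x y).ncard + (p.1.newEdges p.2 x y).ncard else 0 := by
      funext p
      simp only [RootedMultigraph.full, Set.mem_inter_iff, Set.mem_ofPred_eq]
    rw [h]
    refine Measurable.ite ((halive x).inter (halive y))
      ((measurable_ncard_of_mem fun k => ?_).add (measurable_ncard_of_mem fun e => ?_))
      measurable_const
    · exact (hG.mult x.1 y.1 measurableSet_Ioi).inter
        ((hwalk _ (measurableSet_follows _ _)).inter (hwalk _ (measurableSet_follows _ _)))
    · have h : {p : RootedMultigraph ℕ × Noise | e ∈ p.1.newEdges p.2 x y} =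
          {p | x.1 ∈ p.1.verts} ∩ ({p | x.1 = y.1} ∩ ({p | e.2 < p.2.2.1 (x.1, e.1)} ∩
            ⋃ d : Bool, {p | Follows (e.1 ++ [d]) (p.2.2.2 (.new x.1 e.1 e.2 d)) x.2} ∩
              {p | Follows (e.1 ++ [!d]) (p.2.2.2 (.new x.1 e.1 e.2 (!d))) y.2})) := by
        ext p
        simp only [RootedMultigraph.newEdges, Set.mem_ofPred_eq, Set.mem_inter_iff, Set.mem_iUnion]
      rw [h]
      exact (hG.verts _).inter ((MeasurableSet.const _).inter
        (((measurable_pi_apply _).comp hnum measurableSet_Ioi).inter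
          (MeasurableSet.iUnion fun d => (hwalk _ (measurableSet_follows _ _)).inter
            (hwalk _ (measurableSet_follows _ _)))))

lemma measurableGraph_cluster (t : ℝ) :
    MeasurableGraph fun p : RootedMultigraph ℕ × Noise => p.1.cluster p.2 t :=
  (measurableGraph_full t).component

lemma measurable_isoClass_cluster (t : ℝ) :
    Measurable fun p : RootedMultigraph ℕ × Noise => (p.1.cluster p.2 t).isoClass :=
  (measurableGraph_cluster t).isoClass

/-! ### Distances in the spine tree -/

/-- The distance between two words in the infinite binary tree. -/
def wordDist : Word → Word → ℕ
  | [], v => v.length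
  | _ :: u, [] => u.length + 1
  | b :: u, c :: v => if b = c then wordDist u v else u.length + v.length + 2

@[simp] lemma wordDist_nil_left (v : Word) : wordDist [] v = v.length := by
  cases v <;> rfl

@[simp] lemma wordDist_nil_right (u : Word) : wordDist u [] = u.length := by
  cases u <;> rfl

lemma wordDist_comm (u v : Word) : wordDist u v = wordDist v u := by
  induction u generalizing v with
  | nil => simp
  | cons b u ih =>
    cases v with
    | nil => simp
    | cons c v =>
      by_cases h : b = c
      · simp [wordDist, h, ih]
      · simp [wordDist, h, Ne.symm h, add_comm]

lemma wordDist_snoc (u w : Word) (d : Bool) : wordDist (u ++ [d]) w ≤ wordDist u w + 1 ∧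
    wordDist u w ≤ wordDist (u ++ [d]) w + 1 := by
  induction u generalizing w with
  | nil =>
    cases w with
    | nil => simp
    | cons c w =>
      by_cases h : d = c
      · simp [wordDist, h]; omega
      · simp [wordDist, h]
  | cons b u ih =>
    cases w with
    | nil => simp
    | cons c w =>
      by_cases h : b = c
      · simpa [wordDist, h] using ih w
      · simp [wordDist, h]; omega

lemma exists_common_prefix (u w : Word) : ∃ p u' w', u = p ++ u' ∧ w = p ++ w' ∧
    wordDist u w = u'.length + w'.length := by
  induction u generalizing w with
  | nil => exact ⟨[], [], w, by simp⟩
  | cons b u ih =>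
    cases w with
    | nil => exact ⟨[], b :: u, [], by simp⟩
    | cons c w =>
      by_cases h : b = c
      · obtain ⟨p, u', w', rfl, rfl, h'⟩ := ih w
        exact ⟨b :: p, u', w', by simp, by simp [h], by simpa [wordDist, h] using h'⟩
      · exact ⟨[], b :: u, c :: w, by simp, by simp, by simp [wordDist, h]; omega⟩

namespace TreeVertex

/-- The distance between two vertices of the tree, as soon as both belong to it. -/
def spineDist : TreeVertex → TreeVertex → ℕ
  | v m, v n => (m - n) + (n - m)
  | v m, h i w => (m - (i + 1)) + ((i + 1) - m) + w.length + 1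
  | h i w, v m => (m - (i + 1)) + ((i + 1) - m) + w.length + 1
  | h i u, h j w =>
    if i = j then wordDist u w else (i - j) + (j - i) + u.length + w.length + 2

lemma spineDist_comm (x y : TreeVertex) : spineDist x y = spineDist y x := by
  cases x <;> cases y <;> simp only [spineDist]
  · omega
  · rename_i i u j w
    by_cases hij : i = j
    · simp [hij, wordDist_comm]
    · rw [if_neg hij, if_neg (Ne.symm hij)]; omega

/-- A link changes the formal distance by at most one, whatever the clocks, so no walk is shorter
than that distance. -/
lemma Link.spineDist_le {s : ℕ → ℝ} {clock : ℕ × Word → ℝ} {x x' : TreeVertex}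
    (hl : Link s clock x x') (y : TreeVertex) :
    spineDist x y ≤ spineDist x' y + 1 ∧ spineDist x' y ≤ spineDist x y + 1 := by
  cases hl with
  | path n => cases y <;> simp only [spineDist] <;> omega
  | attach i =>
    cases y with
    | v m => simp only [spineDist, List.length_nil]; omega
    | h j w =>
      by_cases hij : i = j
      · simp only [spineDist, hij, if_true, wordDist_nil_left]; omega
      · simp only [spineDist, hij, if_false, List.length_nil]; omega
  | child i w d hw =>
    cases y with
    | v m => simp only [spineDist, List.length_append, List.length_singleton]; omega
    | h j w' =>
      by_cases hij : i = j
      · simpa [spineDist, hij] using (wordDist_snoc w w' d).symm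
      · simp [spineDist, hij]; omega

lemma spineDist_self (x : TreeVertex) : spineDist x x = 0 := by
  have h (w : Word) : wordDist w w = 0 := by
    induction w with
    | nil => rfl
    | cons b w ih => simp [wordDist, ih]
  cases x <;> simp [spineDist, h]

lemma spineDist_le_length {s : ℕ → ℝ} {clock : ℕ × Word → ℝ} {x y : TreeVertex}
    (p : (tree s clock).Walk x y) : spineDist x y ≤ p.length := by
  induction p with
  | nil => simp [spineDist_self]
  | @cons a b c hab p ih =>
    have h1 : spineDist a c ≤ spineDist b c + 1 := by
      rcases hab.2 with h | h
      · exact (h.spineDist_le c).1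
      · exact (h.spineDist_le c).2
    rw [SimpleGraph.Walk.length_cons]
    omega

lemma birthTime_snoc (clock : ℕ × Word → ℝ) (a : ℕ) (w : Word) (d : Bool) :
    birthTime clock a (w ++ [d]) = splitTime clock a w := by
  unfold birthTime splitTime
  rw [List.length_append, List.length_singleton, Finset.sum_range_succ]
  congr 1
  · refine Finset.sum_congr rfl fun k hk => ?_
    rw [List.take_append_of_le_length (Finset.mem_range.1 hk).le]
  · simp

/-! ### Explicit walks, and the leaves of the spine tree -/

section

variable {s : ℕ → ℝ} {clock : ℕ × Word → ℝ}

lemma Link.adj {x y : TreeVertex} (h : Link s clock x y) : (tree s clock).Adj x y := by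
  refine ⟨?_, Or.inl h⟩
  cases h with
  | path n => simp
  | attach i => simp
  | child i w d hw => simp

/-- There is a walk of length at most `n`. -/
def Within (s : ℕ → ℝ) (clock : ℕ × Word → ℝ) (x y : TreeVertex) (n : ℕ) : Prop :=
  ∃ p : (tree s clock).Walk x y, p.length ≤ n

lemma Within.symm {x y : TreeVertex} {n : ℕ} (h : Within s clock x y n) :
    Within s clock y x n := by
  obtain ⟨p, hp⟩ := h
  exact ⟨p.reverse, by simpa⟩

lemma Within.trans {x y z : TreeVertex} {m n k : ℕ} (h : Within s clock x y m)
    (h' : Within s clock y z n) (hk : m + n ≤ k) : Within s clock x z k := by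
  obtain ⟨p, hp⟩ := h
  obtain ⟨q, hq⟩ := h'
  exact ⟨p.append q, by rw [SimpleGraph.Walk.length_append]; omega⟩

lemma Link.within {x y : TreeVertex} (h : Link s clock x y) : Within s clock x y 1 :=
  ⟨.cons h.adj .nil, le_rfl⟩

lemma within_refl (x : TreeVertex) : Within s clock x x 0 := ⟨.nil, le_rfl⟩

lemma within_path (m k : ℕ) : Within s clock (v (m + k)) (v m) k := by
  induction k with
  | zero => exact within_refl _
  | succ k ih => exact (Link.path (m + k)).within.trans ih (by omega)

lemma within_v (m n : ℕ) : Within s clock (v m) (v n) ((m - n) + (n - m)) := by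
  rcases le_total m n with h | h
  · obtain ⟨k, rfl⟩ := Nat.exists_eq_add_of_le h
    exact (within_path m k).symm.trans (within_refl _) (by omega)
  · obtain ⟨k, rfl⟩ := Nat.exists_eq_add_of_le h
    exact (within_path n k).trans (within_refl _) (by omega)

/-- If a word is born in time, all its proper prefixes have split in time because lifetimes are
positive, so the whole descent consists of links. -/
lemma within_append (hc : ∀ x, 0 < clock x) {i : ℕ} {p u : Word}
    (hu : birthTime clock i (p ++ u) ≤ age s i) :
    Within s clock (h i (p ++ u)) (h i p) u.length := by
  induction u using List.reverseRecOn with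
  | nil => simpa using within_refl _
  | append_singleton u d ih =>
    rw [← List.append_assoc, birthTime_snoc] at hu
    rw [← List.append_assoc]
    refine (Link.child i _ d hu).within.symm.trans (ih ?_) (by simp; omega)
    have := hc (i, p ++ u)
    unfold splitTime at hu
    linarith

lemma within_spineDist (hc : ∀ x, 0 < clock x) {x y : TreeVertex}
    (hx : ∀ i w, x = h i w → birthTime clock i w ≤ age s i)
    (hy : ∀ i w, y = h i w → birthTime clock i w ≤ age s i) :
    Within s clock x y (spineDist x y) := by
  have h0 (i : ℕ) (w : Word) (hw : birthTime clock i w ≤ age s i) :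
      Within s clock (h i w) (v (i + 1)) (w.length + 1) :=
    (within_append (p := []) (u := w) hc hw).trans (Link.attach i).within.symm (by omega)
  cases x with
  | v m =>
    cases y with
    | v n => exact within_v m n
    | h i w =>
      exact (within_v m (i + 1)).trans (h0 i w (hy i w rfl)).symm (by simp only [spineDist]; omega)
  | h i u =>
    cases y with
    | v n =>
      exact (h0 i u (hx i u rfl)).trans (within_v (i + 1) n) (by simp only [spineDist]; omega)
    | h j w =>
      by_cases hij : i = j
      · subst hij
        obtain ⟨p, u', w', rfl, rfl, hd⟩ := exists_common_prefix u w
        rw [spineDist, if_pos rfl, hd]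
        exact (within_append hc (hx i _ rfl)).trans (within_append hc (hy i _ rfl)).symm le_rfl
      · refine ((h0 i u (hx i u rfl)).trans (within_v (i + 1) (j + 1)) le_rfl).trans
          (h0 j w (hy j w rfl)).symm ?_
        rw [spineDist, if_neg hij]
        omega

lemma dist_eq_spineDist (hc : ∀ x, 0 < clock x) {x y : TreeVertex}
    (hx : ∀ i w, x = h i w → birthTime clock i w ≤ age s i)
    (hy : ∀ i w, y = h i w → birthTime clock i w ≤ age s i) :
    (tree s clock).dist x y = spineDist x y := by
  obtain ⟨p, hp⟩ := within_spineDist hc hx hy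
  refine le_antisymm ((SimpleGraph.dist_le p).trans hp) ?_
  obtain ⟨q, hq⟩ := SimpleGraph.Reachable.exists_walk_length_eq_dist ⟨p⟩
  rw [← hq]
  exact spineDist_le_length q

/-- A split vertex has two children, and `v (n + 1)` has two neighbours on the path, so neither is a
leaf. A vertex that has been born but has not split has only its parent as neighbour. -/
lemma isLeaf_tree_iff (hs : ∀ i, 0 < s i) (x : TreeVertex) :
    IsLeaf (tree s clock) x ↔ x = v 0 ∨ ∃ i w, x = h i w ∧ Alive clock (age s i) (i, w) := by
  cases x with
  | v n =>
    cases n with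
    | zero => simpa using isLeaf_v_zero s clock
    | succ n =>
      simp only [reduceCtorEq, false_and, exists_false, or_false, v.injEq, Nat.add_eq_zero_iff,
        one_ne_zero, and_false, iff_false]
      rintro ⟨y, -, hy⟩
      have h1 := hy _ (Link.path n).adj
      have h2 := hy _ (Link.path (n + 1)).adj.symm
      rw [← h1] at h2
      simp only [v.injEq] at h2
      omega
  | h i w =>
    simp only [reduceCtorEq, h.injEq, false_or]
    have hadj (y : TreeVertex) : (tree s clock).Adj (h i w) y ↔
        (w = [] ∧ y = v (i + 1)) ∨
          (∃ u d, w = u ++ [d] ∧ y = h i u ∧ splitTime clock i u ≤ age s i) ∨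
          ∃ d, y = h i (w ++ [d]) ∧ splitTime clock i w ≤ age s i := by
      constructor
      · rintro ⟨-, hl | hl⟩
        · cases hl with
          | child _ _ d hw => exact Or.inr (Or.inr ⟨d, rfl, hw⟩)
        · generalize hz : h i w = z at hl
          cases hl with
          | path n => cases hz
          | attach j => cases hz; exact Or.inl ⟨rfl, rfl⟩
          | child j u d hw => cases hz; exact Or.inr (Or.inl ⟨u, d, rfl, rfl, hw⟩)
      · rintro (⟨rfl, rfl⟩ | ⟨u, d, rfl, rfl, hu⟩ | ⟨d, rfl, hw⟩)
        · exact (Link.attach i).adj.symm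
        · exact (Link.child i u d hu).adj.symm
        · exact (Link.child i w d hw).adj
    constructor
    · rintro ⟨y, hy, huniq⟩
      have hns : age s i < splitTime clock i w := by
        by_contra hle
        push Not at hle
        have h1 := huniq _ ((hadj _).2 (Or.inr (Or.inr ⟨false, rfl, hle⟩)))
        have h2 := huniq _ ((hadj _).2 (Or.inr (Or.inr ⟨true, rfl, hle⟩)))
        rw [← h1] at h2
        simp at h2
      refine ⟨i, w, ⟨rfl, rfl⟩, ?_, hns⟩
      rcases (hadj y).1 hy with ⟨rfl, -⟩ | ⟨u, d, rfl, -, hu⟩ | ⟨d, -, hw⟩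
      · simpa [birthTime] using (age_pos hs i).le
      · simpa only [birthTime_snoc] using hu
      · exact absurd hw (not_le.2 hns)
    · rintro ⟨_, _, ⟨rfl, rfl⟩, hb, hns⟩
      rcases List.eq_nil_or_concat w with rfl | ⟨u, d, rfl⟩
      · refine ⟨v (i + 1), (hadj _).2 (Or.inl ⟨rfl, rfl⟩), fun y hy => ?_⟩
        rcases (hadj y).1 hy with ⟨-, h⟩ | ⟨u, d, hu, -⟩ | ⟨d, -, hw⟩
        · exact h
        · simp at hu
        · exact absurd hw (not_le.2 hns)
      · simp only [List.concat_eq_append, birthTime_snoc] at hb hns hadj ⊢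
        refine ⟨h i u, (hadj _).2 (Or.inr (Or.inl ⟨u, d, rfl, rfl, hb⟩)), fun y hy => ?_⟩
        rcases (hadj y).1 hy with ⟨hu, -⟩ | ⟨u', d', hu, h, -⟩ | ⟨d, -, hw⟩
        · simp at hu
        · rw [h, (List.append_inj' hu rfl).1]
        · exact absurd hw (not_le.2 hns)

end

end TreeVertex

/-! ### The Poisson edge model on the leaves of the spine tree -/

open TreeVertex

/-- Unlike `pairRate`, this does not depend on the clocks, so one field of edges can be sampled
independently of the tree and used for all trimmings simultaneously. -/
noncomputable def spineRate (lam : ℝ≥0) : Sym2 TreeVertex → ℝ≥0 :=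
  Sym2.lift ⟨fun x y => 2 * lam / 2 ^ spineDist x y, fun x y => by simp only [spineDist_comm]⟩

lemma spineRate_mk (lam : ℝ≥0) (x y : TreeVertex) :
    spineRate lam s(x, y) = 2 * lam / 2 ^ spineDist x y := rfl

/-- The law of independent Poisson edge numbers between all pairs of vertices. -/
noncomputable def spineField (lam : ℝ≥0) : Measure (Sym2 TreeVertex → ℕ) :=
  Measure.infinitePi fun e => poissonMeasure (spineRate lam e)

instance (lam : ℝ≥0) : IsProbabilityMeasure (spineField lam) := by
  unfold spineField; infer_instance

/-- The vertices of the spine tree that are leaves when the trees on the levels have the leaves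
`c`. -/
def spineVerts (c : Set (ℕ × Word)) : Set TreeVertex := {x | x = v 0 ∨ ∃ p ∈ c, x = h p.1 p.2}

open scoped Classical in
/-- The multigraph on `v 0` and the vertices `h i w`, `(i, w) ∈ c`, with edge numbers `N`. -/
noncomputable def spineGraph (c : Set (ℕ × Word)) (N : Sym2 TreeVertex → ℕ) :
    RootedMultigraph TreeVertex where
  verts := spineVerts c
  mult x y := if x ≠ y ∧ x ∈ spineVerts c ∧ y ∈ spineVerts c then N s(x, y) else 0
  root := v 0
  root_mem := Or.inl rfl
  mult_comm x y := by
    rw [Sym2.eq_swap]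
    congr 1
    simp only [eq_iff_iff]
    tauto
  mult_self x := by simp
  mem_of_mult x y h := by
    by_contra hx
    exact h (if_neg fun h' => hx h'.2.1)

/-- The leaves of the trees attached to the infinite path. -/
def hangingLeaves (θ : (ℕ → ℝ) × (ℕ × Word → ℝ)) : Set (ℕ × Word) :=
  {p | Alive θ.2 (age θ.1 p.1) p}

lemma isLeaf_tree_iff_mem {θ : (ℕ → ℝ) × (ℕ × Word → ℝ)} (hs : ∀ i, 0 < θ.1 i) (x : TreeVertex) :
    IsLeaf (tree θ.1 θ.2) x ↔ x ∈ spineVerts (hangingLeaves θ) := by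
  rw [isLeaf_tree_iff hs]
  simp only [spineVerts, hangingLeaves, Set.mem_ofPred_eq, Prod.exists]
  exact or_congr Iff.rfl ⟨fun ⟨i, w, k, k'⟩ => ⟨i, w, k', k⟩, fun ⟨i, w, k, k'⟩ => ⟨i, w, k', k⟩⟩

lemma leafGraph_tree {θ : (ℕ → ℝ) × (ℕ × Word → ℝ)} (hs : ∀ i, 0 < θ.1 i)
    (N : Sym2 TreeVertex → ℕ) :
    leafGraph (tree θ.1 θ.2) (v 0) (isLeaf_v_zero θ.1 θ.2) N = spineGraph (hangingLeaves θ) N := by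
  refine RootedMultigraph.ext' (Set.ext fun x => isLeaf_tree_iff_mem hs x) ?_ rfl
  classical
  funext x y
  exact if_congr (by simp only [isLeaf_tree_iff_mem hs]) rfl rfl

lemma measurableGraph_spineGraph {Ω : Type*} [MeasurableSpace Ω] {c : Ω → Set (ℕ × Word)}
    (hc : ∀ p, MeasurableSet {ω | p ∈ c ω}) {N : Ω → Sym2 TreeVertex → ℕ} (hN : Measurable N) :
    MeasurableGraph fun ω => spineGraph (c ω) (N ω) := by
  have hv (x : TreeVertex) : MeasurableSet {ω | x ∈ spineVerts (c ω)} := by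
    have h : {ω | x ∈ spineVerts (c ω)} =
        {ω | x = v 0} ∪ ⋃ p, {ω | p ∈ c ω} ∩ {ω | x = h p.1 p.2} := by
      ext ω
      simp [spineVerts]
    rw [h]
    exact (MeasurableSet.const _).union
      (MeasurableSet.iUnion fun p => (hc p).inter (MeasurableSet.const _))
  refine ⟨fun x => MeasurableSet.const (v 0 = x), hv, fun x y => ?_⟩
  exact Measurable.ite ((MeasurableSet.const _).inter ((hv x).inter (hv y)))
    (measurable_pi_iff.1 hN _) measurable_const

/-- The law of a function of finitely or infinitely many coordinates only depends on the factors at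
these coordinates. -/
lemma map_infinitePi_congr {ι X Y : Type*} [MeasurableSpace X] [MeasurableSpace Y] [Nonempty X]
    {μ ν : ι → Measure X} [∀ i, IsProbabilityMeasure (μ i)] [∀ i, IsProbabilityMeasure (ν i)]
    {f : (ι → X) → Y} (hf : Measurable f) (A : Set ι) (hμ : ∀ i ∈ A, μ i = ν i)
    (hfA : ∀ N N' : ι → X, (∀ i ∈ A, N i = N' i) → f N = f N') :
    (Measure.infinitePi μ).map f = (Measure.infinitePi ν).map f := by
  classical
  -- An arbitrary filler outside `A` is never read by `f`; thus `f` factors through the restriction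
  -- to `A`, where the two laws coincide.
  let ext : (A → X) → ι → X := fun g i => if hi : i ∈ A then g ⟨i, hi⟩ else Classical.arbitrary X
  have hext : Measurable ext := by
    refine measurable_pi_iff.2 fun i => ?_
    by_cases hi : i ∈ A
    · simpa only [ext, hi, dite_true] using measurable_pi_apply _
    · simpa only [ext, hi, dite_false] using measurable_const
  have h : f = (f ∘ ext) ∘ A.domRestrict := by
    funext N
    exact hfA _ _ fun i hi => by simp [ext, hi, Set.domRestrict]
  have hr : Measurable (A.domRestrict : (ι → X) → A → X) := measurable_pi_iff.2 fun i =>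
    measurable_pi_apply _
  rw [h, ← Measure.map_map (hf.comp hext) hr, ← Measure.map_map (hf.comp hext) hr,
    Measure.infinitePi_map_restrict', Measure.infinitePi_map_restrict']
  congr 2
  funext i
  exact hμ i i.2

noncomputable def spineClass (c : Set (ℕ × Word)) (N : Sym2 TreeVertex → ℕ) : MultigraphClass :=
  (spineGraph c N).component.isoClass

lemma measurable_spineClass {Ω : Type*} [MeasurableSpace Ω] {c : Ω → Set (ℕ × Word)}
    (hc : ∀ p, MeasurableSet {ω | p ∈ c ω}) {N : Ω → Sym2 TreeVertex → ℕ} (hN : Measurable N) :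
    Measurable fun ω => spineClass (c ω) (N ω) :=
  (measurableGraph_spineGraph hc hN).component.isoClass

/-- On pairs of leaves the tree distance equals the formal one, and the component of the root reads
no other pairs. -/
lemma poissonClusterLaw_tree (lam : ℝ≥0) {θ : (ℕ → ℝ) × (ℕ × Word → ℝ)} (hc : ∀ x, 0 < θ.2 x)
    (hs : ∀ i, 0 < θ.1 i) :
    poissonClusterLaw lam (tree θ.1 θ.2) (v 0) (isLeaf_v_zero θ.1 θ.2) =
      (spineField lam).map (spineClass (hangingLeaves θ)) := by
  unfold poissonClusterLaw
  simp only [leafGraph_tree hs]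
  have hmem (x : TreeVertex) (hx : x ∈ spineVerts (hangingLeaves θ)) (i : ℕ) (w : Word)
      (hxi : x = h i w) : birthTime θ.2 i w ≤ age θ.1 i := by
    subst hxi
    rcases hx with hx | ⟨⟨j, u⟩, hp, hx⟩
    · cases hx
    · cases hx
      exact hp.1
  refine map_infinitePi_congr (f := spineClass (hangingLeaves θ))
    (measurable_spineClass (fun _ => MeasurableSet.const _) measurable_id)
    {e | ∀ x ∈ e, x ∈ spineVerts (hangingLeaves θ)} ?_ ?_
  · intro e he
    induction e with
    | h x y =>
      have hx := he x (by simp)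
      have hy := he y (by simp)
      change poissonMeasure (2 * lam / 2 ^ (tree θ.1 θ.2).dist x y) = poissonMeasure _
      rw [dist_eq_spineDist hc (hmem x hx) (hmem y hy), spineRate_mk]
  · intro N N' hNN
    have : spineGraph (hangingLeaves θ) N = spineGraph (hangingLeaves θ) N' := by
      refine RootedMultigraph.ext' rfl ?_ rfl
      funext x y
      simp only [spineGraph]
      by_cases hxy : x ≠ y ∧ x ∈ spineVerts (hangingLeaves θ) ∧ y ∈ spineVerts (hangingLeaves θ)
      · rw [if_pos hxy, if_pos hxy]
        refine hNN _ fun z hz => ?_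
        rcases Sym2.mem_iff.1 hz with rfl | rfl
        · exact hxy.2.1
        · exact hxy.2.2
      · rw [if_neg hxy, if_neg hxy]
    rw [spineClass, this, spineClass]

lemma measurableSet_hangingLeaves (p : ℕ × Word) :
    MeasurableSet {θ : (ℕ → ℝ) × (ℕ × Word → ℝ) | p ∈ hangingLeaves θ} :=
  (measurableSet_le ((measurable_birthTime _ _).comp measurable_snd)
    ((measurable_age _).comp measurable_fst)).inter
    (measurableSet_lt ((measurable_age _).comp measurable_fst)
      ((measurable_splitTime _ _).comp measurable_snd))

instance : IsProbabilityMeasure treeMeasure := by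
  unfold treeMeasure; infer_instance

lemma ae_treeMeasure_pos :
    ∀ᵐ θ ∂treeMeasure, (∀ i, 0 < θ.1 i) ∧ ∀ x, 0 < θ.2 x := by
  have h1 : ∀ᵐ c ∂(Measure.infinitePi fun _ : ℕ × Word => expMeasure 1), ∀ x, 0 < c x := by
    refine ae_all_iff.2 fun x => ?_
    exact (measurePreserving_eval_infinitePi (fun _ : ℕ × Word => expMeasure 1)
      x).quasiMeasurePreserving.ae ae_pos_expMeasure
  have h2 := (Measure.quasiMeasurePreserving_fst (μ := Measure.infinitePi fun _ : ℕ => expMeasure 1)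
    (ν := Measure.infinitePi fun _ : ℕ × Word => expMeasure 1)).ae ae_label_pos
  have h3 := (Measure.quasiMeasurePreserving_snd (μ := Measure.infinitePi fun _ : ℕ => expMeasure 1)
    (ν := Measure.infinitePi fun _ : ℕ × Word => expMeasure 1)).ae h1
  exact h2.and h3

lemma measurable_spineClass_hangingLeaves :
    Measurable fun p : ((ℕ → ℝ) × (ℕ × Word → ℝ)) × (Sym2 TreeVertex → ℕ) =>
      spineClass (hangingLeaves p.1) p.2 :=
  measurable_spineClass (fun q => measurable_fst (measurableSet_hangingLeaves q)) measurable_snd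

lemma limitLaw_eq_map (lam : ℝ≥0) : limitLaw lam =
    (treeMeasure.prod (spineField lam)).map fun p => spineClass (hangingLeaves p.1) p.2 := by
  have hm := measurable_spineClass_hangingLeaves
  have hmeas : Measurable fun θ => (spineField lam).map (spineClass (hangingLeaves θ)) := by
    refine Measure.measurable_of_measurable_coe _ fun S hS => ?_
    have h (θ) : (spineField lam).map (spineClass (hangingLeaves θ)) S =
        spineField lam (Prod.mk θ ⁻¹' ((fun p : ((ℕ → ℝ) × (ℕ × Word → ℝ)) ×
          (Sym2 TreeVertex → ℕ) => spineClass (hangingLeaves p.1) p.2) ⁻¹' S)) :=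
      Measure.map_apply (hm.comp measurable_prodMk_left) hS
    simp only [h]
    exact measurable_measure_prodMk_left (hm hS)
  have hae : (fun θ => poissonClusterLaw lam (tree θ.1 θ.2) (v 0) (isLeaf_v_zero θ.1 θ.2))
      =ᵐ[treeMeasure] fun θ => (spineField lam).map (spineClass (hangingLeaves θ)) :=
    ae_treeMeasure_pos.mono fun θ h => poissonClusterLaw_tree lam h.2 h.1
  ext S hS
  rw [limitLaw, Measure.bind_apply hS (hmeas.aemeasurable.congr hae.symm), Measure.map_apply hm hS,
    Measure.prod_apply (hm hS)]
  refine lintegral_congr_ae (hae.mono fun θ h => ?_)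
  simp only [h]
  exact Measure.map_apply (hm.comp measurable_prodMk_left) hS

/-! ### Second moments of counts of events with decaying covariances -/

/-- The exponent is |i - j| written with truncated subtraction. Each of the two sides of `i`
contributes at most 2. -/
lemma sum_half_pow_dist_le (n i : ℕ) :
    ∑ j ∈ Finset.range n, (1 / 2 : ℝ) ^ ((i - j) + (j - i)) ≤ 4 := by
  have h1 : ∑ j ∈ Finset.range (i + 1), (1 / 2 : ℝ) ^ ((i - j) + (j - i)) ≤ 2 := by
    rw [← Finset.sum_range_reflect]
    refine (Finset.sum_le_sum fun j hj => ?_).trans (sum_geometric_two_le (i + 1))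
    have := Finset.mem_range.1 hj
    rw [show i - (i + 1 - 1 - j) + (i + 1 - 1 - j - i) = j by omega]
  have h2 : ∑ j ∈ Finset.Ico i (i + n), (1 / 2 : ℝ) ^ ((i - j) + (j - i)) ≤ 2 := by
    rw [Finset.sum_Ico_eq_sum_range]
    refine (Finset.sum_le_sum fun j hj => ?_).trans (sum_geometric_two_le (i + n - i))
    rw [show i - (i + j) + (i + j - i) = j by omega]
  have hsub : Finset.range n ⊆ Finset.range (i + 1) ∪ Finset.Ico i (i + n) := by
    intro j hj
    simp only [Finset.mem_range, Finset.mem_union, Finset.mem_Ico] at hj ⊢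
    omega
  have hnn : ∀ j, (0 : ℝ) ≤ (1 / 2 : ℝ) ^ ((i - j) + (j - i)) := fun j => by positivity
  calc _ ≤ ∑ j ∈ Finset.range (i + 1) ∪ Finset.Ico i (i + n), (1 / 2 : ℝ) ^ ((i - j) + (j - i)) :=
        Finset.sum_le_sum_of_subset_of_nonneg hsub fun j _ _ => hnn j
    _ ≤ ∑ j ∈ Finset.range (i + 1), (1 / 2 : ℝ) ^ ((i - j) + (j - i)) +
        ∑ j ∈ Finset.Ico i (i + n), (1 / 2 : ℝ) ^ ((i - j) + (j - i)) := by
      rw [← Finset.sum_union_inter]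
      exact le_add_of_nonneg_right (Finset.sum_nonneg fun j _ => hnn j)
    _ ≤ 4 := by linarith

/-- Chebyshev's inequality for the number of events that occur: decaying covariances make its
variance at most 4 * C * n, while its mean is at least n * p. -/
lemma measureReal_iInter_compl_le {Ω : Type*} [MeasurableSpace Ω] (μ : Measure Ω)
    [IsProbabilityMeasure μ] {E : ℕ → Set Ω} (hE : ∀ i, MeasurableSet (E i)) {p C : ℝ} (hp : 0 < p)
    (hE1 : ∀ i, p ≤ μ.real (E i))
    (hE2 : ∀ i j, μ.real (E i ∩ E j) - μ.real (E i) * μ.real (E j) ≤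
      C * (1 / 2) ^ ((i - j) + (j - i))) (hC : 0 ≤ C) {n : ℕ} (hn : 0 < n) :
    μ.real {ω | ∀ i < n, ω ∉ E i} ≤ 4 * C / p ^ 2 / n := by
  set f : ℕ → Ω → ℝ := fun i ω => (E i).indicator (fun _ => (1 : ℝ)) ω - μ.real (E i) with hf
  have hint (i : ℕ) : Integrable ((E i).indicator (fun _ => (1 : ℝ))) μ :=
    (integrable_const 1).indicator (hE i)
  have hprod (i j : ℕ) (ω : Ω) : f i ω * f j ω = (E i ∩ E j).indicator (fun _ => (1 : ℝ)) ω
      - (E i).indicator (fun _ => (1 : ℝ)) ω * μ.real (E j)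
      - μ.real (E i) * (E j).indicator (fun _ => (1 : ℝ)) ω + μ.real (E i) * μ.real (E j) := by
    simp only [hf]
    by_cases h1 : ω ∈ E i <;> by_cases h2 : ω ∈ E j <;> simp [h1, h2] <;> ring
  have hij : ∀ i j, Integrable (fun ω => f i ω * f j ω) μ := by
    intro i j
    simp only [hprod]
    exact ((((integrable_const (1 : ℝ)).indicator ((hE i).inter (hE j))).sub
      ((hint i).mul_const _)).sub ((hint j).const_mul _)).add (integrable_const _)
  have hcov (i j : ℕ) : ∫ ω, f i ω * f j ω ∂μ =
      μ.real (E i ∩ E j) - μ.real (E i) * μ.real (E j) := by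
    simp only [hprod]
    rw [integral_add, integral_sub, integral_sub, integral_mul_const, integral_const_mul,
      integral_indicator_const _ (hE i), integral_indicator_const _ (hE j),
      integral_indicator_const _ ((hE i).inter (hE j)), integral_const]
    · simp
    · exact (integrable_const (1 : ℝ)).indicator ((hE i).inter (hE j))
    · exact (hint i).mul_const _
    · exact ((integrable_const (1 : ℝ)).indicator ((hE i).inter (hE j))).sub
        ((hint i).mul_const _)
    · exact (hint j).const_mul _
    · exact (((integrable_const (1 : ℝ)).indicator ((hE i).inter (hE j))).sub
        ((hint i).mul_const _)).sub ((hint j).const_mul _)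
    · exact integrable_const _
  have hsq (ω : Ω) : (∑ i ∈ Finset.range n, f i ω) ^ 2 =
      ∑ i ∈ Finset.range n, ∑ j ∈ Finset.range n, f i ω * f j ω := by
    rw [sq, Finset.sum_mul_sum]
  have hsqint : Integrable (fun ω => (∑ i ∈ Finset.range n, f i ω) ^ 2) μ := by
    simp only [hsq]
    exact integrable_finsetSum _ fun i _ => integrable_finsetSum _ fun j _ => hij i j
  have hvar : ∫ ω, (∑ i ∈ Finset.range n, f i ω) ^ 2 ∂μ ≤ 4 * C * n := by
    simp only [hsq]
    rw [integral_finsetSum _ fun i _ => integrable_finsetSum _ fun j _ => hij i j]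
    calc _ ≤ ∑ i ∈ Finset.range n, 4 * C := by
          refine Finset.sum_le_sum fun i _ => ?_
          rw [integral_finsetSum _ fun j _ => hij i j]
          calc _ ≤ ∑ j ∈ Finset.range n, C * (1 / 2 : ℝ) ^ ((i - j) + (j - i)) :=
                Finset.sum_le_sum fun j _ => by rw [hcov]; exact hE2 i j
            _ ≤ 4 * C := by
              rw [← Finset.mul_sum]
              nlinarith [sum_half_pow_dist_le n i]
      _ = 4 * C * n := by simp; ring
  have hn' : (0 : ℝ) < n := by exact_mod_cast hn
  -- If no event occurs, every centred indicator is at most `-p`, so the centred sum is at most `-(n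
  -- * p)`.
  have hsub : {ω | ∀ i < n, ω ∉ E i} ⊆ {ω | (n * p) ^ 2 ≤ (∑ i ∈ Finset.range n, f i ω) ^ 2} := by
    intro ω hω
    have h1 : ∑ i ∈ Finset.range n, f i ω ≤ -(n * p) := by
      calc _ ≤ ∑ i ∈ Finset.range n, -p := by
            refine Finset.sum_le_sum fun i hi => ?_
            simp only [hf, Set.indicator_of_notMem (hω i (Finset.mem_range.1 hi))]
            linarith [hE1 i]
        _ = _ := by simp
    have h2 : 0 < n * p := by positivity
    simp only [Set.mem_ofPred_eq]
    nlinarith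
  have hmarkov := mul_meas_ge_le_integral_of_nonneg (ae_of_all μ fun ω =>
    sq_nonneg (∑ i ∈ Finset.range n, f i ω)) hsqint ((n * p) ^ 2)
  have h3 : μ.real {ω | ∀ i < n, ω ∉ E i} ≤
      μ.real {ω | (n * p) ^ 2 ≤ (∑ i ∈ Finset.range n, f i ω) ^ 2} := measureReal_mono hsub
  have h4 : 4 * C / p ^ 2 / n = 4 * C * n / (n * p) ^ 2 := by
    field_simp
  rw [h4, le_div_iff₀ (by positivity)]
  calc _ ≤ (n * p) ^ 2 * μ.real {ω | (n * p) ^ 2 ≤ (∑ i ∈ Finset.range n, f i ω) ^ 2} := by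
        rw [mul_comm]
        exact mul_le_mul_of_nonneg_left h3 (by positivity)
    _ ≤ _ := hmarkov.trans hvar

/-! ### Void probabilities of Poisson fields -/

lemma poissonMeasure_zero_singleton (r : ℝ≥0) :
    poissonMeasure r {0} = ENNReal.ofReal (Real.exp (-r)) := by
  rw [poissonMeasure_singleton]; simp

/-- Finite sets of coordinates give a product of exponentials; continuity from above along the
finite sets gives the general case. -/
lemma measure_infinitePi_poisson_void {σ : Type*} [Countable σ] (ρ : σ → ℝ≥0) (A : Set σ)
    (hA : ∑' e, A.indicator (fun e => (ρ e : ℝ≥0∞)) e ≠ ∞) :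
    (Measure.infinitePi fun e => poissonMeasure (ρ e)).real {N : σ → ℕ | ∀ e ∈ A, N e = 0} =
      Real.exp (-(∑' e, A.indicator (fun e => (ρ e : ℝ≥0∞)) e).toReal) := by
  classical
  set P := Measure.infinitePi fun e => poissonMeasure (ρ e) with hP
  let B : σ → Set ℕ := fun e => if e ∈ A then {0} else Set.univ
  set g : σ → ℝ := fun e => (A.indicator (fun e => (ρ e : ℝ≥0∞)) e).toReal with hgdef
  have hg : HasSum g (∑' e, A.indicator (fun e => (ρ e : ℝ≥0∞)) e).toReal :=
    by
    rw [ENNReal.tsum_toReal_eq fun e => ENNReal.ne_top_of_tsum_ne_top hA e]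
    exact ENNReal.hasSum_toReal hA
  have hB (e : σ) : poissonMeasure (ρ e) (B e) = ENNReal.ofReal (Real.exp (-g e)) := by
    by_cases he : e ∈ A
    · simp [B, g, he, poissonMeasure_zero_singleton]
    · simp [B, g, he]
  have hs (s : Finset σ) : P (Set.pi s B) = ENNReal.ofReal (Real.exp (-∑ e ∈ s, g e)) := by
    rw [hP, Measure.infinitePi_pi _ fun e _ => MeasurableSet.of_discrete]
    simp only [hB]
    rw [← ENNReal.ofReal_prod_of_nonneg fun e _ => (Real.exp_pos _).le, ← Real.exp_sum,
      Finset.sum_neg_distrib]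
  have hset : {N : σ → ℕ | ∀ e ∈ A, N e = 0} = ⋂ s : Finset σ, Set.pi (s : Set σ) B := by
    ext N
    simp only [Set.mem_ofPred_eq, Set.mem_iInter, Set.mem_pi, Finset.mem_coe]
    constructor
    · intro h s e _
      by_cases he : e ∈ A
      · simp [B, he, h e he]
      · simp [B, he]
    · intro h e he
      simpa [B, he] using h {e} e (by simp)
  have h1 : Tendsto (fun s : Finset σ => P (Set.pi (s : Set σ) B)) atTop
      (𝓝 (P (⋂ s : Finset σ, Set.pi (s : Set σ) B))) := by
    refine tendsto_measure_iInter_atTop (fun s => ?_) ?_ ⟨∅, measure_ne_top _ _⟩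
    · exact (MeasurableSet.pi s.countable_toSet fun e _ =>
        MeasurableSet.of_discrete).nullMeasurableSet
    · intro s t hst N hN e he
      exact hN e (hst he)
  have h2 : Tendsto (fun s : Finset σ => P (Set.pi (s : Set σ) B)) atTop
      (𝓝 (ENNReal.ofReal (Real.exp
        (-(∑' e, A.indicator (fun e => (ρ e : ℝ≥0∞)) e).toReal)))) := by
    simp only [hs]
    exact ENNReal.tendsto_ofReal ((Real.continuous_exp.tendsto _).comp (Tendsto.neg hg))
  rw [measureReal_def, hset, tendsto_nhds_unique h1 h2, ENNReal.toReal_ofReal (Real.exp_pos _).le]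

/-! ### Cuts of the spine graph -/

namespace TreeVertex

def level : TreeVertex → ℕ
  | v n => n
  | h i _ => i + 1

noncomputable def weight : TreeVertex → ℝ≥0
  | v _ => 1
  | h _ w => 2⁻¹ ^ w.length

lemma tsum_eq (f : TreeVertex → ℝ≥0∞) :
    ∑' x, f x = ∑' n, f (v n) + ∑' i, ∑' w, f (h i w) := by
  rw [← equivSum.symm.tsum_eq, ENNReal.tsum_sum, ← ENNReal.tsum_prod]
  rfl

end TreeVertex

/-- The total mass of the leaves on each level, for the uniform measure on infinite words, is at
most one. -/
def KraftBound (c : Set (ℕ × Word)) : Prop :=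
  ∀ i, ∑' w, {w | (i, w) ∈ c}.indicator (fun w => (2⁻¹ : ℝ≥0∞) ^ w.length) w ≤ 1

/-- For leaves on different levels the rate is bounded by a product of a function of the lower leaf
and one of the higher leaf, so that sums over pairs factorise. -/
lemma spineRate_le (lam : ℝ≥0) {c : Set (ℕ × Word)} {x y : TreeVertex} (hx : x ∈ spineVerts c)
    (hy : y ∈ spineVerts c) (hxy : x.level < y.level) : spineRate lam s(x, y) ≤
      lam * (2 ^ x.level * x.weight) * (2⁻¹ ^ y.level * y.weight) := by
  have hr (n : ℕ) : 2 * lam / 2 ^ (n + 1) = lam * 2⁻¹ ^ n := by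
    rw [pow_succ, inv_pow]
    field_simp
  rcases hy with rfl | ⟨⟨j, w⟩, -, rfl⟩
  · exact absurd hxy (Nat.not_lt_zero _)
  rcases hx with rfl | ⟨⟨i, u⟩, -, rfl⟩
  · rw [spineRate_mk]
    simp only [spineDist, level, weight]
    rw [hr, show 0 - (j + 1) + (j + 1 - 0) + w.length = (j + 1) + w.length by omega, pow_add]
    simp
  · simp only [level] at hxy
    obtain ⟨k, rfl⟩ : ∃ k, j = i + k + 1 := ⟨j - i - 1, by omega⟩
    rw [spineRate_mk]
    simp only [spineDist, level, weight]
    rw [if_neg (by omega), show i - (i + k + 1) + (i + k + 1 - i) + u.length + w.length + 2 =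
      ((k + 1) + u.length + w.length + 1) + 1 by omega, hr]
    have h2 : (2 : ℝ≥0) ^ (i + 1) * 2⁻¹ ^ (i + 1) = 1 := by
      rw [← mul_pow]; simp
    have h3 : lam * (2 ^ (i + 1) * 2⁻¹ ^ u.length) * (2⁻¹ ^ (i + k + 1 + 1) * 2⁻¹ ^ w.length) =
        lam * 2⁻¹ ^ (k + 1 + u.length + w.length) * (2 ^ (i + 1) * 2⁻¹ ^ (i + 1)) := by
      ring
    rw [h3, h2, mul_one]
    -- Two hanging trees contribute two attaching edges; the resulting extra factor 1/2 is given
    -- away.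
    gcongr lam * ?_
    exact pow_le_pow_of_le_one zero_le (by norm_num) (by omega)

/-- Pairs of leaves of which one is at most at level `i` and the other above level `j`. -/
def crossing (c : Set (ℕ × Word)) (i j : ℕ) : Set (Sym2 TreeVertex) :=
  {e | ∃ x ∈ spineVerts c, ∃ y ∈ spineVerts c, x.level ≤ i ∧ j < y.level ∧ e = s(x, y)}

/-- An edge across both cuts spans all the levels between them. This long span makes the dependence
of two cuts decay. -/
lemma crossing_inter_subset (c : Set (ℕ × Word)) {i j : ℕ} (hij : i ≤ j) :
    crossing c i i ∩ crossing c j j ⊆ crossing c i j := by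
  rintro e ⟨⟨x, hx, y, hy, hxi, hyi, rfl⟩, ⟨x', hx', y', hy', hxj, hyj, h⟩⟩
  rcases Sym2.eq_iff.1 h with ⟨rfl, rfl⟩ | ⟨rfl, rfl⟩
  · exact ⟨x, hx, y, hy, hxi, hyj, rfl⟩
  · omega

/-- Kraft bounds the leaf weights on each hanging level by one, leaving the geometric sum 1 + 2 +
... + 2^i. -/
lemma tsum_low_le {c : Set (ℕ × Word)} (hc : KraftBound c) (i : ℕ) :
    ∑' x : TreeVertex, {x | x ∈ spineVerts c ∧ x.level ≤ i}.indicator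
      (fun x => (2 : ℝ≥0∞) ^ x.level * x.weight) x ≤ 2 ^ (i + 1) := by
  classical
  rw [TreeVertex.tsum_eq]
  have h1 : ∑' n, {x | x ∈ spineVerts c ∧ x.level ≤ i}.indicator
      (fun x => (2 : ℝ≥0∞) ^ x.level * x.weight) (v n) ≤ 1 := by
    rw [tsum_eq_single 0]
    · refine (Set.indicator_le_self _ _ _).trans ?_
      simp [level, weight]
    · intro n hn
      refine Set.indicator_of_notMem ?_ _
      rintro ⟨h | ⟨p, -, h⟩, -⟩
      · simp only [v.injEq] at h
        exact hn h
      · cases h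
  have h2 (k : ℕ) : ∑' w, {x | x ∈ spineVerts c ∧ x.level ≤ i}.indicator
      (fun x => (2 : ℝ≥0∞) ^ x.level * x.weight) (h k w) ≤
        (if k < i then (2 : ℝ≥0∞) ^ (k + 1) else 0) := by
    by_cases hk : k < i
    · rw [if_pos hk]
      calc _ ≤ ∑' w, (2 : ℝ≥0∞) ^ (k + 1) *
            {w | (k, w) ∈ c}.indicator (fun w => (2⁻¹ : ℝ≥0∞) ^ w.length) w := by
            refine ENNReal.tsum_le_tsum fun w => ?_
            by_cases hw : (k, w) ∈ c
            · refine (Set.indicator_le_self _ _ _).trans ?_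
              rw [Set.indicator_of_mem (by exact hw)]
              simp [level, weight, ENNReal.coe_pow, ENNReal.inv_pow]
            · rw [Set.indicator_of_notMem]
              · exact zero_le
              rintro ⟨h | ⟨⟨k', w'⟩, hp, h⟩, -⟩
              · cases h
              · cases h
                exact hw hp
        _ ≤ 2 ^ (k + 1) := by
          rw [ENNReal.tsum_mul_left]
          exact mul_le_of_le_one_right' (hc k)
    · rw [if_neg hk]
      refine (ENNReal.tsum_eq_zero.2 fun w => Set.indicator_of_notMem ?_ _).le
      rintro ⟨-, h⟩
      simp only [level] at h
      omega
  have h3 (i : ℕ) : 1 + ∑ k ∈ Finset.range i, (2 : ℝ≥0∞) ^ (k + 1) ≤ 2 ^ (i + 1) := by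
    induction i with
    | zero => norm_num
    | succ i ih =>
      rw [Finset.sum_range_succ, ← add_assoc]
      calc _ ≤ (2 : ℝ≥0∞) ^ (i + 1) + 2 ^ (i + 1) := by gcongr
        _ = 2 ^ (i + 1 + 1) := by rw [pow_succ _ (i + 1)]; ring
  refine le_trans (add_le_add h1 ((ENNReal.tsum_le_tsum h2).trans (le_of_eq ?_))) (h3 i)
  rw [tsum_eq_sum (s := Finset.range i)]
  · exact Finset.sum_congr rfl fun k hk => if_pos (Finset.mem_range.1 hk)
  · intro k hk
    exact if_neg fun h => hk (Finset.mem_range.2 h)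

/-- With the Kraft bound on each level, the geometric tail starting at 2^-(j+1) sums to 2^-j. -/
lemma tsum_high_le {c : Set (ℕ × Word)} (hc : KraftBound c) (j : ℕ) :
    ∑' y : TreeVertex, {y | y ∈ spineVerts c ∧ j < y.level}.indicator
      (fun y => (2⁻¹ : ℝ≥0∞) ^ y.level * y.weight) y ≤ 2⁻¹ ^ j := by
  classical
  rw [TreeVertex.tsum_eq]
  have h1 : ∑' n, {y | y ∈ spineVerts c ∧ j < y.level}.indicator
      (fun y => (2⁻¹ : ℝ≥0∞) ^ y.level * y.weight) (v n) = 0 := by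
    refine ENNReal.tsum_eq_zero.2 fun n => Set.indicator_of_notMem ?_ _
    rintro ⟨h | ⟨p, -, h⟩, h'⟩
    · rw [h] at h'
      exact absurd h' (Nat.not_lt_zero _)
    · cases h
  have h2 (k : ℕ) : ∑' w, {y | y ∈ spineVerts c ∧ j < y.level}.indicator
      (fun y => (2⁻¹ : ℝ≥0∞) ^ y.level * y.weight) (h k w) ≤
        (if j ≤ k then (2⁻¹ : ℝ≥0∞) ^ (k + 1) else 0) := by
    by_cases hk : j ≤ k
    · rw [if_pos hk]
      calc _ ≤ ∑' w, (2⁻¹ : ℝ≥0∞) ^ (k + 1) *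
            {w | (k, w) ∈ c}.indicator (fun w => (2⁻¹ : ℝ≥0∞) ^ w.length) w := by
            refine ENNReal.tsum_le_tsum fun w => ?_
            by_cases hw : (k, w) ∈ c
            · refine (Set.indicator_le_self _ _ _).trans ?_
              rw [Set.indicator_of_mem (by exact hw)]
              simp [level, weight, ENNReal.coe_pow, ENNReal.inv_pow]
            · rw [Set.indicator_of_notMem]
              · exact zero_le
              rintro ⟨h | ⟨⟨k', w'⟩, hp, h⟩, -⟩
              · cases h
              · cases h
                exact hw hp
        _ ≤ 2⁻¹ ^ (k + 1) := by
          rw [ENNReal.tsum_mul_left]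
          exact mul_le_of_le_one_right' (hc k)
    · rw [if_neg hk]
      refine (ENNReal.tsum_eq_zero.2 fun w => Set.indicator_of_notMem ?_ _).le
      rintro ⟨-, h⟩
      simp only [level] at h
      omega
  rw [h1, zero_add]
  refine (ENNReal.tsum_le_tsum h2).trans (le_of_eq ?_)
  rw [← (add_right_injective j).tsum_eq]
  · simp only [le_add_iff_nonneg_right, zero_le, if_true, add_assoc, pow_add (2⁻¹ : ℝ≥0∞) j]
    rw [ENNReal.tsum_mul_left, ENNReal.tsum_geometric_add_one, ENNReal.one_sub_inv_two, inv_inv,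
      ENNReal.inv_mul_cancel (by simp) (by simp), mul_one]
  · intro k hk
    have hjk : j ≤ k := by
      by_contra h
      exact hk (if_neg h)
    exact ⟨k - j, by simp; omega⟩

/-- The total rate of a set of pairs. -/
noncomputable def totalRate (lam : ℝ≥0) (A : Set (Sym2 TreeVertex)) : ℝ≥0∞ :=
  ∑' e, A.indicator (fun e => (spineRate lam e : ℝ≥0∞)) e

lemma totalRate_mono (lam : ℝ≥0) {A B : Set (Sym2 TreeVertex)} (h : A ⊆ B) :
    totalRate lam A ≤ totalRate lam B :=
  ENNReal.tsum_le_tsum fun e => Set.indicator_le_indicator_of_subset h (fun _ => zero_le) e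

lemma totalRate_union_add_inter (lam : ℝ≥0) (A B : Set (Sym2 TreeVertex)) :
    totalRate lam (A ∪ B) + totalRate lam (A ∩ B) = totalRate lam A + totalRate lam B := by
  unfold totalRate
  rw [← ENNReal.tsum_add, ← ENNReal.tsum_add]
  refine tsum_congr fun e => ?_
  exact congrFun (Set.indicator_union_add_inter (fun e => (spineRate lam e : ℝ≥0∞)) A B) e

lemma totalRate_crossing_le (lam : ℝ≥0) {c : Set (ℕ × Word)} (hc : KraftBound c) {i j : ℕ}
    (hij : i ≤ j) : totalRate lam (crossing c i j) ≤ lam * 2 ^ (i + 1) * 2⁻¹ ^ j := by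
  classical
  -- Each crossing pair is oriented with its low end first. The orientation is injective, so the sum
  -- over unordered pairs is bounded by a double sum.
  have hg : ∀ e : Sym2 TreeVertex, ∃ p : TreeVertex × TreeVertex, s(p.1, p.2) = e ∧
      (e ∈ crossing c i j → (p.1 ∈ spineVerts c ∧ p.1.level ≤ i) ∧
        (p.2 ∈ spineVerts c ∧ j < p.2.level)) := by
    intro e
    by_cases he : e ∈ crossing c i j
    · obtain ⟨x, hx, y, hy, hxi, hyj, rfl⟩ := he
      exact ⟨(x, y), rfl, fun _ => ⟨⟨hx, hxi⟩, hy, hyj⟩⟩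
    · induction e with
      | h x y => exact ⟨(x, y), rfl, fun h => absurd h he⟩
  choose g hg1 hg2 using hg
  have hinj : Function.Injective g := fun e e' h => by rw [← hg1 e, ← hg1 e', h]
  set low := fun x : TreeVertex => {x | x ∈ spineVerts c ∧ x.level ≤ i}.indicator
      (fun x => (2 : ℝ≥0∞) ^ x.level * x.weight) x with hlow
  set high := fun y : TreeVertex => {y | y ∈ spineVerts c ∧ j < y.level}.indicator
      (fun y => (2⁻¹ : ℝ≥0∞) ^ y.level * y.weight) y with hhigh
  calc totalRate lam (crossing c i j) ≤ ∑' e, lam * low (g e).1 * high (g e).2 := by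
        refine ENNReal.tsum_le_tsum fun e => ?_
        by_cases he : e ∈ crossing c i j
        · obtain ⟨hx, hy⟩ := hg2 e he
          rw [Set.indicator_of_mem he]
          simp only [hlow, hhigh]
          rw [Set.indicator_of_mem (by exact hx), Set.indicator_of_mem (by exact hy)]
          have h := spineRate_le lam hx.1 hy.1 (by omega)
          rw [hg1] at h
          have h' := ENNReal.coe_le_coe.2 h
          simpa [ENNReal.coe_mul, ENNReal.coe_pow, ENNReal.inv_pow] using h'
        · rw [Set.indicator_of_notMem he]
          exact zero_le
    _ ≤ ∑' p : TreeVertex × TreeVertex, lam * low p.1 * high p.2 :=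
      ENNReal.tsum_comp_le_tsum_of_injective hinj fun p => lam * low p.1 * high p.2
    _ = lam * (∑' x, low x) * ∑' y, high y := by
      rw [ENNReal.tsum_prod']
      simp only [ENNReal.tsum_mul_left, ENNReal.tsum_mul_right]
    _ ≤ lam * 2 ^ (i + 1) * 2⁻¹ ^ j := by
      gcongr
      · exact tsum_low_le hc i
      · exact tsum_high_le hc j

lemma toReal_totalRate_crossing_le (lam : ℝ≥0) {c : Set (ℕ × Word)} (hc : KraftBound c) {i j : ℕ}
    (hij : i ≤ j) : totalRate lam (crossing c i j) ≠ ∞ ∧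
      (totalRate lam (crossing c i j)).toReal ≤ 2 * lam * (1 / 2) ^ (j - i) := by
  have h := totalRate_crossing_le lam hc hij
  have h' : (lam : ℝ≥0∞) * 2 ^ (i + 1) * 2⁻¹ ^ j =
      ENNReal.ofReal (2 * lam * (1 / 2) ^ (j - i)) := by
    obtain ⟨k, rfl⟩ := Nat.exists_eq_add_of_le hij
    have h2 : (2 : ℝ≥0) ^ i * 2⁻¹ ^ i = 1 := by
      rw [← mul_pow]; simp
    have h3 : (lam * 2 ^ (i + 1) * 2⁻¹ ^ (i + k) : ℝ≥0) = 2 * lam * (1 / 2) ^ k := by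
      calc (lam * 2 ^ (i + 1) * 2⁻¹ ^ (i + k) : ℝ≥0) =
            2 * lam * 2⁻¹ ^ k * (2 ^ i * 2⁻¹ ^ i) := by ring
        _ = _ := by rw [h2, mul_one, one_div]
    rw [Nat.add_sub_cancel_left]
    have h4 : ((2 * lam * (1 / 2) ^ k : ℝ≥0) : ℝ) = 2 * lam * (1 / 2) ^ k := by push_cast; rfl
    rw [← h4, ENNReal.ofReal_coe_nnreal, ← h3]
    simp [ENNReal.coe_mul, ENNReal.coe_pow, ENNReal.inv_pow]
  rw [h'] at h
  exact ⟨ne_top_of_le_ne_top ENNReal.ofReal_ne_top h,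
    ENNReal.toReal_le_of_le_ofReal (by positivity) h⟩

/-- No edge crosses from the levels up to `i` to the levels above `i`. -/
def EmptyCut (c : Set (ℕ × Word)) (N : Sym2 TreeVertex → ℕ) (i : ℕ) : Prop :=
  ∀ e ∈ crossing c i i, N e = 0

lemma measurableSet_emptyCut (c : Set (ℕ × Word)) (i : ℕ) :
    MeasurableSet {N | EmptyCut c N i} := by
  have h : {N | EmptyCut c N i} = ⋂ e ∈ crossing c i i, {N | N e = 0} := by
    ext N
    simp [EmptyCut]
  rw [h]
  exact MeasurableSet.biInter (Set.to_countable _) fun e _ =>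
    measurable_pi_apply (X := fun _ => ℕ) e (MeasurableSet.singleton 0)

lemma measureReal_emptyCut (lam : ℝ≥0) {c : Set (ℕ × Word)} (hc : KraftBound c) (i : ℕ) :
    (spineField lam).real {N | EmptyCut c N i} =
      Real.exp (-(totalRate lam (crossing c i i)).toReal) :=
  measure_infinitePi_poisson_void _ _ (toReal_totalRate_crossing_le lam hc le_rfl).1

/-- With `a`, `b` the rates of the cuts and `x` that of their common edges, the covariance is exp
(-a-b) * (exp x - 1), at most x * exp x; and `x` decays geometrically in the distance of the cuts.
-/
lemma measureReal_emptyCut_inter (lam : ℝ≥0) {c : Set (ℕ × Word)} (hc : KraftBound c) {i j : ℕ}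
    (hij : i ≤ j) : (spineField lam).real ({N | EmptyCut c N i} ∩ {N | EmptyCut c N j}) -
        (spineField lam).real {N | EmptyCut c N i} * (spineField lam).real {N | EmptyCut c N j} ≤
      2 * lam * Real.exp (2 * lam) * (1 / 2) ^ (j - i) := by
  have hi := (toReal_totalRate_crossing_le lam hc (le_refl i)).1
  have hj := (toReal_totalRate_crossing_le lam hc (le_refl j)).1
  have hsum := totalRate_union_add_inter lam (crossing c i i) (crossing c j j)
  have hint : totalRate lam (crossing c i i ∩ crossing c j j) ≠ ∞ :=
    ne_top_of_le_ne_top hi (totalRate_mono lam Set.inter_subset_left)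
  have hun : totalRate lam (crossing c i i ∪ crossing c j j) ≠ ∞ :=
    ne_top_of_le_ne_top (ENNReal.add_ne_top.2 ⟨hi, hj⟩) (hsum ▸ le_self_add)
  have hset : {N | EmptyCut c N i} ∩ {N | EmptyCut c N j} =
      {N | ∀ e ∈ crossing c i i ∪ crossing c j j, N e = 0} := by
    ext N
    simp only [EmptyCut, Set.mem_inter_iff, Set.mem_ofPred_eq, Set.mem_union, or_imp,
      forall_and]
  have hP : (spineField lam).real ({N | EmptyCut c N i} ∩ {N | EmptyCut c N j}) =
      Real.exp (-(totalRate lam (crossing c i i ∪ crossing c j j)).toReal) := by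
    rw [hset]
    exact measure_infinitePi_poisson_void _ _ hun
  have hsum' : (totalRate lam (crossing c i i ∪ crossing c j j)).toReal +
      (totalRate lam (crossing c i i ∩ crossing c j j)).toReal =
      (totalRate lam (crossing c i i)).toReal + (totalRate lam (crossing c j j)).toReal := by
    rw [← ENNReal.toReal_add hun hint, hsum, ENNReal.toReal_add hi hj]
  rw [hP, measureReal_emptyCut lam hc, measureReal_emptyCut lam hc]
  have hx : (totalRate lam (crossing c i i ∩ crossing c j j)).toReal ≤
      2 * lam * (1 / 2) ^ (j - i) := by
    obtain ⟨h1, h2⟩ := toReal_totalRate_crossing_le lam hc hij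
    exact (ENNReal.toReal_mono h1 (totalRate_mono lam (crossing_inter_subset c hij))).trans h2
  have hx0 : 0 ≤ (totalRate lam (crossing c i i ∩ crossing c j j)).toReal := ENNReal.toReal_nonneg
  have hri : 0 ≤ (totalRate lam (crossing c i i)).toReal := ENNReal.toReal_nonneg
  have hrj : 0 ≤ (totalRate lam (crossing c j j)).toReal := ENNReal.toReal_nonneg
  generalize (totalRate lam (crossing c i i ∩ crossing c j j)).toReal = x at *
  generalize (totalRate lam (crossing c i i)).toReal = a at *
  generalize (totalRate lam (crossing c j j)).toReal = b at *
  generalize (totalRate lam (crossing c i i ∪ crossing c j j)).toReal = u at *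
  obtain rfl : u = a + b - x := by linarith
  have h1 : Real.exp (-(a + b - x)) = Real.exp (-a) * Real.exp (-b) * Real.exp x := by
    rw [← Real.exp_add, ← Real.exp_add]; ring_nf
  have h2 : Real.exp x - 1 ≤ x * Real.exp x := by
    have h3 := Real.add_one_le_exp (-x)
    have h4 : Real.exp (-x) * Real.exp x = 1 := by rw [← Real.exp_add]; simp
    nlinarith [Real.exp_pos x]
  have hle : x ≤ 2 * lam := hx.trans (mul_le_of_le_one_right (by positivity)
    (pow_le_one₀ (by norm_num) (by norm_num)))
  have h5 : x * Real.exp x ≤ 2 * lam * (1 / 2) ^ (j - i) * Real.exp (2 * lam) :=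
    mul_le_mul hx (Real.exp_le_exp.2 hle) (Real.exp_pos _).le (by positivity)
  have h6 : Real.exp (-a) * Real.exp (-b) ≤ 1 := by
    rw [← Real.exp_add]
    exact Real.exp_le_one_iff.2 (by linarith)
  have h7 : 0 ≤ Real.exp (-a) * Real.exp (-b) := by positivity
  have h8 : 0 ≤ Real.exp x - 1 := by linarith [Real.add_one_le_exp x]
  rw [h1]
  nlinarith

/-- With high probability, one of the first cuts is empty, uniformly in the configuration. -/
theorem exists_tendsto_measure_not_emptyCut (lam : ℝ≥0) : ∃ q : ℕ → ℝ≥0∞, Tendsto q atTop (𝓝 0) ∧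
    ∀ c, KraftBound c → ∀ n, spineField lam {N | ∀ i < n, ¬ EmptyCut c N i} ≤ q n := by
  set p := Real.exp (-(2 * lam))
  set C := 2 * lam * Real.exp (2 * lam)
  have hlim : Tendsto (fun n : ℕ => ENNReal.ofReal (4 * C / p ^ 2 / n)) atTop (𝓝 0) := by
    rw [← ENNReal.ofReal_zero]
    exact ENNReal.tendsto_ofReal (tendsto_const_div_atTop_nhds_zero_nat _)
  -- At `n = 0` the event is certain, while division by zero would yield the false bound `0`.
  refine ⟨fun n => if n = 0 then 1 else ENNReal.ofReal (4 * C / p ^ 2 / n), ?_, ?_⟩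
  · refine hlim.congr' ?_
    filter_upwards [eventually_ne_atTop 0] with n hn
    rw [if_neg hn]
  · intro c hc n
    rcases Nat.eq_zero_or_pos n with rfl | hn
    · simp
    simp only
    rw [if_neg hn.ne', ← ofReal_measureReal]
    refine ENNReal.ofReal_le_ofReal ?_
    refine measureReal_iInter_compl_le (spineField lam) (measurableSet_emptyCut c)
      (Real.exp_pos _) (fun i => ?_) (fun i j => ?_) (by positivity) hn
    · rw [measureReal_emptyCut lam hc]
      have := (toReal_totalRate_crossing_le lam hc (le_refl i)).2
      rw [Nat.sub_self, pow_zero, mul_one] at this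
      exact Real.exp_le_exp.2 (by linarith)
    · rcases le_total i j with h | h
      · rw [Nat.sub_eq_zero_of_le h, zero_add]
        exact measureReal_emptyCut_inter lam hc h
      · rw [Nat.sub_eq_zero_of_le h, add_zero, Set.inter_comm, mul_comm ((spineField lam).real _)]
        exact measureReal_emptyCut_inter lam hc h

/-! ### Partitions -/

lemma measure_eq_tsum_inter {Ω ι : Type*} [MeasurableSpace Ω] [Countable ι] {μ : Measure Ω}
    {E : ι → Set Ω} (hE : ∀ i, MeasurableSet (E i)) (hd : ∀ i j ω, ω ∈ E i → ω ∈ E j → i = j)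
    (hcov : ∀ᵐ ω ∂μ, ∃ i, ω ∈ E i) {A : Set Ω} (hA : MeasurableSet A) :
    μ A = ∑' i, μ (A ∩ E i) := by
  rw [← measure_iUnion _ fun i => hA.inter (hE i), ← Set.inter_iUnion]
  · refine measure_congr ?_
    filter_upwards [hcov] with ω hω
    refine propext ⟨fun h => ⟨h, Set.mem_iUnion.2 hω⟩, fun h => h.1⟩
  · intro i j hij
    rw [Function.onFun, Set.disjoint_left]
    exact fun ω h h' => hij (hd i j ω h.2 h'.2)

/-! ### Configurations of leaves -/

/-- On each level, the leaves are those of a finite binary tree, if there are any. -/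
def TreeLevels (c : Set (ℕ × Word)) : Prop :=
  ∀ i, (∃ x : BinTree, ∀ w, (i, w) ∈ c ↔ w ∈ x.leaves) ∨ ∀ w, (i, w) ∉ c

lemma TreeLevels.kraftBound {c : Set (ℕ × Word)} (hc : TreeLevels c) : KraftBound c := by
  intro i
  rcases hc i with ⟨x, hx⟩ | h
  · have : {w | (i, w) ∈ c} = x.leaves := Set.ext hx
    rw [this]
    exact x.kraft
  · have : {w | (i, w) ∈ c} = ∅ := Set.eq_empty_of_forall_notMem h
    rw [this]
    simp

lemma TreeLevels.finite {c : Set (ℕ × Word)} (hc : TreeLevels c) (i : ℕ) :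
    {w | (i, w) ∈ c}.Finite := by
  rcases hc i with ⟨x, hx⟩ | h
  · have : {w | (i, w) ∈ c} = x.leaves := Set.ext hx
    rw [this]
    exact x.leaves_finite
  · have : {w | (i, w) ∈ c} = ∅ := Set.eq_empty_of_forall_notMem h
    rw [this]
    exact Set.finite_empty

lemma treeLevels_levelLeaves (l : List BinTree) : TreeLevels (levelLeaves l) := levelLeaves_level l

lemma spineVerts_mono {c c' : Set (ℕ × Word)} (h : c' ⊆ c) : spineVerts c' ⊆ spineVerts c := by
  rintro x (hx | ⟨p, hp, hx⟩)
  · exact Or.inl hx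
  · exact Or.inr ⟨p, h hp, hx⟩

lemma finite_spineVerts {c : Set (ℕ × Word)} (hc : c.Finite) : (spineVerts c).Finite := by
  refine ((Set.finite_singleton (v 0)).union
    (hc.image fun p => TreeVertex.h p.1 p.2)).subset ?_
  rintro x (hx | ⟨p, hp, hx⟩)
  · exact Or.inl hx
  · exact Or.inr ⟨p, hp, hx.symm⟩

lemma spineGraph_mult_ne_zero {c : Set (ℕ × Word)} {N : Sym2 TreeVertex → ℕ} {x y : TreeVertex}
    (h : (spineGraph c N).mult x y ≠ 0) : x ∈ spineVerts c ∧ y ∈ spineVerts c ∧ N s(x, y) ≠ 0 := by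
  by_cases hxy : x ≠ y ∧ x ∈ spineVerts c ∧ y ∈ spineVerts c
  · have h' : (spineGraph c N).mult x y = N s(x, y) := if_pos hxy
    exact ⟨hxy.2.1, hxy.2.2, h' ▸ h⟩
  · exact absurd (if_neg hxy) h

lemma EmptyCut.level_le {c : Set (ℕ × Word)} {N : Sym2 TreeVertex → ℕ} {i : ℕ}
    (h : EmptyCut c N i) {x : TreeVertex} (hx : (spineGraph c N).Reachable x) : x.level ≤ i := by
  induction hx with
  | refl => exact Nat.zero_le _
  | @tail y z _ hyz ih =>
    obtain ⟨hy, hz, hN⟩ := spineGraph_mult_ne_zero hyz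
    by_contra hlt
    exact hN (h _ ⟨y, hy, z, hz, ih, not_le.1 hlt, rfl⟩)

/-- Leaves beyond an empty cut may be deleted without changing the component of the root. -/
lemma EmptyCut.component_eq {c c' : Set (ℕ × Word)} {N : Sym2 TreeVertex → ℕ} {i : ℕ}
    (h : EmptyCut c N i) (hsub : c' ⊆ c) (hc' : ∀ p ∈ c, p.1 < i → p ∈ c') :
    (spineGraph c N).component = (spineGraph c' N).component := by
  classical
  have hmem (x : TreeVertex) (hx : x ∈ spineVerts c) (hxi : x.level ≤ i) : x ∈ spineVerts c' := by
    rcases hx with rfl | ⟨p, hp, rfl⟩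
    · exact Or.inl rfl
    · exact Or.inr ⟨p, hc' p hp hxi, rfl⟩
  refine RootedMultigraph.component_congr {x | x ∈ spineVerts c ∧ x.level ≤ i} rfl
    ⟨Or.inl rfl, Nat.zero_le _⟩ ?_ ?_
  · rintro x ⟨hx, hxi⟩ y
    by_cases hy : y ∈ spineVerts c'
    · have h1 := hmem x hx hxi
      have h2 := spineVerts_mono hsub hy
      exact if_congr (by simp only [hx, hy, h1, h2]) rfl rfl
    · have h2 : (spineGraph c' N).mult x y = 0 := if_neg fun h' => hy h'.2.2
      rw [h2]
      by_contra hne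
      obtain ⟨-, hyc, hN⟩ := spineGraph_mult_ne_zero hne
      have hyi : i < y.level := by
        by_contra hlt
        exact hy (hmem y hyc (not_lt.1 hlt))
      exact hN (h _ ⟨x, hx, y, hyc, hxi, hyi, rfl⟩)
  · rintro x ⟨hx, hxi⟩ y hne
    obtain ⟨-, hyc, hN⟩ := spineGraph_mult_ne_zero hne
    refine ⟨hyc, ?_⟩
    by_contra hlt
    exact hN (h _ ⟨x, hx, y, hyc, hxi, not_le.1 hlt, rfl⟩)

lemma EmptyCut.finite {c : Set (ℕ × Word)} {N : Sym2 TreeVertex → ℕ} {i : ℕ}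
    (h : EmptyCut c N i) (hc : TreeLevels c) : (spineGraph c N).component.verts.Finite := by
  have hfin : (⋃ k ∈ Set.Iio i, (fun w => (k, w)) '' {w | (k, w) ∈ c}).Finite :=
    (Set.finite_Iio i).biUnion fun k _ => (hc.finite k).image _
  refine (finite_spineVerts hfin).subset ?_
  intro x hx
  have hxi := h.level_le hx
  have hxc : x ∈ spineVerts c := RootedMultigraph.Reachable.mem_verts hx
  rcases hxc with rfl | ⟨⟨k, w⟩, hp, rfl⟩
  · exact Or.inl rfl
  · exact Or.inr ⟨(k, w), Set.mem_biUnion (show k ∈ Set.Iio i from hxi) ⟨w, hp, rfl⟩, rfl⟩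

/-! ### Trimming the random tree -/

/-- The leaves of the trees of age at most `t`. -/
def trimmedLeaves (θ : (ℕ → ℝ) × (ℕ × Word → ℝ)) (t : ℝ) : Set (ℕ × Word) :=
  {p | p ∈ hangingLeaves θ ∧ age θ.1 p.1 ≤ t}

lemma measurableSet_trimmedLeaves (t : ℝ) (p : ℕ × Word) :
    MeasurableSet {θ : (ℕ → ℝ) × (ℕ × Word → ℝ) | p ∈ trimmedLeaves θ t} :=
  (measurableSet_hangingLeaves p).inter
    (measurableSet_le ((measurable_age _).comp measurable_fst) measurable_const)

lemma AllLevels.wordAlive_iff {s : ℕ → ℝ} {K : ℕ → Word → ℝ} {l : List BinTree}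
    (h : AllLevels (fun (x : BinTree) i => {c | x.Grows c (age s i)}) l K) (hs : ∀ i, 0 < s i)
    (hK : ∀ i w, 0 < K i w) {i : ℕ} (hi : i < l.length) (w : Word) :
    WordAlive (K i) (age s i) w ↔ (i, w) ∈ levelLeaves l := by
  induction l with
  | nil => exact absurd hi (Nat.not_lt_zero _)
  | cons x l ih =>
    rw [mem_levelLeaves_cons]
    by_cases hil : i = l.length
    · have hx : x.Grows (K l.length) (age s l.length) := h.1
      rw [hil, hx.wordAlive_iff (hK _) (age_pos hs _).le]
      constructor
      · exact fun hw => Or.inl ⟨rfl, hw⟩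
      · rintro (hw | hw)
        · exact hw.2
        · exact absurd (lt_length_of_mem_levelLeaves hw) (lt_irrefl _)
    · rw [ih h.2 (by simp at hi; omega)]
      simp [hil]

lemma TrimmedSpine.trimmedLeaves_eq {l : List BinTree} {θ : (ℕ → ℝ) × (ℕ × Word → ℝ)} {t : ℝ}
    (h : TrimmedSpine l θ.1 (fun i w => θ.2 (i, w)) t) (hs : ∀ i, 0 < θ.1 i) (hc : ∀ x, 0 < θ.2 x) :
    trimmedLeaves θ t = levelLeaves l := by
  ext ⟨i, w⟩
  constructor
  · rintro ⟨hw, hi⟩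
    have hi' : i < l.length := by
      by_contra hlt
      exact absurd (h.2.2.trans_le (age_mono hs (not_lt.1 hlt))) (not_lt.2 hi)
    exact (h.1.wordAlive_iff hs (fun i w => hc (i, w)) hi' w).1 hw
  · intro hw
    have hi' := lt_length_of_mem_levelLeaves hw
    exact ⟨(h.1.wordAlive_iff hs (fun i w => hc (i, w)) hi' w).2 hw, h.2.1 i hi'⟩

lemma measurePreserving_treeMeasure_curry : MeasurePreserving
    (fun θ : (ℕ → ℝ) × (ℕ × Word → ℝ) => (θ.1, fun i w => θ.2 (i, w))) treeMeasure
    ((Measure.infinitePi fun _ : ℕ => expMeasure 1).prod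
      (Measure.infinitePi fun _ : ℕ => clockMeasure)) := by
  have h : MeasurePreserving (MeasurableEquiv.curry ℕ Word ℝ)
      (Measure.infinitePi fun _ : ℕ × Word => expMeasure 1)
      (Measure.infinitePi fun _ : ℕ => clockMeasure) :=
    ⟨(MeasurableEquiv.curry ℕ Word ℝ).measurable,
      Measure.infinitePi_map_curry fun (_ : ℕ) (_ : Word) => expMeasure 1⟩
  exact (MeasurePreserving.id _).prod h

lemma measurableSet_trimmedSpine_tree (l : List BinTree) (t : ℝ) :
    MeasurableSet {θ : (ℕ → ℝ) × (ℕ × Word → ℝ) |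
      TrimmedSpine l θ.1 (fun i w => θ.2 (i, w)) t} :=
  measurePreserving_treeMeasure_curry.measurable (measurableSet_trimmedSpine l t)

lemma treeMeasure_trimmedSpine (l : List BinTree) (t : ℝ) :
    treeMeasure {θ | TrimmedSpine l θ.1 (fun i w => θ.2 (i, w)) t} = SpineList.prob l t := by
  rw [← measure_trimmedSpine l t, ← measurePreserving_treeMeasure_curry.measure_preimage
    (measurableSet_trimmedSpine l t).nullMeasurableSet]
  rfl

lemma ae_exists_trimmedSpine (t : ℝ) :
    ∀ᵐ θ ∂treeMeasure, ∃ l, TrimmedSpine l θ.1 (fun i w => θ.2 (i, w)) t := by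
  have hm := fun l => measurableSet_trimmedSpine_tree l t
  have h : treeMeasure (⋃ l, {θ | TrimmedSpine l θ.1 (fun i w => θ.2 (i, w)) t}) = 1 := by
    rw [measure_iUnion _ hm]
    · simp only [treeMeasure_trimmedSpine, tsum_spineList_prob]
    · intro l m hlm
      rw [Function.onFun, Set.disjoint_left]
      exact fun θ h h' => hlm (TrimmedSpine.unique h h')
  have h' := (prob_compl_eq_zero_iff (MeasurableSet.iUnion hm)).2 h
  refine (measure_eq_zero_iff_ae_notMem.1 h').mono fun θ hθ => ?_
  simpa using hθ

lemma ae_treeLevels_hangingLeaves : ∀ᵐ θ ∂treeMeasure, TreeLevels (hangingLeaves θ) := by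
  filter_upwards [ae_treeMeasure_pos, ae_all_iff.2 fun n : ℕ => ae_exists_trimmedSpine n]
    with θ hpos h i
  obtain ⟨n, hn⟩ := exists_nat_ge (age θ.1 i)
  obtain ⟨l, hl⟩ := h n
  have heq := hl.trimmedLeaves_eq hpos.1 hpos.2
  have h' (w : Word) : (i, w) ∈ hangingLeaves θ ↔ (i, w) ∈ levelLeaves l := by
    rw [← heq]
    exact ⟨fun hw => ⟨hw, hn⟩, fun hw => hw.1⟩
  simpa only [h'] using levelLeaves_level l i

/-- The law of the component of the root when the trees have the shapes in `l`. -/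
noncomputable def spineLaw (lam : ℝ≥0) (l : List BinTree) : Measure MultigraphClass :=
  (spineField lam).map (spineClass (levelLeaves l))

lemma spineLaw_apply (lam : ℝ≥0) (l : List BinTree) {S : Set MultigraphClass}
    (hS : MeasurableSet S) :
    spineLaw lam l S = spineField lam {N | spineClass (levelLeaves l) N ∈ S} :=
  Measure.map_apply (measurable_spineClass (fun _ => MeasurableSet.const _) measurable_id) hS

/-- The mixture of the laws of the component of the root over the shapes of the trees of age at
most `t`. -/
noncomputable def trimmedLaw (lam : ℝ≥0) (t : ℝ) : Measure MultigraphClass :=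
  Measure.sum fun l => SpineList.prob l t • spineLaw lam l

lemma trimmedLaw_apply (lam : ℝ≥0) (t : ℝ) {S : Set MultigraphClass} (hS : MeasurableSet S) :
    trimmedLaw lam t S = ∑' l, SpineList.prob l t * spineLaw lam l S := by
  rw [trimmedLaw, Measure.sum_apply _ hS]
  rfl

/-- Conditioning on the shapes of the trees of age at most `t`. -/
lemma measure_prod_trimmedSpine {Ω : Type*} [MeasurableSpace Ω] (ρ : Measure Ω) [SFinite ρ] (t : ℝ)
    {A : Set (((ℕ → ℝ) × (ℕ × Word → ℝ)) × Ω)} (hA : MeasurableSet A) {B : List BinTree → Set Ω}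
    (hAB : ∀ θ l, TrimmedSpine l θ.1 (fun i w => θ.2 (i, w)) t → (∀ i, 0 < θ.1 i) →
      (∀ x, 0 < θ.2 x) → ∀ ω, (θ, ω) ∈ A ↔ ω ∈ B l) :
    (treeMeasure.prod ρ) A = ∑' l, SpineList.prob l t * ρ (B l) := by
  have hfst := Measure.quasiMeasurePreserving_fst (μ := treeMeasure) (ν := ρ)
  rw [measure_eq_tsum_inter (E := fun l => {p : ((ℕ → ℝ) × (ℕ × Word → ℝ)) × Ω |
      TrimmedSpine l p.1.1 (fun i w => p.1.2 (i, w)) t})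
    (fun l => measurable_fst (measurableSet_trimmedSpine_tree l t))
    (fun l m p h h' => TrimmedSpine.unique h h') (hfst.ae (ae_exists_trimmedSpine t)) hA]
  refine tsum_congr fun l => ?_
  rw [← treeMeasure_trimmedSpine, ← Measure.prod_prod]
  refine measure_congr ?_
  filter_upwards [hfst.ae ae_treeMeasure_pos] with p hp
  refine propext ⟨fun h => ⟨h.2, (hAB p.1 l h.2 hp.1 hp.2 p.2).1 h.1⟩,
    fun h => ⟨(hAB p.1 l h.1 hp.1 hp.2 p.2).2 h.2, h.1⟩⟩

lemma map_spineClass_trimmedLeaves (lam : ℝ≥0) (t : ℝ) {S : Set MultigraphClass}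
    (hS : MeasurableSet S) :
    (treeMeasure.prod (spineField lam)) {p | spineClass (trimmedLeaves p.1 t) p.2 ∈ S} =
      trimmedLaw lam t S := by
  have hm : Measurable fun p : ((ℕ → ℝ) × (ℕ × Word → ℝ)) × (Sym2 TreeVertex → ℕ) =>
      spineClass (trimmedLeaves p.1 t) p.2 :=
    measurable_spineClass (fun q => measurable_fst (measurableSet_trimmedLeaves t q)) measurable_snd
  have hA : MeasurableSet {p : ((ℕ → ℝ) × (ℕ × Word → ℝ)) × (Sym2 TreeVertex → ℕ) |
      spineClass (trimmedLeaves p.1 t) p.2 ∈ S} := hm hS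
  rw [trimmedLaw_apply lam t hS, measure_prod_trimmedSpine _ t hA
    (B := fun l => {N | spineClass (levelLeaves l) N ∈ S})]
  · simp only [spineLaw_apply lam _ hS]
  · intro θ l h hs hc N
    simp only [Set.mem_ofPred_eq, h.trimmedLeaves_eq hs hc]

/-- Trimming at age `t` changes the component of the root. -/
def TrimmingChanges (t : ℝ) (p : ((ℕ → ℝ) × (ℕ × Word → ℝ)) × (Sym2 TreeVertex → ℕ)) : Prop :=
  (spineGraph (hangingLeaves p.1) p.2).component ≠ (spineGraph (trimmedLeaves p.1 t) p.2).component

lemma measurableSet_emptyCut_hangingLeaves (i : ℕ) : MeasurableSet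
    {p : ((ℕ → ℝ) × (ℕ × Word → ℝ)) × (Sym2 TreeVertex → ℕ) |
      EmptyCut (hangingLeaves p.1) p.2 i} := by
  have hG := measurableGraph_spineGraph (Ω := ((ℕ → ℝ) × (ℕ × Word → ℝ)) × (Sym2 TreeVertex → ℕ))
    (fun q => measurable_fst (measurableSet_hangingLeaves q)) measurable_snd
  have h : {p : ((ℕ → ℝ) × (ℕ × Word → ℝ)) × (Sym2 TreeVertex → ℕ) |
      EmptyCut (hangingLeaves p.1) p.2 i} = ⋂ x : TreeVertex, ⋂ y : TreeVertex,
        {p | ¬ (x.level ≤ i ∧ i < y.level)} ∪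
          {p | (spineGraph (hangingLeaves p.1) p.2).mult x y = 0} := by
    ext p
    simp only [Set.mem_ofPred_eq, Set.mem_iInter, Set.mem_union, ← imp_iff_not_or]
    constructor
    · rintro h x y ⟨hx, hy⟩
      by_contra hne
      obtain ⟨h1, h2, h3⟩ := spineGraph_mult_ne_zero hne
      exact h3 (h _ ⟨x, h1, y, h2, hx, hy, rfl⟩)
    · rintro h _ ⟨x, h1, y, h2, hx, hy, rfl⟩
      have hxy : x ≠ y := by
        rintro rfl
        omega
      have h3 := h x y ⟨hx, hy⟩
      have h4 : (spineGraph (hangingLeaves p.1) p.2).mult x y = p.2 s(x, y) := if_pos ⟨hxy, h1, h2⟩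
      exact h4 ▸ h3
  rw [h]
  exact MeasurableSet.iInter fun x => MeasurableSet.iInter fun y =>
    (MeasurableSet.const _).union (hG.mult x y (MeasurableSet.singleton 0))

/-- The bound is uniform in the leaf configuration, so it survives averaging over the random tree.
-/
lemma measure_not_emptyCut_hangingLeaves_le (lam : ℝ≥0) {q : ℝ≥0∞} {n : ℕ}
    (hq : ∀ c, KraftBound c → spineField lam {N | ∀ i < n, ¬ EmptyCut c N i} ≤ q) :
    (treeMeasure.prod (spineField lam))
      {p | ∀ i < n, ¬ EmptyCut (hangingLeaves p.1) p.2 i} ≤ q := by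
  have hm : MeasurableSet {p : ((ℕ → ℝ) × (ℕ × Word → ℝ)) × (Sym2 TreeVertex → ℕ) |
      ∀ i < n, ¬ EmptyCut (hangingLeaves p.1) p.2 i} := by
    have : {p : ((ℕ → ℝ) × (ℕ × Word → ℝ)) × (Sym2 TreeVertex → ℕ) |
        ∀ i < n, ¬ EmptyCut (hangingLeaves p.1) p.2 i} =
          ⋂ i ∈ Set.Iio n, {p | EmptyCut (hangingLeaves p.1) p.2 i}ᶜ := by
      ext p
      simp
    rw [this]
    exact MeasurableSet.biInter (Set.to_countable _) fun i _ =>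
      (measurableSet_emptyCut_hangingLeaves i).compl
  rw [Measure.prod_apply hm]
  calc _ ≤ ∫⁻ _, q ∂treeMeasure := by
        refine lintegral_mono_ae (ae_treeLevels_hangingLeaves.mono fun θ hθ => ?_)
        exact hq _ hθ.kraftBound
    _ = q := by simp

/-- If the age at level `n` is at most `t` and one of the first `n` cuts is empty, all trees below
that cut are kept, and what trimming removes lies beyond it. -/
lemma trimmingChanges_subset (t : ℝ) (n : ℕ) :
    {p | TrimmingChanges t p} ∩ {p | ∀ i, 0 < p.1.1 i} ⊆ {p | t < age p.1.1 n} ∪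
      {p | ∀ i < n, ¬ EmptyCut (hangingLeaves p.1) p.2 i} := by
  rintro p ⟨hp, hs⟩
  by_contra hnot
  simp only [Set.mem_union, Set.mem_ofPred_eq, not_or, not_lt, not_forall, not_not] at hnot
  obtain ⟨hn, i, hi, hcut⟩ := hnot
  refine hp (hcut.component_eq (fun q hq => hq.1) fun q hq hqi => ⟨hq, ?_⟩)
  exact (age_mono hs (hqi.trans hi).le).trans hn

lemma tendsto_treeMeasure_age (n : ℕ) :
    Tendsto (fun t : ℝ => treeMeasure {θ | t < age θ.1 n}) atTop (𝓝 0) := by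
  have h := tendsto_measure_iInter_atTop (μ := treeMeasure) (s := fun t : ℝ => {θ | t < age θ.1 n})
    (fun t => (measurableSet_lt measurable_const
      ((measurable_age n).comp measurable_fst)).nullMeasurableSet)
    (fun s t hst θ hθ => lt_of_le_of_lt hst hθ) ⟨0, measure_ne_top _ _⟩
  have h0 : ⋂ t : ℝ, {θ : (ℕ → ℝ) × (ℕ × Word → ℝ) | t < age θ.1 n} = ∅ := by
    refine Set.eq_empty_of_forall_notMem fun θ hθ => ?_
    exact lt_irrefl (age θ.1 n) (Set.mem_iInter.1 hθ (age θ.1 n))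
  rwa [h0, measure_empty] at h

/-- Choose `n` so that an empty cut below `n` is likely, then `t` so large that the age at level `n`
is likely to be below `t`. -/
lemma tendsto_measure_trimmingChanges (lam : ℝ≥0) :
    Tendsto (fun t : ℝ => (treeMeasure.prod (spineField lam)) {p | TrimmingChanges t p}) atTop
      (𝓝 0) := by
  obtain ⟨q, hq0, hq⟩ := exists_tendsto_measure_not_emptyCut lam
  rw [ENNReal.tendsto_nhds_zero]
  intro ε hε
  have hε2 : 0 < ε / 2 := ENNReal.half_pos hε.ne'
  obtain ⟨n, hn⟩ := ((ENNReal.tendsto_nhds_zero.1 hq0) _ hε2).exists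
  filter_upwards [(ENNReal.tendsto_nhds_zero.1 (tendsto_treeMeasure_age n)) _ hε2] with t ht
  have hfst := Measure.quasiMeasurePreserving_fst (μ := treeMeasure) (ν := spineField lam)
  have h1 : (treeMeasure.prod (spineField lam)) {p | TrimmingChanges t p} =
      (treeMeasure.prod (spineField lam)) ({p | TrimmingChanges t p} ∩ {p | ∀ i, 0 < p.1.1 i}) := by
    refine measure_congr ?_
    filter_upwards [hfst.ae ae_treeMeasure_pos] with p hp
    exact propext ⟨fun h => ⟨h, hp.1⟩, fun h => h.1⟩
  have h2 : (treeMeasure.prod (spineField lam)) {p | t < age p.1.1 n} =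
      treeMeasure {θ | t < age θ.1 n} := by
    have := measurePreserving_fst (μ := treeMeasure) (ν := spineField lam)
    exact this.measure_preimage (measurableSet_lt measurable_const
      ((measurable_age n).comp measurable_fst)).nullMeasurableSet
  rw [h1]
  calc _ ≤ (treeMeasure.prod (spineField lam)) {p | t < age p.1.1 n} +
        (treeMeasure.prod (spineField lam))
          {p | ∀ i < n, ¬ EmptyCut (hangingLeaves p.1) p.2 i} :=
        (measure_mono (trimmingChanges_subset t n)).trans (measure_union_le _ _)
    _ ≤ ε / 2 + ε / 2 := by
      rw [h2]
      exact add_le_add ht (measure_not_emptyCut_hangingLeaves_le lam fun c hc =>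
        (hq c hc n).trans hn)
    _ = ε := ENNReal.add_halves ε

/-! ### The limit law -/

lemma ae_finite_component_hangingLeaves (lam : ℝ≥0) :
    ∀ᵐ p ∂(treeMeasure.prod (spineField lam)),
      (spineGraph (hangingLeaves p.1) p.2).component.verts.Finite := by
  obtain ⟨q, hq0, hq⟩ := exists_tendsto_measure_not_emptyCut lam
  have h0 : (treeMeasure.prod (spineField lam))
      {p | ∀ i, ¬ EmptyCut (hangingLeaves p.1) p.2 i} = 0 := by
    refine le_antisymm (ge_of_tendsto' hq0 fun n => ?_) zero_le
    have hsub : {p : ((ℕ → ℝ) × (ℕ × Word → ℝ)) × (Sym2 TreeVertex → ℕ) |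
        ∀ i, ¬ EmptyCut (hangingLeaves p.1) p.2 i} ⊆
          {p | ∀ i < n, ¬ EmptyCut (hangingLeaves p.1) p.2 i} := fun p hp i _ => hp i
    exact (measure_mono hsub).trans
      (measure_not_emptyCut_hangingLeaves_le lam fun c hc => hq c hc n)
  have hfst := Measure.quasiMeasurePreserving_fst (μ := treeMeasure) (ν := spineField lam)
  filter_upwards [measure_eq_zero_iff_ae_notMem.1 h0, hfst.ae ae_treeLevels_hangingLeaves]
    with p hp hl
  simp only [not_forall, not_not] at hp
  obtain ⟨i, hi⟩ := hp
  exact hi.finite hl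

lemma measurableSet_setOf_isFinite : MeasurableSet {c : MultigraphClass | c.IsFinite} :=
  MultigraphClass.measurableSet_of_isFinite fun _ h => h

lemma ae_limitLaw_isFinite (lam : ℝ≥0) : ∀ᵐ c ∂(limitLaw lam), c.IsFinite := by
  rw [limitLaw_eq_map, ae_map_iff measurable_spineClass_hangingLeaves.aemeasurable
    measurableSet_setOf_isFinite]
  exact (ae_finite_component_hangingLeaves lam).mono fun p hp =>
    RootedMultigraph.isFinite_isoClass hp

lemma isFinite_spineClass_levelLeaves (l : List BinTree) (N : Sym2 TreeVertex → ℕ) :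
    (spineClass (levelLeaves l) N).IsFinite :=
  RootedMultigraph.isFinite_isoClass ((finite_spineVerts (levelLeaves_finite l)).subset
    fun _ hx => RootedMultigraph.Reachable.mem_verts hx)

/-- The trimmed and the full model are coupled through the same tree and the same edge field; their
laws differ by at most the probability that trimming changes the component. -/
lemma tendsto_trimmedLaw (lam : ℝ≥0) {S : Set MultigraphClass} (hS : MeasurableSet S) :
    Tendsto (fun t : ℝ => trimmedLaw lam t S) atTop (𝓝 (limitLaw lam S)) := by
  set P := treeMeasure.prod (spineField lam)
  have hlim : limitLaw lam S = P {p | spineClass (hangingLeaves p.1) p.2 ∈ S} := by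
    rw [limitLaw_eq_map, Measure.map_apply measurable_spineClass_hangingLeaves hS]
    rfl
  have h1 (t : ℝ) : trimmedLaw lam t S ≤ limitLaw lam S + P {p | TrimmingChanges t p} := by
    rw [hlim, ← map_spineClass_trimmedLeaves lam t hS]
    refine (measure_mono fun p hp => ?_).trans (measure_union_le _ _)
    by_cases h : TrimmingChanges t p
    · exact Or.inr h
    · refine Or.inl ?_
      rw [TrimmingChanges, not_not] at h
      simp only [spineClass, Set.mem_ofPred_eq, h] at hp ⊢
      exact hp
  have h2 (t : ℝ) : limitLaw lam S ≤ trimmedLaw lam t S + P {p | TrimmingChanges t p} := by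
    rw [hlim, ← map_spineClass_trimmedLeaves lam t hS]
    refine (measure_mono fun p hp => ?_).trans (measure_union_le _ _)
    by_cases h : TrimmingChanges t p
    · exact Or.inr h
    · refine Or.inl ?_
      rw [TrimmingChanges, not_not] at h
      simp only [spineClass, Set.mem_ofPred_eq, h] at hp ⊢
      exact hp
  have hfin : limitLaw lam S ≠ ∞ := by
    rw [hlim]; exact measure_ne_top _ _
  have h0 := tendsto_measure_trimmingChanges lam
  refine tendsto_of_tendsto_of_tendsto_of_le_of_le (g := fun t => limitLaw lam S -
    P {p | TrimmingChanges t p}) (h := fun t => limitLaw lam S + P {p | TrimmingChanges t p})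
    ?_ ?_ (fun t => tsub_le_iff_right.2 (h2 t)) h1
  · simpa using ENNReal.Tendsto.sub tendsto_const_nhds h0 (Or.inl hfin)
  · simpa using tendsto_const_nhds.add h0

/-! ### The degree of the root -/

lemma lintegral_poissonMeasure_id (r : ℝ≥0) : ∫⁻ n, (n : ℝ≥0∞) ∂(poissonMeasure r) = r := by
  have h := hasSum_one_poissonMeasure r
  rw [lintegral_countable']
  simp only [poissonMeasure_singleton]
  rw [tsum_eq_zero_add' ENNReal.summable]
  have hterm (n : ℕ) : ((n + 1 : ℕ) : ℝ≥0∞) *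
      ENNReal.ofReal (Real.exp (-r) * r ^ (n + 1) / (n + 1).factorial) =
      r * ENNReal.ofReal (Real.exp (-r) * r ^ n / n.factorial) := by
    rw [← ENNReal.ofReal_natCast, ← ENNReal.ofReal_coe_nnreal,
      ← ENNReal.ofReal_mul (by positivity), ← ENNReal.ofReal_mul (by positivity)]
    congr 1
    rw [Nat.factorial_succ]
    push_cast
    field_simp
    ring
  simp only [hterm]
  rw [ENNReal.tsum_mul_left, ← ENNReal.ofReal_tsum_of_nonneg (fun n => by positivity) h.summable,
    h.tsum_eq]
  simp

/-- The expected degree is the total rate from `v 0` across the cut at level `0`, and the upper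
weights above that cut add up to at most one. -/
lemma lintegral_rootDegree_spineGraph_le (lam : ℝ≥0) {c : Set (ℕ × Word)} (hc : KraftBound c) :
    ∫⁻ N, (spineGraph c N).rootDegree ∂(spineField lam) ≤ lam := by
  classical
  have hle (N : Sym2 TreeVertex → ℕ) : (spineGraph c N).rootDegree ≤
      ∑' y, {y | y ∈ spineVerts c ∧ 0 < y.level}.indicator
        (fun y => (N s(v 0, y) : ℝ≥0∞)) y := by
    refine ENNReal.tsum_le_tsum fun y => ?_
    by_cases hy : v 0 ≠ y ∧ v 0 ∈ spineVerts c ∧ y ∈ spineVerts c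
    · have hy' : y ∈ spineVerts c ∧ 0 < y.level := by
        refine ⟨hy.2.2, ?_⟩
        rcases hy.2.2 with h | ⟨p, -, rfl⟩
        · exact absurd h.symm hy.1
        · exact Nat.succ_pos _
      rw [Set.indicator_of_mem (by exact hy')]
      exact le_of_eq (congrArg _ (if_pos hy))
    · have h0 : (spineGraph c N).mult (spineGraph c N).root y = 0 := if_neg hy
      rw [h0]
      simp
  calc _ ≤ ∫⁻ N, ∑' y, {y | y ∈ spineVerts c ∧ 0 < y.level}.indicator
        (fun y => (N s(v 0, y) : ℝ≥0∞)) y ∂(spineField lam) := lintegral_mono hle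
    _ = ∑' y, {y | y ∈ spineVerts c ∧ 0 < y.level}.indicator
        (fun y => (spineRate lam s(v 0, y) : ℝ≥0∞)) y := by
      rw [lintegral_tsum]
      · refine tsum_congr fun y => ?_
        by_cases hy : y ∈ spineVerts c ∧ 0 < y.level
        · simp only [Set.indicator_of_mem (show y ∈ {y | y ∈ spineVerts c ∧ 0 < y.level} from hy)]
          rw [← lintegral_poissonMeasure_id]
          exact (measurePreserving_eval_infinitePi
            (fun e => poissonMeasure (spineRate lam e)) s(v 0, y)).lintegral_comp
              (f := fun n : ℕ => (n : ℝ≥0∞)) measurable_from_top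
        · simp only [Set.indicator_of_notMem
            (show y ∉ {y | y ∈ spineVerts c ∧ 0 < y.level} from hy), lintegral_zero]
      · intro y
        refine Measurable.aemeasurable ?_
        have hm : Measurable fun N : Sym2 TreeVertex → ℕ => (N s(v 0, y) : ℝ≥0∞) :=
          (measurable_from_top (f := fun n : ℕ => (n : ℝ≥0∞))).comp
            (measurable_pi_apply (X := fun _ => ℕ) s(v 0, y))
        by_cases hy : y ∈ spineVerts c ∧ 0 < y.level
        · simpa only [Set.indicator_of_mem
            (show y ∈ {y | y ∈ spineVerts c ∧ 0 < y.level} from hy)] using hm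
        · simpa only [Set.indicator_of_notMem
            (show y ∉ {y | y ∈ spineVerts c ∧ 0 < y.level} from hy)] using measurable_const
    _ ≤ ∑' y, lam * {y | y ∈ spineVerts c ∧ 0 < y.level}.indicator
        (fun y => (2⁻¹ : ℝ≥0∞) ^ y.level * y.weight) y := by
      refine ENNReal.tsum_le_tsum fun y => ?_
      by_cases hy : y ∈ spineVerts c ∧ 0 < y.level
      · rw [Set.indicator_of_mem (by exact hy), Set.indicator_of_mem (by exact hy)]
        have h := ENNReal.coe_le_coe.2 (spineRate_le lam (x := v 0) (Or.inl rfl) hy.1 hy.2)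
        simpa [level, weight, ENNReal.coe_pow, ENNReal.inv_pow] using h
      · rw [Set.indicator_of_notMem (by exact hy)]
        exact zero_le
    _ ≤ lam := by
      rw [ENNReal.tsum_mul_left]
      refine mul_le_of_le_one_right' ?_
      simpa using tsum_high_le hc 0

lemma lintegral_rootDegree_hangingLeaves_le (lam : ℝ≥0) :
    ∫⁻ p, (spineGraph (hangingLeaves p.1) p.2).rootDegree ∂(treeMeasure.prod (spineField lam)) ≤
      lam := by
  have hG := measurableGraph_spineGraph (Ω := ((ℕ → ℝ) × (ℕ × Word → ℝ)) × (Sym2 TreeVertex → ℕ))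
    (c := fun p => hangingLeaves p.1)
    (fun q => measurable_fst (measurableSet_hangingLeaves q)) measurable_snd
  rw [lintegral_prod _ hG.rootDegree.aemeasurable]
  calc _ ≤ ∫⁻ _, (lam : ℝ≥0∞) ∂treeMeasure := by
        refine lintegral_mono_ae (ae_treeLevels_hangingLeaves.mono fun θ hθ => ?_)
        exact lintegral_rootDegree_spineGraph_le lam hθ.kraftBound
    _ = lam := by simp

/-! ### The position of the descendants in the new spine tree -/

lemma initialWord_succ' (d : ℕ → Bool) (n : ℕ) :
    initialWord d (n + 1) = d 0 :: initialWord (fun n => d (n + 1)) n := by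
  simp [initialWord, List.range_succ_eq_map, Function.comp_def]

lemma initialWord_length (d : ℕ → Bool) (n : ℕ) : (initialWord d n).length = n := by
  simp [initialWord]

/-- The vertex of the spine tree that represents the descendant `u` of a vertex, when the spine
follows `d` and the root has split `L` times. -/
def pathVertex : ℕ → (ℕ → Bool) → Word → TreeVertex
  | 0, _, _ => v 0
  | _ + 1, _, [] => v 0
  | L + 1, d, b :: u => if b = d 0 then pathVertex L (fun n => d (n + 1)) u else h L u

/-- The word `u` leaves the path `d` before the length `L`, or is its initial word of
length `L`. -/
def Fits : ℕ → (ℕ → Bool) → Word → Prop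
  | 0, _, u => u = []
  | _ + 1, _, [] => False
  | L + 1, d, b :: u => b = d 0 → Fits L (fun n => d (n + 1)) u

lemma Fits.pathVertex_eq {L : ℕ} {d : ℕ → Bool} {u : Word} (hu : Fits L d u) :
    (pathVertex L d u = v 0 ∧ u.length = L) ∨
      ∃ j r, pathVertex L d u = h j r ∧ j < L ∧ u.length + j = L + r.length := by
  induction L generalizing d u with
  | zero =>
    obtain rfl : u = [] := hu
    exact Or.inl ⟨rfl, rfl⟩
  | succ L ih =>
    cases u with
    | nil => exact hu.elim
    | cons b u =>
      by_cases hb : b = d 0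
      · simp only [pathVertex, if_pos hb, List.length_cons]
        rcases ih (hu hb) with ⟨h1, h2⟩ | ⟨j, r, h1, h2, h3⟩
        · exact Or.inl ⟨h1, by omega⟩
        · exact Or.inr ⟨j, r, h1, by omega, by omega⟩
      · exact Or.inr ⟨L, u, if_neg hb, by omega, by simp; omega⟩

lemma Fits.spineDist_h {L : ℕ} {d : ℕ → Bool} {u : Word} (hu : Fits L d u) (k : ℕ) (w : Word) :
    spineDist (pathVertex L d u) (h (k + L) w) = u.length + k + w.length + 2 := by
  rcases hu.pathVertex_eq with ⟨h1, h2⟩ | ⟨j, r, h1, h2, h3⟩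
  · rw [h1]
    simp only [spineDist]
    omega
  · rw [h1]
    simp only [spineDist]
    rw [if_neg (by omega)]
    omega

/-- The new part of the spine tree is the tree of descendants of `v 0` redrawn along the path of the
root, so leaf distances are those in the binary tree. -/
lemma Fits.spineDist {L : ℕ} {d : ℕ → Bool} {u w : Word} (hu : Fits L d u) (hw : Fits L d w) :
    spineDist (pathVertex L d u) (pathVertex L d w) = wordDist u w := by
  induction L generalizing d u w with
  | zero =>
    obtain rfl : u = [] := hu
    obtain rfl : w = [] := hw
    rfl
  | succ L ih =>
    cases u with
    | nil => exact hu.elim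
    | cons b u =>
      cases w with
      | nil => exact hw.elim
      | cons b' w =>
        simp only [pathVertex, wordDist]
        by_cases hb : b = d 0 <;> by_cases hb' : b' = d 0
        · rw [if_pos hb, if_pos hb', if_pos (hb.trans hb'.symm)]
          exact ih (hu hb) (hw hb')
        · rw [if_pos hb, if_neg hb', if_neg (fun h => hb' (h.symm.trans hb))]
          simpa using (hu hb).spineDist_h 0 w
        · rw [if_neg hb, if_pos hb', if_neg (fun h => hb (h.trans hb')), spineDist_comm,
            add_comm u.length]
          simpa using (hw hb').spineDist_h 0 u
        · have : b = b' := by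
            cases b <;> cases b' <;> cases hd : d 0 <;> simp_all
          rw [if_neg hb, if_neg hb', if_pos this]
          simp [TreeVertex.spineDist]

/-- Vertices of low level come from words that follow the path for a long time. -/
lemma Fits.prefix {L : ℕ} {d : ℕ → Bool} {u : Word} (hu : Fits L d u) {n : ℕ}
    (hn : (pathVertex L d u).level + n ≤ L) : initialWord d n <+: u := by
  induction n generalizing L d u with
  | zero => simp [initialWord]
  | succ n ih =>
    cases L with
    | zero => omega
    | succ L =>
      cases u with
      | nil => exact hu.elim
      | cons b u =>
        by_cases hb : b = d 0
        · simp only [pathVertex, if_pos hb] at hn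
          rw [initialWord_succ', hb, List.cons_prefix_cons]
          exact ⟨rfl, ih (hu hb) (by omega)⟩
        · simp only [pathVertex, if_neg hb, level] at hn
          omega

/-- The vertex of the new spine tree that represents the descendant `u` of the vertex `x` of the
old one. -/
def descend (L : ℕ) (d : ℕ → Bool) : TreeVertex → Word → TreeVertex
  | v _, u => pathVertex L d u
  | h k w, u => h (k + L) (w ++ u)

lemma wordDist_append_left (p u w : Word) : wordDist (p ++ u) (p ++ w) = wordDist u w := by
  induction p with
  | nil => rfl
  | cons b p ih => simpa [wordDist] using ih

/-- Distinct leaves have already branched apart, so letters appended below them only add to the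
distance. -/
lemma BinTree.wordDist_append {x : BinTree} {w w' : Word} (hw : w ∈ x.leaves) (hw' : w' ∈ x.leaves)
    (hne : w ≠ w') (u u' : Word) :
    wordDist (w ++ u) (w' ++ u') = wordDist w w' + u.length + u'.length := by
  induction x generalizing w w' with
  | leaf =>
    obtain rfl : w = [] := hw
    obtain rfl : w' = [] := hw'
    exact absurd rfl hne
  | node l r hl hr =>
    cases w with
    | nil => simp at hw
    | cons b w =>
      cases w' with
      | nil => simp at hw'
      | cons b' w' =>
        rw [cons_mem_leaves_node] at hw hw'
        by_cases hb : b = b'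
        · subst hb
          have hne' : w ≠ w' := fun h => hne (by rw [h])
          cases b
          · simpa [wordDist] using hl hw hw' hne'
          · simpa [wordDist] using hr hw hw' hne'
        · simp [wordDist, hb]
          omega

-- Each split below one of two distinct old leaves lengthens their distance by one, exactly matching
-- the halving of the chance that an edge follows. Descendants of one leaf keep their distance in
-- its own tree.
open scoped Classical in
lemma spineDist_descend {hs : List BinTree} {L : ℕ} {d : ℕ → Bool} {x y : TreeVertex} {u w : Word}
    (hx : x ∈ spineVerts (levelLeaves hs)) (hy : y ∈ spineVerts (levelLeaves hs))
    (hu : x = v 0 → Fits L d u) (hw : y = v 0 → Fits L d w) :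
    spineDist (descend L d x u) (descend L d y w) =
      if x = y then wordDist u w else spineDist x y + u.length + w.length := by
  rcases hx with rfl | ⟨⟨k, a⟩, hp, rfl⟩ <;> rcases hy with rfl | ⟨⟨k', a'⟩, hp', rfl⟩
  · rw [if_pos rfl]
    exact (hu rfl).spineDist (hw rfl)
  · rw [if_neg (by rintro ⟨⟩)]
    simp only [descend]
    rw [(hu rfl).spineDist_h]
    simp only [spineDist, List.length_append]
    omega
  · rw [if_neg (by rintro ⟨⟩)]
    simp only [descend]
    rw [spineDist_comm, (hw rfl).spineDist_h]
    simp only [spineDist, List.length_append]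
    omega
  · by_cases hk : k = k'
    · subst hk
      by_cases ha : a = a'
      · subst ha
        simp [descend, spineDist, wordDist_append_left]
      · rw [if_neg (by simpa using ha)]
        simp only [descend, spineDist, if_true]
        rcases levelLeaves_level hs k with ⟨x, hx⟩ | hx
        · exact BinTree.wordDist_append ((hx a).1 hp) ((hx a').1 hp') ha u w
        · exact absurd hp (hx a)
    · rw [if_neg (by simp [hk])]
      simp only [descend, spineDist, List.length_append]
      rw [if_neg (by omega), if_neg hk]
      omega

lemma eq_of_wordDist_eq_zero {u w : Word} (h : wordDist u w = 0) : u = w := by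
  induction u generalizing w with
  | nil => simpa [eq_comm] using h
  | cons b u ih =>
    cases w with
    | nil => simp at h
    | cons c w =>
      by_cases hbc : b = c
      · rw [hbc, ih (by simpa [wordDist, hbc] using h)]
      · simp [wordDist, hbc] at h

lemma TreeVertex.eq_of_spineDist_eq_zero {x y : TreeVertex} (hxy : spineDist x y = 0) : x = y := by
  cases x <;> cases y <;> simp only [spineDist] at hxy
  · rename_i m n
    rw [show m = n by omega]
  · omega
  · omega
  · rename_i i u j w
    by_cases hij : i = j
    · rw [if_pos hij] at hxy
      rw [hij, eq_of_wordDist_eq_zero hxy]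
    · rw [if_neg hij] at hxy
      omega

lemma descend_injective {hs : List BinTree} {L : ℕ} {d : ℕ → Bool} {x y : TreeVertex} {u w : Word}
    (hx : x ∈ spineVerts (levelLeaves hs)) (hy : y ∈ spineVerts (levelLeaves hs))
    (hu : x = v 0 → Fits L d u) (hw : y = v 0 → Fits L d w)
    (heq : descend L d x u = descend L d y w) : x = y ∧ u = w := by
  classical
  have h0 := spineDist_descend hx hy hu hw
  rw [heq, spineDist_self] at h0
  by_cases hxy : x = y
  · rw [if_pos hxy] at h0
    exact ⟨hxy, eq_of_wordDist_eq_zero h0.symm⟩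
  · rw [if_neg hxy] at h0
    exact absurd (eq_of_spineDist_eq_zero (by omega)) hxy

lemma Marks.wordAlive {l : List BinTree} {c : Word → ℝ} {d : ℕ → Bool} {t : ℝ}
    (hl : Marks l c d t) (hc : ∀ w, 0 < c w) (ht : 0 ≤ t) {u : Word} (hu : WordAlive c t u) :
    Fits l.length d u ∧ pathVertex l.length d u ∈ spineVerts (levelLeaves l) := by
  induction l generalizing c d t u with
  | nil =>
    have hg : BinTree.leaf.Grows c t := hl
    exact ⟨(hg.wordAlive_iff hc ht u).1 hu, Or.inl rfl⟩
  | cons x l ih =>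
    cases u with
    | nil => exact absurd ((wordAlive_nil c t).1 hu).2 (not_lt.2 hl.1)
    | cons b u =>
      rw [wordAlive_cons] at hu
      by_cases hb : b = d 0
      · subst hb
        obtain ⟨h1, h2⟩ := ih hl.2.2 (fun w => hc _) (sub_nonneg.2 hl.1) hu
        refine ⟨fun _ => h1, ?_⟩
        simp only [List.length_cons, pathVertex, if_true]
        exact spineVerts_mono (fun p hp => Or.inr hp) h2
      · have hb' : b = !d 0 := by cases b <;> cases hd : d 0 <;> simp_all
        refine ⟨fun h => absurd h hb, ?_⟩
        simp only [List.length_cons, pathVertex, if_neg hb]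
        rw [hb'] at hu
        exact Or.inr ⟨(l.length, u), Or.inl ⟨rfl,
          (hl.2.1.wordAlive_iff (fun w => hc _) (sub_nonneg.2 hl.1) u).1 hu⟩, rfl⟩

lemma Marks.exists_wordAlive {l : List BinTree} {c : Word → ℝ} {d : ℕ → Bool} {t : ℝ}
    (hl : Marks l c d t) (hc : ∀ w, 0 < c w) (ht : 0 ≤ t) {y : TreeVertex}
    (hy : y ∈ spineVerts (levelLeaves l)) : ∃ u, WordAlive c t u ∧ pathVertex l.length d u = y := by
  induction l generalizing c d t y with
  | nil =>
    rcases hy with rfl | ⟨p, hp, -⟩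
    · exact ⟨[], (wordAlive_nil c t).2 ⟨ht, hl⟩, rfl⟩
    · exact hp.elim
  | cons x l ih =>
    have hold (hy : y ∈ spineVerts (levelLeaves l)) :
        ∃ u, WordAlive c t u ∧ pathVertex (x :: l).length d u = y := by
      obtain ⟨u, hu, huy⟩ := ih hl.2.2 (fun w => hc _) (sub_nonneg.2 hl.1) hy
      exact ⟨d 0 :: u, (wordAlive_cons c t _ u).2 hu, by simpa [pathVertex] using huy⟩
    rcases hy with rfl | ⟨⟨i, w⟩, hp | hp, rfl⟩
    · exact hold (Or.inl rfl)
    · obtain ⟨h1, h2⟩ : i = l.length ∧ w ∈ x.leaves := hp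
      subst h1
      refine ⟨(!d 0) :: w, (wordAlive_cons c t _ w).2
        ((hl.2.1.wordAlive_iff (fun w => hc _) (sub_nonneg.2 hl.1) w).2 h2), ?_⟩
      simp [pathVertex]
    · exact hold (Or.inr ⟨_, hp, rfl⟩)

lemma Marks.initialWord {l : List BinTree} {c : Word → ℝ} {d : ℕ → Bool} {t : ℝ}
    (hl : Marks l c d t) (hc : ∀ w, 0 < c w) (ht : 0 ≤ t) :
    WordAlive c t (initialWord d l.length) ∧
      pathVertex l.length d (initialWord d l.length) = v 0 := by
  induction l generalizing c d t with
  | nil => exact ⟨(wordAlive_nil c t).2 ⟨ht, hl⟩, rfl⟩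
  | cons x l ih =>
    obtain ⟨h1, h2⟩ := ih hl.2.2 (fun w => hc _) (sub_nonneg.2 hl.1)
    rw [List.length_cons, initialWord_succ', wordAlive_cons]
    exact ⟨h1, by simpa [pathVertex] using h2⟩

lemma splitTime_initialWord_mono {clock : ℕ × Word → ℝ} (hc : ∀ x, 0 < clock x) (a : ℕ)
    (d : ℕ → Bool) {m n : ℕ} (hmn : m < n) :
    splitTime clock a (initialWord d m) ≤ birthTime clock a (initialWord d n) := by
  induction n with
  | zero => omega
  | succ n ih =>
    rw [initialWord_succ, birthTime_snoc]
    rcases Nat.lt_succ_iff_lt_or_eq.1 hmn with hmn' | rfl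
    · exact (ih hmn').trans (le_add_of_nonneg_right (hc _).le)
    · exact le_rfl

/-- Earlier vertices on the path of the root have all split by the time the living one is born; this
identifies the infimum defining `rootAt`. -/
lemma sInf_splitTime {clock : ℕ × Word → ℝ} (hc : ∀ x, 0 < clock x) {a : ℕ} {d : ℕ → Bool} {t : ℝ}
    {L : ℕ} (hL : Alive clock t (a, initialWord d L)) :
    sInf {n : ℕ | t < splitTime clock a (initialWord d n)} = L := by
  refine le_antisymm (Nat.sInf_le hL.2) ?_
  refine le_csInf ⟨L, hL.2⟩ fun n hn => ?_
  by_contra hlt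
  exact absurd ((splitTime_initialWord_mono hc a d (not_le.1 hlt)).trans hL.1) (not_le.2 hn)

/-- The new list consists of the grown old trees followed by the list `M` produced by `v 0`. Levels
count from the end, so old levels are shifted by `M.length` and the lower ones are those of `M`. -/
lemma SpineGrows.exists_marks {hs l : List BinTree} {C : TreeVertex → Word → ℝ} {d : ℕ → Bool}
    {t : ℝ} (hl : SpineGrows hs l C d t) (hC : ∀ x w, 0 < C x w) (ht : 0 ≤ t) :
    ∃ M, Marks M (C (v 0)) d t ∧ l.length = hs.length + M.length ∧
      (∀ k w, (k, w) ∈ levelLeaves M ↔ (k, w) ∈ levelLeaves l ∧ k < M.length) ∧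
      ∀ k w, (k + M.length, w) ∈ levelLeaves l ↔
        ∃ a u, (k, a) ∈ levelLeaves hs ∧ WordAlive (C (h k a)) t u ∧ w = a ++ u := by
  induction hs generalizing l with
  | nil =>
    refine ⟨l, hl, by simp, fun k w => ⟨fun hw => ⟨hw, lt_length_of_mem_levelLeaves hw⟩,
      fun hw => hw.1⟩, fun k w => ⟨fun hw => ?_, ?_⟩⟩
    · have := lt_length_of_mem_levelLeaves hw
      omega
    · rintro ⟨a, u, h, -⟩
      exact h.elim
  | cons x hs ih =>
    cases l with
    | nil => exact hl.elim
    | cons y m =>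
      obtain ⟨hg, hm⟩ := hl
      obtain ⟨M, h1, h2, h3, h4⟩ := ih hm
      refine ⟨M, h1, by simp [h2]; omega, fun k w => ?_, fun k w => ?_⟩
      · rw [h3, mem_levelLeaves_cons]
        constructor
        · exact fun hw => ⟨Or.inr hw.1, hw.2⟩
        · rintro ⟨hw | hw, hk⟩
          · omega
          · exact ⟨hw, hk⟩
      · rw [mem_levelLeaves_cons, h4]
        simp only [mem_levelLeaves_cons]
        constructor
        · rintro (⟨hk, hw⟩ | ⟨a, u, ha, hu, hw⟩)
          · obtain ⟨a, ha, u, hu, hw⟩ := (hg.mem_leaves_iff (fun _ _ => hC _ _) ht w).1 hw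
            obtain rfl : k = hs.length := by omega
            exact ⟨a, u, Or.inl ⟨rfl, ha⟩, hu, hw⟩
          · exact ⟨a, u, Or.inr ha, hu, hw⟩
        · rintro ⟨a, u, ⟨rfl, ha⟩ | ha, hu, hw⟩
          · exact Or.inl ⟨by omega,
              (hg.mem_leaves_iff (fun _ _ => hC _ _) ht w).2 ⟨a, ha, u, hu, hw⟩⟩
          · exact Or.inr ⟨a, u, ha, hu, hw⟩

/-- The living descendants correspond to the leaves of the new spine tree. -/
structure Descends (hs l : List BinTree) (C : TreeVertex → Word → ℝ) (d : ℕ → Bool) (t : ℝ)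
    (L : ℕ) : Prop where
  length_eq : l.length = hs.length + L
  mem : ∀ x ∈ spineVerts (levelLeaves hs), ∀ u, WordAlive (C x) t u →
    descend L d x u ∈ spineVerts (levelLeaves l)
  fits : ∀ u, WordAlive (C (v 0)) t u → Fits L d u
  surj : ∀ y ∈ spineVerts (levelLeaves l), ∃ x ∈ spineVerts (levelLeaves hs), ∃ u,
    WordAlive (C x) t u ∧ descend L d x u = y
  root : WordAlive (C (v 0)) t (initialWord d L)
  root_eq : descend L d (v 0) (initialWord d L) = v 0

lemma SpineGrows.descends {hs l : List BinTree} {C : TreeVertex → Word → ℝ} {d : ℕ → Bool}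
    {t : ℝ} (hl : SpineGrows hs l C d t) (hC : ∀ x w, 0 < C x w) (ht : 0 ≤ t) :
    ∃ L, Descends hs l C d t L := by
  obtain ⟨M, h1, h2, h3, h4⟩ := hl.exists_marks hC ht
  have hsub : levelLeaves M ⊆ levelLeaves l := fun ⟨k, w⟩ hp => ((h3 k w).1 hp).1
  refine ⟨M.length, h2, ?_, fun u hu => (h1.wordAlive (hC _) ht hu).1, ?_,
    (h1.initialWord (hC _) ht).1, (h1.initialWord (hC _) ht).2⟩
  · rintro x (rfl | ⟨⟨k, a⟩, hp, rfl⟩) u hu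
    · exact spineVerts_mono hsub (h1.wordAlive (hC _) ht hu).2
    · exact Or.inr ⟨(k + M.length, a ++ u), (h4 k _).2 ⟨a, u, hp, hu, rfl⟩, rfl⟩
  · rintro y (rfl | ⟨⟨k, w⟩, hp, rfl⟩)
    · exact ⟨v 0, Or.inl rfl, _, (h1.initialWord (hC _) ht).1, (h1.initialWord (hC _) ht).2⟩
    · by_cases hk : k < M.length
      · obtain ⟨u, hu, huy⟩ := h1.exists_wordAlive (hC _) ht (y := h k w)
          (Or.inr ⟨(k, w), (h3 k w).2 ⟨hp, hk⟩, rfl⟩)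
        exact ⟨v 0, Or.inl rfl, u, hu, huy⟩
      · obtain ⟨j, rfl⟩ := Nat.exists_eq_add_of_le' (not_lt.1 hk)
        obtain ⟨a, u, ha, hu, rfl⟩ := (h4 j w).1 hp
        exact ⟨h j a, Or.inr ⟨(j, a), ha, rfl⟩, u, hu, rfl⟩

/-! ### Products of product measures -/

lemma map_prodMk_infinitePi {ι X Y : Type*} [MeasurableSpace X] [MeasurableSpace Y]
    (μ : ι → Measure X) (ν : ι → Measure Y) [∀ i, IsProbabilityMeasure (μ i)]
    [∀ i, IsProbabilityMeasure (ν i)] :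
    ((Measure.infinitePi μ).prod (Measure.infinitePi ν)).map (fun p i => (p.1 i, p.2 i)) =
      Measure.infinitePi fun i => (μ i).prod (ν i) := by
  refine Measure.eq_infinitePi _ fun s t ht => ?_
  have hm : Measurable fun (p : (ι → X) × (ι → Y)) (i : ι) => (p.1 i, p.2 i) := by fun_prop
  have hs : MeasurableSet (Set.pi (s : Set ι) t) := .pi s.countable_toSet fun _ _ => ht _
  rw [Measure.map_apply hm hs, Measure.prod_apply (hm hs)]
  have h1 (f : ι → X) : (Measure.infinitePi ν) (Prod.mk f ⁻¹'
      ((fun (p : (ι → X) × (ι → Y)) (i : ι) => (p.1 i, p.2 i)) ⁻¹' Set.pi s t)) =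
        ∏ i ∈ s, ν i (Prod.mk (f i) ⁻¹' t i) := by
    rw [← Measure.infinitePi_pi ν fun i _ => measurable_prodMk_left (ht i)]
    rfl
  simp only [h1]
  have hmeas (i : ι) : Measurable fun x => ν i (Prod.mk x ⁻¹' t i) :=
    measurable_measure_prodMk_left (ht i)
  have hind : iIndepFun (fun i (f : ι → X) => ν i (Prod.mk (f i) ⁻¹' t i))
      (Measure.infinitePi μ) :=
    iIndepFun_infinitePi (X := fun i x => ν i (Prod.mk x ⁻¹' t i)) fun i => hmeas i
  rw [lintegral_prod_eq_prod_lintegral_of_indepFun s _ hind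
    fun i => (hmeas i).comp (measurable_pi_apply i)]
  refine Finset.prod_congr rfl fun i _ => ?_
  rw [Measure.prod_apply (ht i)]
  exact (measurePreserving_eval_infinitePi μ i).lintegral_comp (hmeas i)

/-! ### The sources of edges -/

/-- Pairs of initial vertices, and splits: each of them provides a Poisson number of edges. -/
abbrev Source : Type := {p : ℕ × ℕ // p.1 < p.2} ⊕ (ℕ × Word)

namespace Source

/-- The ends of the edges of a source. -/
def walker : Source → ℕ → Bool → Walker
  | .inl p, k, false => .old p.1.1 p.1.2 k
  | .inl p, k, true => .old p.1.2 p.1.1 k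
  | .inr p, k, b => .new p.1 p.2 k b

/-- Injectivity makes the walks of different ends independent. Ordering the two vertices of an old
pair prevents its edges from being counted twice. -/
lemma walker_injective :
    Function.Injective fun q : (Source × ℕ) × Bool => q.1.1.walker q.1.2 q.2 := by
  rintro ⟨⟨⟨⟨a, b⟩, hab⟩ | ⟨a, p⟩, k⟩, _ | _⟩ ⟨⟨⟨⟨a', b'⟩, hab'⟩ | ⟨a', p'⟩, k'⟩, _ | _⟩ h <;>
    simp only [walker, Walker.old.injEq, Walker.new.injEq, reduceCtorEq] at h <;>
    simp_all <;> omega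

/-- The number of edges of each source, and the walks of their ends. -/
def items (e : TreeVertex ≃ ℕ)
    (q : (Sym2 TreeVertex → ℕ) × (ℕ × Word → ℕ) × (Walker → ℕ → Bool)) (σ : Source) :
    ℕ × (ℕ → Bool → ℕ → Bool) :=
  (Sum.elim (fun p : {p : ℕ × ℕ // p.1 < p.2} => q.1 s(e.symm p.1.1, e.symm p.1.2)) q.2.1 σ,
    fun k b => q.2.2 (σ.walker k b))

noncomputable def rate (lam : ℝ≥0) (e : TreeVertex ≃ ℕ) : Source → ℝ≥0 :=
  Sum.elim (fun p => spineRate lam s(e.symm p.1.1, e.symm p.1.2)) fun _ => lam / 2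

end Source

/-- The law of the walks of the two ends of an edge. -/
noncomputable def endMeasure : Measure (Bool → ℕ → Bool) := Measure.infinitePi fun _ => coinMeasure

instance : IsProbabilityMeasure endMeasure := by unfold endMeasure; infer_instance

/-- The law of the initial edge numbers, of the numbers of new edges and of the walks. -/
noncomputable def edgeNoise (lam : ℝ≥0) :
    Measure ((Sym2 TreeVertex → ℕ) × (ℕ × Word → ℕ) × (Walker → ℕ → Bool)) :=
  (spineField lam).prod ((Measure.infinitePi fun _ : ℕ × Word => poissonMeasure (lam / 2)).prod
    (Measure.infinitePi fun _ : Walker => coinMeasure))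

instance (lam : ℝ≥0) : IsProbabilityMeasure (edgeNoise lam) := by
  unfold edgeNoise; infer_instance

/-- Old pairs and splits become, on an equal footing, independent sources of Poisson items marked by
their two walks; this is the setting of the thinning theorem. -/
lemma measurePreserving_items (lam : ℝ≥0) (e : TreeVertex ≃ ℕ) :
    MeasurePreserving (Source.items e) (edgeNoise lam)
      (Measure.infinitePi fun σ => markedPoisson (Source.rate lam e σ) endMeasure) := by
  have hinj : Function.Injective fun p : {p : ℕ × ℕ // p.1 < p.2} =>
      s(e.symm p.1.1, e.symm p.1.2) := by
    rintro ⟨⟨a, b⟩, hab⟩ ⟨⟨a', b'⟩, hab'⟩ h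
    simp only [Sym2.eq_iff, EmbeddingLike.apply_eq_iff_eq] at h
    simp only [Subtype.mk.injEq, Prod.mk.injEq]
    simp only at hab hab'
    omega
  have hN1 : MeasurePreserving (fun (N : Sym2 TreeVertex → ℕ) (p : {p : ℕ × ℕ // p.1 < p.2}) =>
      N s(e.symm p.1.1, e.symm p.1.2)) (spineField lam) (Measure.infinitePi fun p =>
        poissonMeasure (spineRate lam s(e.symm p.1.1, e.symm p.1.2))) :=
    ⟨by fun_prop, Measure.map_infinitePi_infinitePi_of_inj hinj⟩
  have hrate : (Sum.elim (fun p : {p : ℕ × ℕ // p.1 < p.2} =>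
      poissonMeasure (spineRate lam s(e.symm p.1.1, e.symm p.1.2)))
        fun _ : ℕ × Word => poissonMeasure (lam / 2)) =
      fun σ : Source => poissonMeasure (Source.rate lam e σ) := by
    funext σ
    rcases σ with p | p <;> rfl
  have hmelim : Measurable fun p : ({p : ℕ × ℕ // p.1 < p.2} → ℕ) × (ℕ × Word → ℕ) =>
      (Sum.elim p.1 p.2 : Source → ℕ) := by
    refine measurable_pi_lambda _ ?_
    rintro (a | b)
    · exact (measurable_pi_apply a).comp measurable_fst
    · exact (measurable_pi_apply b).comp measurable_snd
  have hN2 : MeasurePreserving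
      (fun p : ({p : ℕ × ℕ // p.1 < p.2} → ℕ) × (ℕ × Word → ℕ) =>
        (Sum.elim p.1 p.2 : Source → ℕ))
      ((Measure.infinitePi fun p : {p : ℕ × ℕ // p.1 < p.2} =>
        poissonMeasure (spineRate lam s(e.symm p.1.1, e.symm p.1.2))).prod
        (Measure.infinitePi fun _ : ℕ × Word => poissonMeasure (lam / 2)))
      (Measure.infinitePi fun σ => poissonMeasure (Source.rate lam e σ)) := by
    refine ⟨hmelim, ?_⟩
    rw [map_sumElim_infinitePi]
    congr 1
  have hN := hN2.comp (hN1.prod (MeasurePreserving.id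
    (Measure.infinitePi fun _ : ℕ × Word => poissonMeasure (lam / 2))))
  have hW1 : MeasurePreserving (fun (W : Walker → ℕ → Bool) (q : (Source × ℕ) × Bool) =>
      W (q.1.1.walker q.1.2 q.2)) (Measure.infinitePi fun _ : Walker => coinMeasure)
      (Measure.infinitePi fun _ : (Source × ℕ) × Bool => coinMeasure) :=
    ⟨by fun_prop, Measure.map_infinitePi_infinitePi_of_inj Source.walker_injective⟩
  have hW2 : MeasurePreserving (MeasurableEquiv.curry (Source × ℕ) Bool (ℕ → Bool))
      (Measure.infinitePi fun _ : (Source × ℕ) × Bool => coinMeasure)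
      (Measure.infinitePi fun _ : Source × ℕ => endMeasure) :=
    ⟨MeasurableEquiv.measurable _,
      Measure.infinitePi_map_curry fun (_ : Source × ℕ) (_ : Bool) => coinMeasure⟩
  have hW3 : MeasurePreserving (MeasurableEquiv.curry Source ℕ (Bool → ℕ → Bool))
      (Measure.infinitePi fun _ : Source × ℕ => endMeasure)
      (Measure.infinitePi fun _ : Source => Measure.infinitePi fun _ : ℕ => endMeasure) :=
    ⟨MeasurableEquiv.measurable _,
      Measure.infinitePi_map_curry fun (_ : Source) (_ : ℕ) => endMeasure⟩
  have hW := hW3.comp (hW2.comp hW1)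
  have hpair : MeasurePreserving
      (fun (p : (Source → ℕ) × (Source → ℕ → Bool → ℕ → Bool)) (σ : Source) => (p.1 σ, p.2 σ))
      ((Measure.infinitePi fun σ => poissonMeasure (Source.rate lam e σ)).prod
        (Measure.infinitePi fun _ : Source => Measure.infinitePi fun _ : ℕ => endMeasure))
      (Measure.infinitePi fun σ => markedPoisson (Source.rate lam e σ) endMeasure) :=
    ⟨by fun_prop, map_prodMk_infinitePi _ _⟩
  have hassoc := (measurePreserving_prodAssoc (spineField lam)
    (Measure.infinitePi fun _ : ℕ × Word => poissonMeasure (lam / 2))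
    (Measure.infinitePi fun _ : Walker => coinMeasure)).symm
  exact hpair.comp ((hN.prod hW).comp hassoc)

/-! ### Sets of end pairs -/

/-- The two ends follow the words `u` and `w`. -/
def ends (u w : Word) : Set (Bool → ℕ → Bool) :=
  {ξ | initialWord (ξ false) u.length = u ∧ initialWord (ξ true) w.length = w}

lemma measurableSet_ends (u w : Word) : MeasurableSet (ends u w) :=
  ((measurableSet_initialWord _ _).preimage (measurable_pi_apply false)).inter
    ((measurableSet_initialWord _ _).preimage (measurable_pi_apply true))

lemma coinMeasure_initialWord (u : Word) :
    coinMeasure {c | initialWord c u.length = u} = (2⁻¹ : ℝ≥0∞) ^ u.length := by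
  have h : {c : ℕ → Bool | initialWord c u.length = u} =
      Set.pi (Finset.range u.length : Set ℕ) fun i => {u.getD i false} := by
    ext c
    simp only [Set.mem_ofPred_eq, Set.mem_pi, Finset.mem_coe, Finset.mem_range,
      Set.mem_singleton_iff]
    constructor
    · intro h i hi
      conv_rhs => rw [← h]
      simp [initialWord, hi]
    · intro h
      refine List.ext_getElem (initialWord_length _ _) fun i h1 h2 => ?_
      have := h i h2
      simpa [initialWord, h2] using this
  rw [h, coinMeasure, Measure.infinitePi_pi _ fun _ _ => MeasurableSet.singleton _]
  simp

lemma endMeasure_ends (u w : Word) :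
    endMeasure (ends u w) = (2⁻¹ : ℝ≥0∞) ^ u.length * 2⁻¹ ^ w.length := by
  have h : ends u w = Set.pi ((Finset.univ : Finset Bool) : Set Bool) fun b =>
      cond b {c | initialWord c w.length = w} {c | initialWord c u.length = u} := by
    ext ξ
    simp [ends, and_comm]
  rw [h, endMeasure, Measure.infinitePi_pi]
  · simp [coinMeasure_initialWord, mul_comm]
  · rintro (_ | _) -
    · exact measurableSet_initialWord _ _
    · exact measurableSet_initialWord _ _

lemma ncard_eq_markCount {X : Type*} (m : Set X) (z : ℕ × (ℕ → X)) :
    {k | k < z.1 ∧ z.2 k ∈ m}.ncard = markCount m z := by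
  classical
  rw [markCount, ← Set.ncard_coe_finset]
  congr 1
  ext k
  simp

lemma follows_nil_iff (c : ℕ → Bool) (w : Word) :
    Follows [] c w ↔ initialWord c w.length = w := by
  constructor
  · rintro ⟨n, hn⟩
    rw [List.nil_append] at hn
    rw [hn, initialWord_length]
  · exact fun h => ⟨w.length, by simpa using h.symm⟩

lemma follows_append_iff (p : Word) (d : Bool) (c : ℕ → Bool) (u : Word) :
    Follows (p ++ [d]) c (p ++ d :: u) ↔ initialWord c u.length = u := by
  rw [← follows_nil_iff]
  simp [Follows]

/-- Two alive descendants of the same vertex are incomparable. -/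
lemma splitTime_le_birthTime {clock : ℕ × Word → ℝ} (hc : ∀ x, 0 < clock x) (a : ℕ) (u : Word)
    (b : Bool) (r : Word) : splitTime clock a u ≤ birthTime clock a (u ++ b :: r) := by
  induction r using List.reverseRecOn with
  | nil => rw [birthTime_snoc]
  | append_singleton r d ih =>
    rw [show u ++ b :: (r ++ [d]) = (u ++ b :: r) ++ [d] by simp, birthTime_snoc]
    exact ih.trans (le_add_of_nonneg_right (hc _).le)

/-- A proper extension is born only once the shorter word has split, so the two cannot be alive
together. -/
lemma Alive.eq_of_prefix {clock : ℕ × Word → ℝ} (hc : ∀ x, 0 < clock x) {t : ℝ} {a : ℕ}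
    {u w : Word} (hu : Alive clock t (a, u)) (hw : Alive clock t (a, w)) (huw : u <+: w) :
    u = w := by
  obtain ⟨r, rfl⟩ := huw
  cases r with
  | nil => simp
  | cons b r =>
    exact absurd ((splitTime_le_birthTime hc a u b r).trans hw.1) (not_le.2 hu.2)

lemma prefix_or_prefix_of_initialWord {c : ℕ → Bool} {u w : Word}
    (hu : initialWord c u.length = u) (hw : initialWord c w.length = w) : u <+: w ∨ w <+: u := by
  have h (m n : ℕ) (hmn : m ≤ n) : initialWord c m <+: initialWord c n := by
    induction n, hmn using Nat.le_induction with
    | base => exact List.prefix_refl _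
    | succ n _ ih => rw [initialWord_succ]; exact ih.trans (List.prefix_append _ _)
  rcases le_total u.length w.length with h' | h'
  · exact Or.inl (by simpa only [hu, hw] using h _ _ h')
  · exact Or.inr (by simpa only [hu, hw] using h _ _ h')

lemma exists_branching {u w : Word} (h1 : ¬ u <+: w) (h2 : ¬ w <+: u) : ∃ p b r s,
    u = p ++ b :: r ∧ w = p ++ (!b) :: s ∧ wordDist u w = r.length + s.length + 2 := by
  induction u generalizing w with
  | nil => exact absurd List.nil_prefix h1
  | cons b u ih =>
    cases w with
    | nil => exact absurd List.nil_prefix h2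
    | cons c w =>
      by_cases h : b = c
      · subst h
        rw [List.cons_prefix_cons] at h1 h2
        obtain ⟨p, b', r, s, hu, hw, hd⟩ := ih (by simpa using h1) (by simpa using h2)
        exact ⟨b :: p, b', r, s, by simp [hu], by simp [hw], by simpa [wordDist] using hd⟩
      · refine ⟨[], b, u, w, rfl, ?_, by simp [wordDist, h]⟩
        have : c = !b := by cases b <;> cases c <;> simp_all
        simp [this]

/-- Two words diverge at one place only, so the new edges between two descendants of a vertex all
come from a single split. -/
lemma branching_unique {p p' u w r s : Word} {d : Bool} (h1 : p' ++ d :: r = p ++ false :: u)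
    (h2 : p' ++ (!d) :: s = p ++ true :: w) : p' = p ∧ d = false := by
  induction p' generalizing p with
  | nil =>
    cases p with
    | nil => simp at h1; exact ⟨rfl, h1.1⟩
    | cons b p =>
      simp only [List.nil_append, List.cons_append, List.cons.injEq] at h1 h2
      have := h1.1.trans h2.1.symm
      cases d <;> simp at this
  | cons b' p' ih =>
    cases p with
    | nil =>
      simp only [List.nil_append, List.cons_append, List.cons.injEq] at h1 h2
      have := h1.1.symm.trans h2.1
      simp at this
    | cons b p =>
      simp only [List.cons_append, List.cons.injEq] at h1 h2
      obtain ⟨h, hd⟩ := ih h1.2 h2.2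
      exact ⟨by rw [h, h1.1], hd⟩

/-! ### Multiplicities as numbers of marked edges -/

namespace Source

/-- The position of the first end of an edge that has followed the word `u`. -/
def left : Source → Word → ℕ × Word
  | .inl p, u => (p.1.1, u)
  | .inr p, u => (p.1, p.2 ++ false :: u)

/-- The position of the second end of an edge that has followed the word `w`. -/
def right : Source → Word → ℕ × Word
  | .inl p, w => (p.1.2, w)
  | .inr p, w => (p.1, p.2 ++ true :: w)

/-- Words followed by the same walk are comparable, whereas distinct living descendants of a vertex
are not: an edge end sits at one place at a time. -/
lemma left_eq_of_ends {clock : ℕ × Word → ℝ} (hc : ∀ x, 0 < clock x) {t : ℝ} {σ : Source}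
    {u u' : Word} {c : ℕ → Bool} (hu : Alive clock t (σ.left u)) (hu' : Alive clock t (σ.left u'))
    (h : initialWord c u.length = u) (h' : initialWord c u'.length = u') :
    σ.left u = σ.left u' := by
  rcases σ with p | ⟨a, p⟩
  · rcases prefix_or_prefix_of_initialWord h h' with h0 | h0
    · exact congrArg _ (hu.eq_of_prefix hc hu' h0)
    · exact congrArg _ (hu'.eq_of_prefix hc hu h0).symm
  · rcases prefix_or_prefix_of_initialWord h h' with h0 | h0
    · exact Prod.ext rfl (hu.eq_of_prefix hc hu' (by simpa [Source.left] using h0))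
    · exact Prod.ext rfl (hu'.eq_of_prefix hc hu (by simpa using h0)).symm

lemma right_eq_of_ends {clock : ℕ × Word → ℝ} (hc : ∀ x, 0 < clock x) {t : ℝ} {σ : Source}
    {u u' : Word} {c : ℕ → Bool} (hu : Alive clock t (σ.right u)) (hu' : Alive clock t (σ.right u'))
    (h : initialWord c u.length = u) (h' : initialWord c u'.length = u') :
    σ.right u = σ.right u' := by
  rcases σ with p | ⟨a, p⟩
  · rcases prefix_or_prefix_of_initialWord h h' with h0 | h0
    · exact congrArg _ (hu.eq_of_prefix hc hu' h0)
    · exact congrArg _ (hu'.eq_of_prefix hc hu h0).symm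
  · rcases prefix_or_prefix_of_initialWord h h' with h0 | h0
    · exact Prod.ext rfl (hu.eq_of_prefix hc hu' (by simpa [Source.right] using h0))
    · exact Prod.ext rfl (hu'.eq_of_prefix hc hu (by simpa using h0)).symm

end Source

/-- Different initial ancestors leave only old edges, a common one only edges of the split where the
words diverge. Overwriting the walk of the root is harmless, since no edge end uses it. -/
lemma mult_full_eq_markCount {c : Set (ℕ × Word)} {e : TreeVertex ≃ ℕ} {clock : ℕ × Word → ℝ}
    {d : ℕ → Bool} {t : ℝ}
    (q : (Sym2 TreeVertex → ℕ) × (ℕ × Word → ℕ) × (Walker → ℕ → Bool)) {σ : Source} {u w : Word}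
    (hu : Alive clock t (σ.left u)) (hw : Alive clock t (σ.right w))
    (hu' : e.symm (σ.left u).1 ∈ spineVerts c) (hw' : e.symm (σ.right w).1 ∈ spineVerts c)
    [DecidableEq Walker] :
    (((spineGraph c q.1).relabel e).full (clock, q.2.1, Function.update q.2.2 .root d) t).mult
      (σ.left u) (σ.right w) = markCount (ends u w) (Source.items e q σ) := by
  set G := (spineGraph c q.1).relabel e with hG
  set η : Noise := (clock, q.2.1, Function.update q.2.2 .root d) with hη
  have hmult : (G.full η t).mult (σ.left u) (σ.right w) =
      (G.oldEdges η (σ.left u) (σ.right w)).ncard + (G.newEdges η (σ.left u) (σ.right w)).ncard :=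
    if_pos ⟨hu, hw⟩
  have hwalk (x : Walker) (hx : x ≠ .root) : η.2.2 x = q.2.2 x := Function.update_of_ne hx _ _
  rw [hmult, ← ncard_eq_markCount]
  rcases σ with ⟨⟨a, b⟩, hab⟩ | ⟨a, p⟩
  · have hne : a ≠ b := (show a < b from hab).ne
    have hGm : G.mult a b = q.1 s(e.symm a, e.symm b) :=
      if_pos ⟨fun h => hne (e.symm.injective h), hu', hw'⟩
    have h1 : G.newEdges η (a, u) (b, w) = ∅ := by
      ext k
      simp [RootedMultigraph.newEdges, hne]
    have h2 : G.oldEdges η (a, u) (b, w) = {k | k < (Source.items e q (.inl ⟨(a, b), hab⟩)).1 ∧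
        (Source.items e q (.inl ⟨(a, b), hab⟩)).2 k ∈ ends u w} := by
      ext k
      simp only [RootedMultigraph.oldEdges, Set.mem_ofPred_eq, hGm, follows_nil_iff,
        hwalk (.old a b k) (by simp), hwalk (.old b a k) (by simp)]
      rfl
    simp only [Source.left, Source.right]
    rw [h1, h2, Set.ncard_empty, add_zero]
  · have h1 : G.oldEdges η (a, p ++ false :: u) (a, p ++ true :: w) = ∅ := by
      ext k
      simp [RootedMultigraph.oldEdges, G.mult_self]
    have h2 : G.newEdges η (a, p ++ false :: u) (a, p ++ true :: w) =
        (fun i => (p, i)) '' {k | k < (Source.items e q (.inr (a, p))).1 ∧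
        (Source.items e q (.inr (a, p))).2 k ∈ ends u w} := by
      ext ⟨p', i⟩
      simp only [RootedMultigraph.newEdges, Set.mem_ofPred_eq, Set.mem_image, Prod.mk.injEq]
      constructor
      · rintro ⟨-, -, hi, b, ⟨m, hm⟩, ⟨n, hn⟩⟩
        have hm' : p' ++ b :: initialWord (η.2.2 (.new a p' i b)) m = p ++ false :: u := by
          rw [hm]; simp
        have hn' : p' ++ (!b) :: initialWord (η.2.2 (.new a p' i (!b))) n = p ++ true :: w := by
          rw [hn]; simp
        obtain ⟨rfl, rfl⟩ := branching_unique hm' hn'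
        have hm2 := (follows_append_iff p' false _ u).1 ⟨m, hm⟩
        have hn2 := (follows_append_iff p' true _ w).1 ⟨n, hn⟩
        rw [hwalk _ (by simp)] at hm2
        rw [hwalk _ (by simp)] at hn2
        exact ⟨i, ⟨hi, hm2, hn2⟩, rfl, rfl⟩
      · rintro ⟨i', ⟨hi, hm, hn⟩, rfl, rfl⟩
        refine ⟨hu', trivial, hi, false, ?_, ?_⟩
        · rw [follows_append_iff, hwalk _ (by simp)]
          exact hm
        · rw [hwalk _ (by simp)]
          exact (follows_append_iff p true _ w).2 hn
    simp only [Source.left, Source.right]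
    rw [h1, h2, Set.ncard_empty, zero_add]
    exact Set.ncard_image_of_injective _ fun i j h => (Prod.mk.inj h).2

/-! ### The field of the edges between the living vertices -/

/-- Pairs of distinct leaves. -/
def spinePairs (c : Set (ℕ × Word)) : Set (Sym2 TreeVertex) :=
  {p | ∃ x ∈ spineVerts c, ∃ y ∈ spineVerts c, x ≠ y ∧ p = s(x, y)}

section Field

variable {hs l : List BinTree} {clock : ℕ × Word → ℝ} {e : TreeVertex ≃ ℕ} {d : ℕ → Bool} {t : ℝ}
  {L : ℕ}

/-- The vertex of the new spine tree that represents a descendant of a labelled vertex of the old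
one. -/
def embed (L : ℕ) (d : ℕ → Bool) (e : TreeVertex ≃ ℕ) (z : ℕ × Word) : TreeVertex :=
  descend L d (e.symm z.1) z.2

/-- The living descendants of the vertices of the spine graph. -/
def livePositions (hs : List BinTree) (clock : ℕ × Word → ℝ) (e : TreeVertex ≃ ℕ) (t : ℝ) :
    Set (ℕ × Word) :=
  {z | e.symm z.1 ∈ spineVerts (levelLeaves hs) ∧ Alive clock t z}

lemma Descends.fits_of_mem (hd : Descends hs l (fun x w => clock (e x, w)) d t L) {z : ℕ × Word}
    (hz : z ∈ livePositions hs clock e t) (h : e.symm z.1 = v 0) : Fits L d z.2 := by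
  refine hd.fits _ ?_
  rw [← h, Equiv.apply_symm_apply]
  exact hz.2

lemma Descends.embed_injOn (hd : Descends hs l (fun x w => clock (e x, w)) d t L) :
    Set.InjOn (embed L d e) (livePositions hs clock e t) := by
  intro z hz z' hz' h
  obtain ⟨h1, h2⟩ := descend_injective hz.1 hz'.1 (hd.fits_of_mem hz) (hd.fits_of_mem hz') h
  exact Prod.ext (e.symm.injective h1) h2

lemma Descends.image_embed (hd : Descends hs l (fun x w => clock (e x, w)) d t L) :
    embed L d e '' livePositions hs clock e t = spineVerts (levelLeaves l) := by
  ext y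
  constructor
  · rintro ⟨z, hz, rfl⟩
    refine hd.mem _ hz.1 _ ?_
    simp only [Equiv.apply_symm_apply]
    exact hz.2
  · intro hy
    obtain ⟨x, hx, u, hu, rfl⟩ := hd.surj y hy
    exact ⟨(e x, u), ⟨by simpa using hx, hu⟩, by simp [embed]⟩

/-- The thinned rate is the desired one: an old pair starts from 2 * lam / 2^dist and each later
split adds one to the distance; a split starts from lam / 2, that is 2 * lam / 2^2, the two children
being at distance 2. -/
lemma Descends.exists_source (hd : Descends hs l (fun x w => clock (e x, w)) d t L)
    (hc : ∀ x, 0 < clock x) (lam : ℝ≥0) {p : Sym2 TreeVertex}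
    (hp : p ∈ spinePairs (levelLeaves l)) :
    ∃ (σ : Source) (u w : Word), σ.left u ∈ livePositions hs clock e t ∧
      σ.right w ∈ livePositions hs clock e t ∧
      s(embed L d e (σ.left u), embed L d e (σ.right w)) = p ∧
      σ.rate lam e * (2⁻¹ ^ u.length * 2⁻¹ ^ w.length) = spineRate lam p := by
  classical
  obtain ⟨y, hy, y', hy', hne, rfl⟩ := hp
  rw [← hd.image_embed] at hy hy'
  obtain ⟨⟨a, u⟩, hz, rfl⟩ := hy
  obtain ⟨⟨b, w⟩, hz', rfl⟩ := hy'
  have hdist := spineDist_descend hz.1 hz'.1 (hd.fits_of_mem hz) (hd.fits_of_mem hz')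
  have hpow (m : ℕ) : (2⁻¹ : ℝ≥0) ^ m = (2 ^ m)⁻¹ := inv_pow _ _
  have hold (a b : ℕ) (u w : Word) (hab : a < b) (hz : (a, u) ∈ livePositions hs clock e t)
      (hz' : (b, w) ∈ livePositions hs clock e t) :
      ∃ (σ : Source) (u' w' : Word), σ.left u' ∈ livePositions hs clock e t ∧
        σ.right w' ∈ livePositions hs clock e t ∧
        s(embed L d e (σ.left u'), embed L d e (σ.right w')) =
          s(embed L d e (a, u), embed L d e (b, w)) ∧
        σ.rate lam e * (2⁻¹ ^ u'.length * 2⁻¹ ^ w'.length) =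
          spineRate lam s(embed L d e (a, u), embed L d e (b, w)) := by
    have hdist := spineDist_descend hz.1 hz'.1 (hd.fits_of_mem hz) (hd.fits_of_mem hz')
    rw [if_neg fun h => hab.ne (e.symm.injective h)] at hdist
    refine ⟨.inl ⟨(a, b), hab⟩, u, w, hz, hz', rfl, ?_⟩
    rw [spineRate_mk, embed, embed, hdist]
    change 2 * lam / 2 ^ spineDist (e.symm a) (e.symm b) * _ = _
    rw [hpow, hpow, pow_add, pow_add]
    field_simp
  have hnew (a : ℕ) (q r r' : Word) (hz : (a, q ++ false :: r) ∈ livePositions hs clock e t)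
      (hz' : (a, q ++ true :: r') ∈ livePositions hs clock e t) :
      ∃ (σ : Source) (u' w' : Word), σ.left u' ∈ livePositions hs clock e t ∧
        σ.right w' ∈ livePositions hs clock e t ∧
        s(embed L d e (σ.left u'), embed L d e (σ.right w')) =
          s(embed L d e (a, q ++ false :: r), embed L d e (a, q ++ true :: r')) ∧
        σ.rate lam e * (2⁻¹ ^ u'.length * 2⁻¹ ^ w'.length) =
          spineRate lam s(embed L d e (a, q ++ false :: r), embed L d e (a, q ++ true :: r')) := by
    have hdist := spineDist_descend hz.1 hz'.1 (hd.fits_of_mem hz) (hd.fits_of_mem hz')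
    rw [if_pos rfl, wordDist_append_left] at hdist
    refine ⟨.inr (a, q), r, r', hz, hz', rfl, ?_⟩
    rw [spineRate_mk, embed, embed, hdist]
    change lam / 2 * _ = _
    have : wordDist (false :: r) (true :: r') = r.length + r'.length + 2 := by simp [wordDist]
    rw [this, hpow, hpow, pow_add, pow_add]
    field_simp
  rcases lt_trichotomy a b with hab | rfl | hab
  · exact hold a b u w hab hz hz'
  · have h1 : ¬ u <+: w := fun h => hne (by rw [hz.2.eq_of_prefix hc hz'.2 h])
    have h2 : ¬ w <+: u := fun h => hne (by rw [hz'.2.eq_of_prefix hc hz.2 h])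
    obtain ⟨q, b, r, r', rfl, rfl, -⟩ := exists_branching h1 h2
    cases b
    · exact hnew a q r r' hz hz'
    · rw [Sym2.eq_swap]
      exact hnew a q r' r hz' hz
  · rw [Sym2.eq_swap]
    exact hold b a w u hab hz' hz

lemma Descends.full_verts (hd : Descends hs l (fun x w => clock (e x, w)) d t L)
    (hc : ∀ x, 0 < clock x) [DecidableEq Walker] (N : Sym2 TreeVertex → ℕ) (M : ℕ × Word → ℕ)
    (W : Walker → ℕ → Bool) :
    (((spineGraph (levelLeaves hs) N).relabel e).full
      (clock, M, Function.update W .root d) t).root = (e (v 0), initialWord d L) ∧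
    (((spineGraph (levelLeaves hs) N).relabel e).full
      (clock, M, Function.update W .root d) t).verts = livePositions hs clock e t := by
  have halive : Alive clock t (e (v 0), initialWord d L) := hd.root
  have hroot : (((spineGraph (levelLeaves hs) N).relabel e).full
      (clock, M, Function.update W .root d) t).root = (e (v 0), initialWord d L) := by
    change (e (v 0), initialWord (Function.update W .root d .root)
      (sInf {n : ℕ | t < splitTime clock (e (v 0))
        (initialWord (Function.update W .root d .root) n)})) = _
    rw [Function.update_self, sInf_splitTime hc halive]
  refine ⟨hroot, ?_⟩
  change insert (((spineGraph (levelLeaves hs) N).relabel e).full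
      (clock, M, Function.update W .root d) t).root (livePositions hs clock e t) = _
  rw [hroot]
  refine Set.insert_eq_of_mem ⟨?_, halive⟩
  rw [Equiv.symm_apply_apply]
  exact Or.inl rfl

/-- The edge numbers at time `t` are those of the Poisson edge model on the new spine tree. -/
theorem Descends.exists_field (hd : Descends hs l (fun x w => clock (e x, w)) d t L)
    (hc : ∀ x, 0 < clock x) [DecidableEq Walker] (lam : ℝ≥0) :
    ∃ F : (Sym2 TreeVertex → ℕ) × (ℕ × Word → ℕ) × (Walker → ℕ → Bool) → Sym2 TreeVertex → ℕ,
      (∀ B : Set (Sym2 TreeVertex → ℕ), MeasurableSet B →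
        (∀ N N', (∀ p ∈ spinePairs (levelLeaves l), N p = N' p) → (N ∈ B ↔ N' ∈ B)) →
          edgeNoise lam (F ⁻¹' B) = spineField lam B) ∧
      ∀ q, ∀ z ∈ livePositions hs clock e t, ∀ z' ∈ livePositions hs clock e t,
        (spineGraph (levelLeaves l) (F q)).mult (embed L d e z) (embed L d e z') =
          (((spineGraph (levelLeaves hs) q.1).relabel e).full
            (clock, q.2.1, Function.update q.2.2 .root d) t).mult z z' := by
  classical
  set A := spinePairs (levelLeaves l) with hA
  choose σ u w hl hr hs' hrate using fun p : A => hd.exists_source hc lam p.2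
  let M : (Sym2 TreeVertex → ℕ) × (ℕ × Word → ℕ) × (Walker → ℕ → Bool) → A → ℕ :=
    fun q p => markCount (ends (u p) (w p)) (Source.items e q (σ p))
  -- The filler `0` does not matter: only events that depend on pairs of distinct leaves are
  -- compared with `spineField`.
  let ext : (A → ℕ) → Sym2 TreeVertex → ℕ := fun g p => if hp : p ∈ A then g ⟨p, hp⟩ else 0
  have hext : Measurable ext := by
    refine measurable_pi_iff.2 fun p => ?_
    by_cases hp : p ∈ A
    · simpa only [ext, hp, dite_true] using measurable_pi_apply _
    · simpa only [ext, hp, dite_false] using measurable_const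
  -- One edge cannot join two different pairs of living vertices; this is the disjointness required
  -- for thinning.
  have hdisj (p p' : A) (hne : p ≠ p') (hσ : σ p = σ p') :
      Disjoint (ends (u p) (w p)) (ends (u p') (w p')) := by
    rw [Set.disjoint_left]
    rintro ξ ⟨h1, h2⟩ ⟨h1', h2'⟩
    have hl' := hl p'
    have hr' := hr p'
    have h' := hs' p'
    rw [← hσ] at hl' hr' h'
    refine hne (Subtype.ext ?_)
    rw [← hs' p, ← h', Source.left_eq_of_ends hc (hl p).2 hl'.2 h1 h1',
      Source.right_eq_of_ends hc (hr p).2 hr'.2 h2 h2']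
  have hcount : Measurable fun (ξ : Source → ℕ × (ℕ → Bool → ℕ → Bool)) (p : A) =>
      markCount (ends (u p) (w p)) (ξ (σ p)) :=
    measurable_pi_iff.2 fun p =>
      (measurable_markCount (measurableSet_ends _ _)).comp (measurable_pi_apply _)
  have hM : MeasurePreserving M (edgeNoise lam)
      (Measure.infinitePi fun p : A => poissonMeasure (spineRate lam p)) := by
    have h := map_markCount_eq_infinitePi (Source.rate lam e) endMeasure σ
      (fun p => ends (u p) (w p)) (fun p => measurableSet_ends _ _) hdisj
    have hr : (fun p : A => poissonMeasure (Source.rate lam e (σ p) *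
        (endMeasure (ends (u p) (w p))).toNNReal)) =
          fun p : A => poissonMeasure (spineRate lam p) := by
      funext p
      rw [← hrate p, endMeasure_ends]
      simp only [ENNReal.toNNReal_mul, ENNReal.toNNReal_pow, ENNReal.toNNReal_inv,
        ENNReal.toNNReal_ofNat]
    have h' : (Measure.infinitePi fun σ => markedPoisson (Source.rate lam e σ) endMeasure).map
        (fun ξ (p : A) => markCount (ends (u p) (w p)) (ξ (σ p))) =
          Measure.infinitePi fun p : A => poissonMeasure (spineRate lam p) := by
      rw [h]
      congr 1
    exact (MeasurePreserving.mk hcount h').comp (measurePreserving_items lam e)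
  refine ⟨fun q => ext (M q), fun B hB hBA => ?_, fun q z hz z' hz' => ?_⟩
  · have h1 : edgeNoise lam ((fun q => ext (M q)) ⁻¹' B) =
        (Measure.infinitePi fun p : A => poissonMeasure (spineRate lam p)) (ext ⁻¹' B) :=
      hM.measure_preimage (hext hB).nullMeasurableSet
    have h2 : (spineField lam).map A.domRestrict =
        Measure.infinitePi fun p : A => poissonMeasure (spineRate lam p) :=
      Measure.infinitePi_map_restrict' _
    have hr : Measurable (A.domRestrict : (Sym2 TreeVertex → ℕ) → A → ℕ) :=
      measurable_pi_iff.2 fun i => measurable_pi_apply _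
    rw [h1, ← h2, Measure.map_apply hr (hext hB)]
    congr 1
    ext N
    exact hBA _ _ fun p hp => by simp [ext, hp, Set.domRestrict]
  · by_cases hzz : z = z'
    · subst hzz
      rw [RootedMultigraph.mult_self, RootedMultigraph.mult_self]
    · have hne : embed L d e z ≠ embed L d e z' := fun h => hzz (hd.embed_injOn hz hz' h)
      have hm (y : ℕ × Word) (hy : y ∈ livePositions hs clock e t) :
          embed L d e y ∈ spineVerts (levelLeaves l) := by
        rw [← hd.image_embed]
        exact Set.mem_image_of_mem _ hy
      have hp : s(embed L d e z, embed L d e z') ∈ A := ⟨_, hm z hz, _, hm z' hz', hne, rfl⟩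
      have h1 : (spineGraph (levelLeaves l) (ext (M q))).mult (embed L d e z) (embed L d e z') =
          M q ⟨_, hp⟩ := by
        refine (if_pos ⟨hne, hm z hz, hm z' hz'⟩).trans ?_
        exact dif_pos hp
      have h2 : M q ⟨_, hp⟩ = _ := (mult_full_eq_markCount (d := d) q (hl ⟨_, hp⟩).2 (hr ⟨_, hp⟩).2
        (hl ⟨_, hp⟩).1 (hr ⟨_, hp⟩).1).symm
      rw [h1, h2]
      rcases Sym2.eq_iff.1 (hs' ⟨_, hp⟩) with ⟨h3, h4⟩ | ⟨h3, h4⟩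
      · rw [hd.embed_injOn (hl _) hz h3, hd.embed_injOn (hr _) hz' h4]
      · rw [hd.embed_injOn (hl _) hz' h3, hd.embed_injOn (hr _) hz h4, RootedMultigraph.mult_comm]

end Field

/-! ### Reordering the randomness -/

open scoped Classical in
/-- The initial edge numbers and the noise, from the walk of the root, the lifetimes, and the
edge noise. -/
noncomputable def refresh (p : ((ℕ → Bool) × (ℕ × Word → ℝ)) ×
    (Sym2 TreeVertex → ℕ) × (ℕ × Word → ℕ) × (Walker → ℕ → Bool)) :
    (Sym2 TreeVertex → ℕ) × Noise :=
  (p.2.1, p.1.2, p.2.2.1, Function.update p.2.2.2 .root p.1.1)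

/-- The law of the walk of the root and of the lifetimes. -/
noncomputable def motionMeasure : Measure ((ℕ → Bool) × (ℕ × Word → ℝ)) :=
  coinMeasure.prod (Measure.infinitePi fun _ : ℕ × Word => expMeasure 1)

instance (lam : ℝ≥0) : IsProbabilityMeasure (noiseMeasure lam) := by
  unfold noiseMeasure; infer_instance

/-- The walk of the root is replaced by an independent copy kept with the lifetimes. Conditioning on
that pair fixes the tree and the root's path while leaving the edge randomness fresh. -/
lemma measurePreserving_refresh (lam : ℝ≥0) : MeasurePreserving refresh
    (motionMeasure.prod (edgeNoise lam)) ((spineField lam).prod (noiseMeasure lam)) := by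
  classical
  have hu : MeasurePreserving (fun p : (Walker → ℕ → Bool) × (ℕ → Bool) =>
      Function.update p.1 .root p.2)
      ((Measure.infinitePi fun _ : Walker => coinMeasure).prod coinMeasure)
      (Measure.infinitePi fun _ : Walker => coinMeasure) := by
    refine ⟨?_, map_update_infinitePi (fun _ : Walker => coinMeasure) .root⟩
    refine measurable_pi_lambda _ fun i => ?_
    by_cases hi : i = .root
    · subst hi
      simpa using measurable_snd
    · simp only [Function.update_of_ne hi]
      fun_prop
  let A : Measure (ℕ → Bool) := coinMeasure
  let K : Measure (ℕ × Word → ℝ) := Measure.infinitePi fun _ => expMeasure 1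
  let M : Measure (ℕ × Word → ℕ) := Measure.infinitePi fun _ => poissonMeasure (lam / 2)
  let W : Measure (Walker → ℕ → Bool) := Measure.infinitePi fun _ => coinMeasure
  have h1 := measurePreserving_prodAssoc A K ((spineField lam).prod (M.prod W))
  have h2 := (MeasurePreserving.id A).prod ((measurePreserving_prodAssoc (spineField lam) K
    (M.prod W)).comp (((Measure.measurePreserving_swap (μ := K) (ν := spineField lam)).prod
      (MeasurePreserving.id (M.prod W))).comp
        (measurePreserving_prodAssoc K (spineField lam) (M.prod W)).symm))
  have h3 := Measure.measurePreserving_swap (μ := A)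
    (ν := (spineField lam).prod (K.prod (M.prod W)))
  have h4 := measurePreserving_prodAssoc (spineField lam) (K.prod (M.prod W)) A
  have h5 := (MeasurePreserving.id (spineField lam)).prod (((MeasurePreserving.id K).prod
    (((MeasurePreserving.id M).prod hu).comp (measurePreserving_prodAssoc M W A))).comp
      (measurePreserving_prodAssoc K (M.prod W) A))
  exact h5.comp (h4.comp (h3.comp (h2.comp h1)))

/-! ### Averaging over the lifetimes -/

/-- The spine trees `hs`, whose leaves are labelled by `e`, become the spine trees `l`. -/
def Evolves (hs l : List BinTree) (e : TreeVertex ≃ ℕ) (t : ℝ) :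
    Set ((ℕ → Bool) × (ℕ × Word → ℝ)) :=
  {r | SpineGrows hs l (fun x w => r.2 (e x, w)) r.1 t}

lemma measurePreserving_relabelled_clocks (e : TreeVertex ≃ ℕ) : MeasurePreserving
    (fun (clock : ℕ × Word → ℝ) x w => clock (e x, w))
    (Measure.infinitePi fun _ : ℕ × Word => expMeasure 1)
    (Measure.infinitePi fun _ : TreeVertex => clockMeasure) := by
  have hinj : Function.Injective fun q : TreeVertex × Word => (e q.1, q.2) := by
    rintro ⟨x, w⟩ ⟨x', w'⟩ h
    simpa using h
  have h1 : MeasurePreserving (fun (clock : ℕ × Word → ℝ) (q : TreeVertex × Word) =>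
      clock (e q.1, q.2)) (Measure.infinitePi fun _ : ℕ × Word => expMeasure 1)
      (Measure.infinitePi fun _ : TreeVertex × Word => expMeasure 1) :=
    ⟨by fun_prop, Measure.map_infinitePi_infinitePi_of_inj hinj⟩
  have h2 : MeasurePreserving (MeasurableEquiv.curry TreeVertex Word ℝ)
      (Measure.infinitePi fun _ : TreeVertex × Word => expMeasure 1)
      (Measure.infinitePi fun _ : TreeVertex => clockMeasure) :=
    ⟨(MeasurableEquiv.curry TreeVertex Word ℝ).measurable,
      Measure.infinitePi_map_curry fun (_ : TreeVertex) (_ : Word) => expMeasure 1⟩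
  exact h2.comp h1

lemma measurableSet_evolves (hs l : List BinTree) (e : TreeVertex ≃ ℕ) (t : ℝ) :
    MeasurableSet (Evolves hs l e t) :=
  (measurableSet_spineGrows hs l t).preimage
    (f := fun r : (ℕ → Bool) × (ℕ × Word → ℝ) => ((fun x w => r.2 (e x, w)), r.1)) (by fun_prop)

lemma motionMeasure_evolves (hs l : List BinTree) (e : TreeVertex ≃ ℕ) (t : ℝ) :
    motionMeasure (Evolves hs l e t) = SpineList.growProb t hs l := by
  rw [motionMeasure, Measure.prod_apply (measurableSet_evolves hs l e t)]
  have h (d : ℕ → Bool) : (Measure.infinitePi fun _ : ℕ × Word => expMeasure 1)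
      (Prod.mk d ⁻¹' Evolves hs l e t) = SpineList.growProb t hs l := by
    have hm : MeasurableSet {C : TreeVertex → Word → ℝ | SpineGrows hs l C d t} :=
      (measurableSet_spineGrows hs l t).preimage (f := fun C => (C, d)) (by fun_prop)
    rw [← measure_spineGrows hs l d t,
      ← (measurePreserving_relabelled_clocks e).measure_preimage hm.nullMeasurableSet]
    rfl
  simp [h]

lemma ae_motionMeasure (hs : List BinTree) (e : TreeVertex ≃ ℕ) (t : ℝ) :
    ∀ᵐ r ∂motionMeasure, (∀ x, 0 < r.2 x) ∧ ∃ l, r ∈ Evolves hs l e t := by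
  have h : ∀ᵐ C ∂(Measure.infinitePi fun _ : TreeVertex => clockMeasure),
      ∀ X, (∀ w, 0 < C X w) ∧ ∃ x : BinTree, x.Grows (C X) t :=
    ae_all_iff.2 fun X => (measurePreserving_eval_infinitePi (fun _ : TreeVertex => clockMeasure)
      X).quasiMeasurePreserving.ae (ae_clock_pos.and (ae_exists_grows t))
  have h' := (measurePreserving_relabelled_clocks e).quasiMeasurePreserving.ae h
  filter_upwards [(Measure.quasiMeasurePreserving_snd (μ := coinMeasure)).ae h'] with r hr
  refine ⟨fun x => ?_, exists_spineGrows hs (fun X => (hr X).2) _⟩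
  simpa using (hr (e.symm x.1)).1 x.2

lemma Evolves.unique {hs l m : List BinTree} {e : TreeVertex ≃ ℕ} {t : ℝ}
    {r : (ℕ → Bool) × (ℕ × Word → ℝ)} (h : r ∈ Evolves hs l e t) (h' : r ∈ Evolves hs m e t) :
    l = m := SpineGrows.unique h h'

lemma tsum_indicator_of_mem {ι X : Type*} {E : ι → Set X}
    (hd : ∀ i j x, x ∈ E i → x ∈ E j → i = j) (b : ι → ℝ≥0∞) {i : ι} {x : X} (hx : x ∈ E i) :
    ∑' j, (E j).indicator (fun _ => b j) x = b i := by
  rw [tsum_eq_single i fun j hj => Set.indicator_of_notMem (fun h => hj (hd j i x h hx)) _,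
    Set.indicator_of_mem hx]

lemma lintegral_tsum_indicator {ι X : Type*} [Countable ι] [MeasurableSpace X] (μ : Measure X)
    {E : ι → Set X} (hE : ∀ i, MeasurableSet (E i)) (b : ι → ℝ≥0∞) :
    ∫⁻ x, ∑' j, (E j).indicator (fun _ => b j) x ∂μ = ∑' j, μ (E j) * b j := by
  rw [lintegral_tsum fun j => (measurable_const.indicator (hE j)).aemeasurable]
  simp only [lintegral_indicator_const (hE _), mul_comm]

section Average

variable {hs : List BinTree} {e : TreeVertex ≃ ℕ} {t : ℝ} {lam : ℝ≥0}
  {A : Set ((Sym2 TreeVertex → ℕ) × Noise)} {b : List BinTree → ℝ≥0∞}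

lemma measure_le_tsum_growProb (hA : MeasurableSet A)
    (hb : ∀ l, ∀ r ∈ Evolves hs l e t, (∀ x, 0 < r.2 x) →
      edgeNoise lam {q | refresh (r, q) ∈ A} ≤ b l) :
    ((spineField lam).prod (noiseMeasure lam)) A ≤ ∑' l, SpineList.growProb t hs l * b l := by
  have hR := measurePreserving_refresh lam
  simp only [← motionMeasure_evolves hs _ e t]
  rw [← hR.measure_preimage hA.nullMeasurableSet, Measure.prod_apply (hR.measurable hA),
    ← lintegral_tsum_indicator _ (fun l => measurableSet_evolves hs l e t)]
  refine lintegral_mono_ae ?_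
  filter_upwards [ae_motionMeasure hs e t] with r ⟨hr, l, hl⟩
  rw [tsum_indicator_of_mem (fun _ _ _ => Evolves.unique) _ hl]
  exact hb l r hl hr

/-- Condition on the motion: if the edge probability depends on it only through the resulting
shapes, integrating reduces to a sum against their transition probabilities. -/
lemma measure_eq_tsum_growProb (hA : MeasurableSet A)
    (hb : ∀ l, ∀ r ∈ Evolves hs l e t, (∀ x, 0 < r.2 x) →
      edgeNoise lam {q | refresh (r, q) ∈ A} = b l) :
    ((spineField lam).prod (noiseMeasure lam)) A = ∑' l, SpineList.growProb t hs l * b l := by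
  have hR := measurePreserving_refresh lam
  simp only [← motionMeasure_evolves hs _ e t]
  rw [← hR.measure_preimage hA.nullMeasurableSet, Measure.prod_apply (hR.measurable hA),
    ← lintegral_tsum_indicator _ (fun l => measurableSet_evolves hs l e t)]
  refine lintegral_congr_ae ?_
  filter_upwards [ae_motionMeasure hs e t] with r ⟨hr, l, hl⟩
  rw [tsum_indicator_of_mem (fun _ _ _ => Evolves.unique) _ hl]
  exact hb l r hl hr

end Average

/-! ### The cluster process started from the Poisson edge model on a spine tree -/

lemma spineClass_congr {c : Set (ℕ × Word)} {N N' : Sym2 TreeVertex → ℕ}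
    (h : ∀ p ∈ spinePairs c, N p = N' p) : spineClass c N = spineClass c N' := by
  have : spineGraph c N = spineGraph c N' := by
    refine RootedMultigraph.ext' rfl ?_ rfl
    funext x y
    by_cases hxy : x ≠ y ∧ x ∈ spineVerts c ∧ y ∈ spineVerts c
    · exact (if_pos hxy).trans ((h _ ⟨x, hxy.2.1, y, hxy.2.2, hxy.1, rfl⟩).trans (if_pos hxy).symm)
    · exact (if_neg hxy).trans (if_neg hxy).symm
  rw [spineClass, spineClass, this]

lemma emptyCut_congr {c : Set (ℕ × Word)} {N N' : Sym2 TreeVertex → ℕ}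
    (h : ∀ p ∈ spinePairs c, N p = N' p) (i : ℕ) : EmptyCut c N i ↔ EmptyCut c N' i := by
  refine forall₂_congr fun p hp => ?_
  obtain ⟨x, hx, y, hy, hxi, hyi, rfl⟩ := hp
  rw [h _ ⟨x, hx, y, hy, fun hxy => by subst hxy; omega, rfl⟩]

lemma RootedMultigraph.Reachable.map {V W : Type} {G : RootedMultigraph V} {H : RootedMultigraph W}
    (f : V → W) (hr : f G.root = H.root)
    (hm : ∀ x ∈ G.verts, ∀ y ∈ G.verts, H.mult (f x) (f y) = G.mult x y) {x : V}
    (h : G.Reachable x) : H.Reachable (f x) := by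
  induction h with
  | refl => rw [hr]; exact H.reachable_root
  | @tail a b _ hab ih =>
    refine ih.of_mult ?_
    rw [hm a (G.mem_of_mult a b hab) b (G.mem_of_mult b a (by rwa [G.mult_comm]))]
    exact hab

/-- Given the motion, `embed` is a root-preserving isomorphism from the full graph at time `t` onto
a spine graph whose edge field has the correct law on leaf pairs. The process thus moves between
these models through the shapes alone. -/
theorem measure_cluster_spineGraph (lam : ℝ≥0) (hs : List BinTree) (e : TreeVertex ≃ ℕ) {t : ℝ}
    (ht : 0 ≤ t) {S : Set MultigraphClass} (hS : MeasurableSet S) :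
    ((spineField lam).prod (noiseMeasure lam))
      {p | (((spineGraph (levelLeaves hs) p.1).relabel e).cluster p.2 t).isoClass ∈ S} =
        ∑' l, SpineList.growProb t hs l * spineLaw lam l S := by
  classical
  have hG : Measurable fun p : (Sym2 TreeVertex → ℕ) × Noise =>
      ((spineGraph (levelLeaves hs) p.1).relabel e, p.2) :=
    ((measurableGraph_spineGraph (fun _ => MeasurableSet.const _) measurable_fst).relabel
      e).measurable.prodMk measurable_snd
  refine measure_eq_tsum_growProb (e := e) ((measurable_isoClass_cluster t).comp hG hS)
    fun l r hr hpos => ?_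
  obtain ⟨L, hd⟩ := hr.descends (fun x w => hpos _) ht
  obtain ⟨F, hF, hm⟩ := hd.exists_field hpos lam
  have hB : MeasurableSet {N | spineClass (levelLeaves l) N ∈ S} :=
    (measurable_spineClass (Ω := Sym2 TreeVertex → ℕ) (fun _ => MeasurableSet.const _)
      measurable_id) hS
  rw [spineLaw_apply lam l hS, ← hF _ hB fun N N' h => by
    rw [Set.mem_ofPred_eq, Set.mem_ofPred_eq, spineClass_congr h]]
  congr 1
  ext q
  obtain ⟨hroot, hverts⟩ := hd.full_verts hpos q.1 q.2.1 q.2.2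
  have hiso : (((spineGraph (levelLeaves hs) q.1).relabel e).full
      (r.2, q.2.1, Function.update q.2.2 .root r.1) t).Iso (spineGraph (levelLeaves l) (F q)) := by
    refine RootedMultigraph.iso_of_injOn (embed L r.1 e) ?_ ?_ ?_ ?_
    · rw [hverts]
      exact hd.embed_injOn
    · rw [hverts]
      exact hd.image_embed
    · rw [hroot, embed, Equiv.symm_apply_apply]
      exact hd.root_eq
    · rw [hverts]
      exact hm q
  have := RootedMultigraph.isoClass_eq_of_iso hiso.component
  simp only [Set.mem_ofPred_eq, Set.mem_preimage, spineClass]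
  rw [← this]
  simp only [refresh, RootedMultigraph.cluster]

lemma exists_equiv_apply_eq (o : ℕ) : ∃ e : TreeVertex ≃ ℕ, e (v 0) = o := by
  obtain ⟨e⟩ := nonempty_equiv_of_countable (α := TreeVertex) (β := ℕ)
  exact ⟨e.trans (Equiv.swap (e (v 0)) o), by simp⟩

lemma relabel_spineGraph_nil (e : TreeVertex ≃ ℕ) (N : Sym2 TreeVertex → ℕ) :
    (spineGraph (levelLeaves []) N).relabel e = RootedMultigraph.single (e (v 0)) := by
  have hv : spineVerts (levelLeaves []) = {v 0} := by
    ext x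
    simp [spineVerts, levelLeaves]
  refine RootedMultigraph.ext' ?_ ?_ rfl
  · ext x
    change e.symm x ∈ spineVerts (levelLeaves []) ↔ x = e (v 0)
    rw [hv, Set.mem_singleton_iff, Equiv.symm_apply_eq]
  · funext x y
    refine if_neg fun h => h.1 ?_
    rw [hv] at h
    exact h.2.1.trans h.2.2.symm

/-- A single vertex is the spine graph of the empty list, from which the transition probability to
`l` is `SpineList.prob l t` by definition. -/
lemma measure_cluster_single (lam : ℝ≥0) (o : ℕ) {t : ℝ} (ht : 0 ≤ t) {S : Set MultigraphClass}
    (hS : MeasurableSet S) :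
    noiseMeasure lam {ω | ((RootedMultigraph.single o).cluster ω t).isoClass ∈ S} =
      trimmedLaw lam t S := by
  obtain ⟨e, rfl⟩ := exists_equiv_apply_eq o
  have h := measure_cluster_spineGraph lam [] e ht hS
  simp only [relabel_spineGraph_nil] at h
  rw [trimmedLaw_apply lam t hS]
  refine Eq.trans ?_ h
  have hm : MeasurableSet {ω : Noise |
      ((RootedMultigraph.single (e (v 0))).cluster ω t).isoClass ∈ S} :=
    ((measurable_isoClass_cluster t).comp (measurable_prodMk_left)) hS
  exact ((measurePreserving_snd (μ := spineField lam)).measure_preimage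
    hm.nullMeasurableSet).symm

/-! ### The part of the cluster that descends from a given vertex -/

/-- At time `t`, the cluster started from a single vertex contains a vertex which is not a
descendant of the `n`-th vertex on the path of the root. -/
def Strays (o n : ℕ) (t : ℝ) (ω : Noise) : Prop :=
  ∃ z, ((RootedMultigraph.single o).full ω t).Reachable z ∧ ¬ initialWord (ω.2.2 .root) n <+: z.2

lemma measurableSet_strays (o n : ℕ) (t : ℝ) : MeasurableSet {ω | Strays o n t ω} := by
  have h : {ω | Strays o n t ω} = ⋃ z : ℕ × Word,
      {ω : Noise | ((RootedMultigraph.single o).full ω t).Reachable z} ∩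
        {ω : Noise | ¬ initialWord (ω.2.2 .root) n <+: z.2} := by
    ext ω
    simp [Strays]
  rw [h]
  refine MeasurableSet.iUnion fun z => MeasurableSet.inter ?_ ?_
  · exact ((measurableGraph_full t).comp measurable_prodMk_left).reachable z
  · have hd : {c : ℕ → Bool | ¬ initialWord c n <+: z.2} =
        ⋃ u ∈ {u : Word | ¬ u <+: z.2}, {c | initialWord c n = u} := by
      ext c
      simp
    have hc : MeasurableSet {c : ℕ → Bool | ¬ initialWord c n <+: z.2} := by
      rw [hd]
      exact MeasurableSet.biUnion (Set.to_countable _) fun u _ => measurableSet_initialWord n u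
    exact hc.preimage (f := fun ω : Noise => ω.2.2 .root) (by fun_prop)

/-- With `L` splits of the root, an empty cut at `i < L - n` confines the cluster to levels at most
`i`, and words represented there share the first `n` choices of the root. A stray vertex therefore
excludes empty cuts below `L - n`. -/
lemma measure_strays_le (lam : ℝ≥0) {q : ℕ → ℝ≥0∞}
    (hq : ∀ c, KraftBound c → ∀ n, spineField lam {N | ∀ i < n, ¬ EmptyCut c N i} ≤ q n)
    (o n : ℕ) {t : ℝ} (ht : 0 ≤ t) :
    noiseMeasure lam {ω | Strays o n t ω} ≤
      ∑' l, SpineList.prob l t * min 1 (q (l.length - n)) := by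
  classical
  obtain ⟨e, rfl⟩ := exists_equiv_apply_eq o
  rw [← (measurePreserving_snd (μ := spineField lam)).measure_preimage
    (measurableSet_strays _ n t).nullMeasurableSet]
  refine measure_le_tsum_growProb (hs := []) (e := e)
    (measurable_snd (measurableSet_strays _ n t)) fun l r hr hpos => le_min prob_le_one ?_
  obtain ⟨L, hd⟩ := hr.descends (fun x w => hpos _) ht
  obtain ⟨F, hF, hm⟩ := hd.exists_field hpos lam
  have hL : l.length = L := by simpa using hd.length_eq
  have hB : MeasurableSet {N | ∀ i < L - n, ¬ EmptyCut (levelLeaves l) N i} := by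
    have : {N | ∀ i < L - n, ¬ EmptyCut (levelLeaves l) N i} =
        ⋂ i, ⋂ (_ : i < L - n), {N | EmptyCut (levelLeaves l) N i}ᶜ := by
      ext N
      simp
    rw [this]
    exact MeasurableSet.iInter fun i => MeasurableSet.iInter fun _ =>
      (measurableSet_emptyCut _ i).compl
  rw [hL]
  refine le_trans ?_ (hq _ (treeLevels_levelLeaves l).kraftBound (L - n))
  rw [← hF _ hB fun N N' h => by
    simp only [Set.mem_ofPred_eq, emptyCut_congr h]]
  refine measure_mono fun q hstray i hi hcut => ?_
  obtain ⟨z, hz, hz'⟩ := hstray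
  obtain ⟨hroot, hverts⟩ := hd.full_verts hpos q.1 q.2.1 q.2.2
  have hωr : (refresh (r, q)).2 = (r.2, q.2.1, Function.update q.2.2 .root r.1) := by
    simp only [refresh]
  rw [hωr] at hz hz'
  rw [← relabel_spineGraph_nil e q.1] at hz
  have hzl : z ∈ livePositions [] r.2 e t := by
    rw [← hverts]
    exact hz.mem_verts
  have hz0 : e.symm z.1 = v 0 := by
    rcases hzl.1 with h | ⟨p, hp, -⟩
    · exact h
    · exact hp.elim
  have hreach : (spineGraph (levelLeaves l) (F q)).Reachable (embed L r.1 e z) := by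
    refine hz.map _ ?_ ?_
    · rw [hroot, embed, Equiv.symm_apply_apply]
      exact hd.root_eq
    · rw [hverts]
      exact hm q
  have hlev := hcut.level_le hreach
  rw [embed, hz0] at hlev
  refine hz' ?_
  simp only [Function.update_self]
  refine (hd.fits_of_mem hzl hz0).prefix ?_
  change (pathVertex L r.1 z.2).level ≤ i at hlev
  omega

/-- The length of the list is the number of ages up to `t`; fewer than `n` of them force the age at
level `n` beyond `t`. -/
lemma tsum_prob_short_le (n : ℕ) (t : ℝ) :
    ∑' l : List BinTree, {l | l.length < n}.indicator (fun l => SpineList.prob l t) l ≤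
      treeMeasure {θ | t < age θ.1 n} := by
  have hm := fun l => measurableSet_trimmedSpine_tree l t
  have h (l : List BinTree) : {l | l.length < n}.indicator (fun l => SpineList.prob l t) l =
      treeMeasure {θ | l.length < n ∧ TrimmedSpine l θ.1 (fun i w => θ.2 (i, w)) t} := by
    by_cases hl : l.length < n
    · simp [hl, treeMeasure_trimmedSpine]
    · simp [hl]
  simp only [h]
  rw [← measure_iUnion]
  · refine measure_mono_ae ?_
    filter_upwards [ae_treeMeasure_pos] with θ hθ h
    obtain ⟨l, hl, hl'⟩ := Set.mem_iUnion.1 h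
    exact hl'.2.2.trans_le (age_mono hθ.1 hl.le)
  · intro l m hlm
    rw [Function.onFun, Set.disjoint_left]
    exact fun θ h h' => hlm (TrimmedSpine.unique h.2 h'.2)
  · exact fun l => (MeasurableSet.const _).inter (hm l)

/-- For large times the root has probably split many times, leaving many cuts above the first `n`
generations. The rare short lists are controlled by the minimum with `1`. -/
theorem tendsto_measure_strays (lam : ℝ≥0) (n : ℕ) :
    ∃ b : ℝ → ℝ≥0∞, Tendsto b atTop (𝓝 0) ∧
      ∀ t, 0 ≤ t → ∀ o, noiseMeasure lam {ω | Strays o n t ω} ≤ b t := by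
  obtain ⟨q, hq0, hq⟩ := exists_tendsto_measure_not_emptyCut lam
  refine ⟨fun t => ∑' l, SpineList.prob l t * min 1 (q (l.length - n)), ?_,
    fun t ht o => measure_strays_le lam hq o n ht⟩
  rw [ENNReal.tendsto_nhds_zero]
  intro ε hε
  have hε2 : 0 < ε / 2 := ENNReal.half_pos hε.ne'
  obtain ⟨K, hK⟩ := eventually_atTop.1 (ENNReal.tendsto_nhds_zero.1 hq0 _ hε2)
  filter_upwards [ENNReal.tendsto_nhds_zero.1 (tendsto_treeMeasure_age (K + n)) _ hε2] with t ht
  calc ∑' l, SpineList.prob l t * min 1 (q (l.length - n))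
      ≤ ∑' l : List BinTree,
        ({l | l.length < K + n}.indicator (fun l => SpineList.prob l t) l +
          SpineList.prob l t * (ε / 2)) := by
        refine ENNReal.tsum_le_tsum fun l => ?_
        by_cases hl : l ∈ {l : List BinTree | l.length < K + n}
        · rw [Set.indicator_of_mem hl]
          exact le_add_right (mul_le_of_le_one_right' (min_le_left _ _))
        · rw [Set.indicator_of_notMem hl, zero_add]
          gcongr
          refine (min_le_right _ _).trans (hK _ ?_)
          rw [Set.mem_ofPred_eq] at hl
          omega
    _ ≤ ε / 2 + ε / 2 := by
        rw [ENNReal.tsum_add, ENNReal.tsum_mul_right, tsum_spineList_prob, one_mul]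
        gcongr
        exact (tsum_prob_short_le _ t).trans ht
    _ = ε := ENNReal.add_halves ε

/-! ### Convergence in distribution -/

lemma trimmedLaw_isFinite (lam : ℝ≥0) (t : ℝ) : trimmedLaw lam t {c | c.IsFinite} = 1 := by
  rw [trimmedLaw_apply lam t measurableSet_setOf_isFinite]
  have h (l : List BinTree) : spineLaw lam l {c | c.IsFinite} = 1 := by
    rw [spineLaw_apply lam l measurableSet_setOf_isFinite]
    simp [isFinite_spineClass_levelLeaves]
  simp [h, tsum_spineList_prob]

lemma measurable_isoClass_cluster_right (G : RootedMultigraph ℕ) (t : ℝ) :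
    Measurable fun ω : Noise => (G.cluster ω t).isoClass := by
  have hm : Measurable fun ω : Noise => (G, ω) := measurable_prodMk_left
  exact ((measurableGraph_cluster t).comp hm).isoClass

lemma ae_isFinite_cluster_single (lam : ℝ≥0) (o : ℕ) {t : ℝ} (ht : 0 ≤ t) :
    ∀ᵐ ω ∂(noiseMeasure lam), ((RootedMultigraph.single o).cluster ω t).isoClass.IsFinite := by
  have h := (prob_compl_eq_zero_iff (measurable_isoClass_cluster_right (RootedMultigraph.single o) t
    measurableSet_setOf_isFinite)).2 ((measure_cluster_single lam o ht
      measurableSet_setOf_isFinite).trans (trimmedLaw_isFinite lam t))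
  exact h

lemma measure_inter_of_ae {Ω : Type*} [MeasurableSpace Ω] {μ : Measure Ω} {A B : Set Ω}
    (h : ∀ᵐ ω ∂μ, ω ∈ B) : μ (A ∩ B) = μ A :=
  measure_congr (h.mono fun _ hω => propext ⟨fun h => h.1, fun h => ⟨h, hω⟩⟩)

/-- All the laws involved live on classes of finite graphs, and any set of these is measurable;
intersecting with them removes the measurability hypothesis. -/
theorem tendsto_measure_cluster_single (lam : ℝ≥0) (o : ℕ) (S : Set MultigraphClass) :
    Tendsto (fun t : ℝ => noiseMeasure lam
      {ω | ((RootedMultigraph.single o).cluster ω t).isoClass ∈ S}) atTop (𝓝 (limitLaw lam S)) := by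
  have hS : MeasurableSet (S ∩ {c | c.IsFinite}) :=
    MultigraphClass.measurableSet_of_isFinite fun c hc => hc.2
  have hlim : limitLaw lam (S ∩ {c | c.IsFinite}) = limitLaw lam S :=
    measure_inter_of_ae (ae_limitLaw_isFinite lam)
  rw [← hlim]
  refine (tendsto_trimmedLaw lam hS).congr' ?_
  filter_upwards [eventually_ge_atTop 0] with t ht
  rw [← measure_cluster_single lam o ht hS]
  exact measure_inter_of_ae (ae_isFinite_cluster_single lam o ht)

/-! ### Invariance of the limit law -/

lemma eq_of_tendsto_of_close {x L : ℝ≥0∞} {f ε : ℝ → ℝ≥0∞} (hf : Tendsto f atTop (𝓝 L))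
    (hε : Tendsto ε atTop (𝓝 0)) (h1 : ∀ᶠ t in atTop, x ≤ f t + ε t)
    (h2 : ∀ᶠ t in atTop, f t ≤ x + ε t) : x = L := by
  refine le_antisymm ?_ ?_
  · have := hf.add hε
    rw [add_zero] at this
    exact ge_of_tendsto this h1
  · have := (tendsto_const_nhds (x := x)).add hε
    rw [add_zero] at this
    exact le_of_tendsto_of_tendsto hf this h2

/-- The trimmed model at age `s` is the state at time `s` of the process from one vertex, so the
Chapman-Kolmogorov identity gives its state at time `s + t`. -/
lemma measure_cluster_trimmedLeaves (lam : ℝ≥0) (e : TreeVertex ≃ ℕ) {s t : ℝ} (hs : 0 ≤ s)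
    (ht : 0 ≤ t) {S : Set MultigraphClass} (hS : MeasurableSet S) :
    ((treeMeasure.prod (spineField lam)).prod (noiseMeasure lam))
      {p | (((spineGraph (trimmedLeaves p.1.1 s) p.1.2).relabel e).cluster p.2 t).isoClass ∈ S} =
        trimmedLaw lam (s + t) S := by
  have hG : Measurable fun p : ((ℕ → ℝ) × (ℕ × Word → ℝ)) × (Sym2 TreeVertex → ℕ) × Noise =>
      ((spineGraph (trimmedLeaves p.1 s) p.2.1).relabel e, p.2.2) :=
    ((measurableGraph_spineGraph (fun q => measurable_fst (measurableSet_trimmedLeaves s q))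
      (measurable_fst.comp measurable_snd)).relabel e).measurable.prodMk
        (measurable_snd.comp measurable_snd)
  have hA : MeasurableSet
      {p : ((ℕ → ℝ) × (ℕ × Word → ℝ)) × (Sym2 TreeVertex → ℕ) × Noise |
        (((spineGraph (trimmedLeaves p.1 s) p.2.1).relabel e).cluster p.2.2 t).isoClass ∈ S} :=
    (measurable_isoClass_cluster t).comp hG hS
  have h := (measurePreserving_prodAssoc treeMeasure (spineField lam)
    (noiseMeasure lam)).measure_preimage hA.nullMeasurableSet
  refine h.trans ?_
  rw [measure_prod_trimmedSpine _ s hA (B := fun l => {p |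
    (((spineGraph (levelLeaves l) p.1).relabel e).cluster p.2 t).isoClass ∈ S})]
  · simp only [measure_cluster_spineGraph lam _ e ht hS, ← ENNReal.tsum_mul_left]
    rw [ENNReal.tsum_comm, trimmedLaw_apply lam _ hS]
    refine tsum_congr fun m => ?_
    rw [← SpineList.tsum_prob_mul_growProb ht m hs, ← ENNReal.tsum_mul_right]
    exact tsum_congr fun l => (mul_assoc _ _ _).symm
  · intro θ l h hs hc ω
    simp only [Set.mem_ofPred_eq, h.trimmedLeaves_eq hs hc]

lemma cluster_relabel_congr {G H : RootedMultigraph TreeVertex} (h : G.component = H.component)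
    (e : TreeVertex ≃ ℕ) (ω : Noise) (t : ℝ) :
    (G.relabel e).cluster ω t = (H.relabel e).cluster ω t := by
  rw [← RootedMultigraph.cluster_component, RootedMultigraph.relabel_component, h,
    ← RootedMultigraph.relabel_component, RootedMultigraph.cluster_component]

/-- Trimming at a large age `s` probably leaves the initial component, hence the later cluster,
unchanged. The trimmed law at `s + t` has the same limit as at `s`, so the left side, independent of
`s`, equals that limit. -/
lemma measure_cluster_hangingLeaves (lam : ℝ≥0) (e : TreeVertex ≃ ℕ) {t : ℝ} (ht : 0 ≤ t)
    {S : Set MultigraphClass} (hS : MeasurableSet S) :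
    ((treeMeasure.prod (spineField lam)).prod (noiseMeasure lam))
      {p | (((spineGraph (hangingLeaves p.1.1) p.1.2).relabel e).cluster p.2 t).isoClass ∈ S} =
        limitLaw lam S := by
  have hc (s : ℝ) : ((treeMeasure.prod (spineField lam)).prod (noiseMeasure lam))
      ({p | TrimmingChanges s p} ×ˢ Set.univ) =
        (treeMeasure.prod (spineField lam)) {p | TrimmingChanges s p} := by
    rw [Measure.prod_prod, measure_univ, mul_one]
  have hlim : Tendsto (fun s => trimmedLaw lam (s + t) S) atTop (𝓝 (limitLaw lam S)) :=
    (tendsto_trimmedLaw lam hS).comp (tendsto_atTop_add_const_right _ t tendsto_id)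
  refine eq_of_tendsto_of_close hlim (tendsto_measure_trimmingChanges lam) ?_ ?_
  · filter_upwards [eventually_ge_atTop 0] with s hs
    rw [← measure_cluster_trimmedLeaves lam e hs ht hS, ← hc]
    refine (measure_mono fun p hp => ?_).trans (measure_union_le _ _)
    by_cases h : TrimmingChanges s p.1
    · exact Or.inr ⟨h, trivial⟩
    · refine Or.inl ?_
      rw [Set.mem_ofPred_eq] at hp ⊢
      rwa [← cluster_relabel_congr (not_not.1 h)]
  · filter_upwards [eventually_ge_atTop 0] with s hs
    rw [← measure_cluster_trimmedLeaves lam e hs ht hS, ← hc]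
    refine (measure_mono fun p hp => ?_).trans (measure_union_le _ _)
    by_cases h : TrimmingChanges s p.1
    · exact Or.inr ⟨h, trivial⟩
    · refine Or.inl ?_
      rw [Set.mem_ofPred_eq] at hp ⊢
      rwa [cluster_relabel_congr (not_not.1 h)]

/-- The witness lives on graphs labelled by natural numbers; passing to the component first provides
connectedness and does not affect the cluster process. -/
theorem isInvariantLaw_limitLaw (lam : ℝ≥0) : IsInvariantLaw lam (limitLaw lam) := by
  obtain ⟨e, -⟩ := exists_equiv_apply_eq 0
  set P := treeMeasure.prod (spineField lam) with hP
  let Φ : ((ℕ → ℝ) × (ℕ × Word → ℝ)) × (Sym2 TreeVertex → ℕ) → RootedMultigraph ℕ :=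
    fun p => (spineGraph (hangingLeaves p.1) p.2).component.relabel e
  have hG : MeasurableGraph Φ :=
    (measurableGraph_spineGraph (fun q => measurable_fst (measurableSet_hangingLeaves q))
      measurable_snd).component.relabel e
  have hΦ : Measurable Φ := hG.measurable
  have hmap : (P.map Φ).map RootedMultigraph.isoClass = limitLaw lam := by
    rw [Measure.map_map MeasurableGraph.id.isoClass hΦ, limitLaw_eq_map]
    congr 1
    funext p
    exact RootedMultigraph.isoClass_eq_of_iso (RootedMultigraph.iso_relabel e _).symm
  refine ⟨P.map Φ, Measure.isProbabilityMeasure_map hΦ.aemeasurable, ?_, ?_, fun t ht => ?_, hmap⟩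
  · rw [ae_map_iff hΦ.aemeasurable MeasurableGraph.id.connected]
    exact ae_of_all _ fun p =>
      (RootedMultigraph.connected_component _).of_iso (RootedMultigraph.iso_relabel e _)
  · rw [lintegral_map MeasurableGraph.id.rootDegree hΦ]
    simp only [Φ, RootedMultigraph.rootDegree_relabel, RootedMultigraph.rootDegree_component]
    exact (lintegral_rootDegree_hangingLeaves_le lam).trans_lt ENNReal.coe_lt_top
  · refine ⟨(measurable_isoClass_cluster t).aemeasurable,
      MeasurableGraph.id.isoClass.aemeasurable, ?_⟩
    rw [hmap]
    refine Measure.ext fun S hS => ?_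
    have hprod : (P.map Φ).prod (noiseMeasure lam) =
        (P.prod (noiseMeasure lam)).map (Prod.map Φ id) := by
      rw [← Measure.map_prod_map _ _ hΦ measurable_id, Measure.map_id]
    rw [Measure.map_apply (measurable_isoClass_cluster t) hS, hprod,
      Measure.map_apply (hΦ.prodMap measurable_id) (measurable_isoClass_cluster t hS),
      ← measure_cluster_hangingLeaves lam e ht hS]
    congr 1
    ext p
    simp only [Set.mem_preimage, Set.mem_ofPred_eq, Prod.map, Φ, id]
    rw [← RootedMultigraph.relabel_component, RootedMultigraph.cluster_component]

/-! ### Uniqueness of the invariant law -/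

/-- Resample the walk of `x`: given the walk of the root, it makes the same `n` fair choices with
probability 2^-n. -/
lemma measure_initialWord_eq (lam : ℝ≥0) {x : Walker} (hx : x ≠ .root) (n : ℕ) :
    noiseMeasure lam {ω | initialWord (ω.2.2 x) n = initialWord (ω.2.2 .root) n} = 2⁻¹ ^ n := by
  classical
  set W : Measure (Walker → ℕ → Bool) := Measure.infinitePi fun _ => coinMeasure with hW
  have hm : MeasurableSet
      {p : (ℕ → Bool) × (ℕ → Bool) | initialWord p.1 n = initialWord p.2 n} := by
    have : {p : (ℕ → Bool) × (ℕ → Bool) | initialWord p.1 n = initialWord p.2 n} =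
        ⋃ u : Word, {c | initialWord c n = u} ×ˢ {c | initialWord c n = u} := by
      ext p
      simp [eq_comm]
    rw [this]
    exact MeasurableSet.iUnion fun u =>
      (measurableSet_initialWord n u).prod (measurableSet_initialWord n u)
  have hm1 : MeasurableSet
      {f : Walker → ℕ → Bool | initialWord (f x) n = initialWord (f .root) n} :=
    hm.preimage (f := fun f : Walker → ℕ → Bool => (f x, f .root)) (by fun_prop)
  have h1 : noiseMeasure lam {ω | initialWord (ω.2.2 x) n = initialWord (ω.2.2 .root) n} =
      W {f | initialWord (f x) n = initialWord (f .root) n} := by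
    have hsnd : MeasurePreserving (fun ω : Noise => ω.2.2) (noiseMeasure lam) W :=
      (measurePreserving_snd (μ := Measure.infinitePi fun _ : ℕ × Word =>
        poissonMeasure (lam / 2))).comp (measurePreserving_snd
          (μ := Measure.infinitePi fun _ : ℕ × Word => expMeasure 1))
    exact hsnd.measure_preimage hm1.nullMeasurableSet
  have hu : Measurable fun p : (Walker → ℕ → Bool) × (ℕ → Bool) => Function.update p.1 x p.2 := by
    refine measurable_pi_lambda _ fun i => ?_
    by_cases hi : i = x
    · subst hi
      simpa using measurable_snd
    · simp only [Function.update_of_ne hi]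
      fun_prop
  rw [h1, hW, ← map_update_infinitePi (fun _ : Walker => coinMeasure) x, Measure.map_apply hu hm1,
    Measure.prod_apply (hu hm1)]
  have h2 (f : Walker → ℕ → Bool) : coinMeasure (Prod.mk f ⁻¹'
      ((fun p : (Walker → ℕ → Bool) × (ℕ → Bool) => Function.update p.1 x p.2) ⁻¹'
        {f | initialWord (f x) n = initialWord (f .root) n})) = 2⁻¹ ^ n := by
    have h3 := coinMeasure_initialWord (initialWord (f .root) n)
    rw [initialWord_length] at h3
    rw [← h3]
    congr 1
    ext c
    simp [Function.update_of_ne hx.symm]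
  simp only [h2, lintegral_const, measure_univ, mul_one]

/-! ### Coupling with the process started from the root alone -/

namespace RootedMultigraph

/-- One of the initial edges at the root follows the root for `n` splits. -/
def Accompanied (G : RootedMultigraph ℕ) (n : ℕ) (ω : Noise) : Prop :=
  ∃ b, ∃ k < G.mult G.root b,
    initialWord (ω.2.2 (.old G.root b k)) n = initialWord (ω.2.2 .root) n

lemma measure_accompanied_le (lam : ℝ≥0) (G : RootedMultigraph ℕ) (n : ℕ) :
    noiseMeasure lam {ω | G.Accompanied n ω} ≤ G.rootDegree * 2⁻¹ ^ n := by
  have h : {ω | G.Accompanied n ω} = ⋃ b, ⋃ k ∈ Finset.range (G.mult G.root b),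
      {ω : Noise | initialWord (ω.2.2 (.old G.root b k)) n = initialWord (ω.2.2 .root) n} := by
    ext ω
    simp [Accompanied]
  rw [h, rootDegree, ← ENNReal.tsum_mul_right]
  refine (measure_iUnion_le _).trans (ENNReal.tsum_le_tsum fun b => ?_)
  refine (measure_biUnion_finset_le _ _).trans_eq ?_
  simp [measure_initialWord_eq lam]

/-- Without strays, all vertices of the single-vertex cluster share the first `n` choices of the
root. An initial edge ending at one of them would have accompanied the root that long, so none
attaches to this cluster, while the new edges are the same in both processes. -/
lemma cluster_eq_single {G : RootedMultigraph ℕ} {n : ℕ} {ω : Noise} {t : ℝ}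
    (h1 : ¬ Strays G.root n t ω) (h2 : ¬ G.Accompanied n ω) :
    (single G.root).cluster ω t = G.cluster ω t := by
  have hpre (z) (hz : ((single G.root).full ω t).Reachable z) :
      initialWord (ω.2.2 .root) n <+: z.2 := by
    by_contra h
    exact h1 ⟨z, hz, h⟩
  have hroot (z) (hz : ((single G.root).full ω t).Reachable z) : z.1 = G.root := by
    rcases hz.mem_verts with h | h
    · rw [h]
      rfl
    · exact h.1
  refine component_congr {z | ((single G.root).full ω t).Reachable z} rfl (reachable_root _)
    (fun x hx y => ?_) fun x hx y hxy => hx.of_mult hxy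
  have hold : G.oldEdges ω x y = ∅ := by
    refine Set.eq_empty_of_forall_notMem fun k hk => h2 ?_
    obtain ⟨hk, hf, -⟩ := hk
    rw [hroot x hx] at hk hf
    refine ⟨y.1, k, hk, ?_⟩
    rw [follows_nil_iff] at hf
    have hp := hpre x hx
    rw [← hf] at hp
    refine (List.IsPrefix.eq_of_length ?_ (by simp [initialWord_length])).symm
    have hn : n ≤ x.2.length := by simpa [initialWord_length] using hp.length_le
    refine List.prefix_of_prefix_length_le hp ?_ (by simp [initialWord_length])
    obtain ⟨m, hm⟩ := Nat.exists_eq_add_of_le hn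
    rw [hm, initialWord, initialWord, List.range_add, List.map_append]
    exact List.prefix_append _ _
  have hold' : (single G.root).oldEdges ω x y = ∅ :=
    Set.eq_empty_of_forall_notMem fun k hk => Nat.not_lt_zero k hk.1
  have hnew : (single G.root).newEdges ω x y = G.newEdges ω x y := by
    ext k
    have h1 : x.1 ∈ (single G.root).verts := hroot x hx
    have h2 : x.1 ∈ G.verts := by
      rw [hroot x hx]
      exact G.root_mem
    simp only [newEdges, Set.mem_ofPred_eq, h1, h2]
  simp only [full, hold, hold', hnew]

lemma measure_cluster_ne_single_le {lam : ℝ≥0} (G : RootedMultigraph ℕ) {n : ℕ} {t : ℝ} {b : ℝ≥0∞}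
    (hb : noiseMeasure lam {ω | Strays G.root n t ω} ≤ b) :
    noiseMeasure lam {ω | (single G.root).cluster ω t ≠ G.cluster ω t} ≤
      b + G.rootDegree * 2⁻¹ ^ n := by
  refine (measure_mono fun ω hω => ?_).trans ((measure_union_le _ _).trans
    (add_le_add hb (measure_accompanied_le lam G n)))
  by_contra h
  simp only [Set.mem_union, Set.mem_ofPred_eq, not_or] at h
  exact hω (cluster_eq_single h.1 h.2)

end RootedMultigraph

theorem IsInvariantLaw.eq_limitLaw {lam : ℝ≥0} {ν : Measure MultigraphClass}
    (h : IsInvariantLaw lam ν) : ν = limitLaw lam := by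
  obtain ⟨μ, hμ, -, hdeg, hinv, rfl⟩ := h
  refine Measure.ext fun S hS => ?_
  set D := ∫⁻ G, G.rootDegree ∂μ with hD
  have hν {t : ℝ} (ht : 0 ≤ t) : μ.map RootedMultigraph.isoClass S =
      ∫⁻ G, noiseMeasure lam {ω | (G.cluster ω t).isoClass ∈ S} ∂μ := by
    rw [← (hinv t ht).map_eq, Measure.map_apply (measurable_isoClass_cluster t) hS,
      Measure.prod_apply (measurable_isoClass_cluster t hS)]
    rfl
  have hint (n : ℕ) (b : ℝ≥0∞) : ∫⁻ G, (b + G.rootDegree * 2⁻¹ ^ n) ∂μ = b + D * 2⁻¹ ^ n := by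
    rw [lintegral_add_left measurable_const,
      lintegral_mul_const _ MeasurableGraph.id.rootDegree]
    simp [hD]
  -- From a single vertex the law at time `t` is the same for every label, so averaging over the
  -- random root changes nothing; the error is the averaged coupling bound.
  have hclose (n : ℕ) : ∃ b : ℝ → ℝ≥0∞, Tendsto b atTop (𝓝 0) ∧ ∀ t, 0 ≤ t →
      μ.map RootedMultigraph.isoClass S ≤ trimmedLaw lam t S + (b t + D * 2⁻¹ ^ n) ∧
      trimmedLaw lam t S ≤ μ.map RootedMultigraph.isoClass S + (b t + D * 2⁻¹ ^ n) := by
    obtain ⟨b, hb0, hb⟩ := tendsto_measure_strays lam n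
    refine ⟨b, hb0, fun t ht => ?_⟩
    have hne (G : RootedMultigraph ℕ) := G.measure_cluster_ne_single_le (hb t ht G.root)
    have hconst : ∫⁻ _ : RootedMultigraph ℕ, trimmedLaw lam t S ∂μ = trimmedLaw lam t S := by
      simp
    rw [hν ht, ← hint n (b t), ← hconst]
    constructor
    · rw [← lintegral_add_left measurable_const]
      refine lintegral_mono fun G => ?_
      rw [← measure_cluster_single lam G.root ht hS]
      refine le_trans ((measure_mono fun ω hω => ?_).trans (measure_union_le _ _))
        (add_le_add le_rfl (hne G))
      by_cases h : (RootedMultigraph.single G.root).cluster ω t = G.cluster ω t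
      · refine Or.inl ?_
        rw [Set.mem_ofPred_eq] at hω ⊢
        rwa [h]
      · exact Or.inr h
    · have hm : Measurable fun G : RootedMultigraph ℕ => b t + G.rootDegree * 2⁻¹ ^ n :=
        measurable_const.add (MeasurableGraph.id.rootDegree.mul_const _)
      rw [← lintegral_add_right _ hm]
      refine lintegral_mono fun G => ?_
      rw [← measure_cluster_single lam G.root ht hS]
      refine le_trans ((measure_mono fun ω hω => ?_).trans (measure_union_le _ _))
        (add_le_add le_rfl (hne G))
      by_cases h : (RootedMultigraph.single G.root).cluster ω t = G.cluster ω t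
      · refine Or.inl ?_
        rw [Set.mem_ofPred_eq] at hω ⊢
        rwa [← h]
      · exact Or.inr h
  -- Finite expected root degree is what makes this error vanish. For fixed `n` the time goes to
  -- infinity first, and only then does `n`.
  have hpow : Tendsto (fun n : ℕ => D * (2⁻¹ : ℝ≥0∞) ^ n) atTop (𝓝 0) := by
    have := ENNReal.Tendsto.const_mul (a := D) (ENNReal.tendsto_pow_atTop_nhds_zero_of_lt_one
      (r := 2⁻¹) (by norm_num)) (Or.inr hdeg.ne)
    rwa [mul_zero] at this
  refine le_antisymm ?_ ?_
  · refine ge_of_tendsto' (x := atTop) (f := fun n : ℕ => limitLaw lam S + D * 2⁻¹ ^ n) ?_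
      fun n => ?_
    · simpa using hpow.const_add (limitLaw lam S)
    · obtain ⟨b, hb0, hb⟩ := hclose n
      have := (tendsto_trimmedLaw lam hS).add (hb0.add_const (D * 2⁻¹ ^ n))
      rw [zero_add] at this
      refine ge_of_tendsto this ?_
      filter_upwards [eventually_ge_atTop 0] with t ht using (hb t ht).1
  · refine ge_of_tendsto'
      (x := atTop) (f := fun n : ℕ => μ.map RootedMultigraph.isoClass S + D * 2⁻¹ ^ n) ?_
      fun n => ?_
    · simpa using hpow.const_add (μ.map RootedMultigraph.isoClass S)
    · obtain ⟨b, hb0, hb⟩ := hclose n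
      have := (hb0.add_const (D * 2⁻¹ ^ n)).const_add (μ.map RootedMultigraph.isoClass S)
      rw [zero_add] at this
      refine le_of_tendsto_of_tendsto (tendsto_trimmedLaw lam hS) this ?_
      filter_upwards [eventually_ge_atTop 0] with t ht using (hb t ht).2

theorem theorem1 (lam : ℝ≥0) (hlam : 0 < lam) :
    (∃! ν : Measure MultigraphClass, IsInvariantLaw lam ν) ∧
    IsInvariantLaw lam (limitLaw lam) ∧
    (∀ᵐ c ∂(limitLaw lam), c.IsFinite) ∧
    (∀ S : Set MultigraphClass,
      Tendsto
        (fun t : ℝ => noiseMeasure lam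
          {ω | ((RootedMultigraph.single (0 : ℕ)).cluster ω t).isoClass ∈ S})
        atTop (𝓝 (limitLaw lam S))) :=
  ⟨⟨limitLaw lam, isInvariantLaw_limitLaw lam, fun _ h => h.eq_limitLaw⟩,
    isInvariantLaw_limitLaw lam, ae_limitLaw_isFinite lam,
    tendsto_measure_cluster_single lam 0⟩
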